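/- A combinatorial graph consists of finite sets $V$ of vertices and $H$ of half-edges, a source map $s:H\to V$ and a fixed-point free involution $i:H\to H$; the valence $\mathrm{val}(v)$ of a vertex is the number of half-edges with source $v$, and both maps are extended to $V\sqcup H$ by the identity on $V$. A fat graph is a connected combinatorial graph with a cyclic ordering of the half-edges at every vertex, i.e. a permutation $\sigma$ of $H$ whose cycles are the sets of half-edges at the vertices. Its boundary cycles are the cycles of $\omega=\sigma\circ i$. A bordered fat graph $\Gamma$ is a fat graph with $n\ge 1$ ordered boundary cycles, with exactly one leaf (univalent vertex) in each boundary cycle, and with all other vertices (the interior vertices) of valence at least $3$; its leaves are thus ordered. Its dimension is $\dim\Gamma=\sum_{v}(\mathrm{val}(v)-3)$, summed over the interior vertices. A morphism of bordered fat graphs is a map $V\sqcup H\to V'\sqcup H'$ that commutes with $s$ and $i$, under which the preimage of every vertex is a tree and the preimage of every half-edge contains exactly one half-edge, such that $\omega'$ is obtained from $\omega$ by skipping the half-edges that are sent to vertices, and that sends the $j$-th leaf to the $j$-th leaf. Two bordered fat graphs are related by at most one isomorphism. Let $\mathrm{Fat}^b$ be the category whose objects are the isomorphism classes $[\Gamma]$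 of bordered fat graphs and whose morphisms are the equivalence classes of morphisms, two morphisms being equivalent when they are the horizontal sides of a commutative square whose vertical sides are isomorphisms. Let $\mathcal F^p\mathrm{Fat}^b\subset \mathrm{Fat}^b$ be the full subcategory of the classes of dimension at most $p$, and let $|\mathcal C|$ denote the geometric realization of the nerve of a category $\mathcal C$. For $k\ge 3$ let $\mathcal T^k$ be the category, defined in the same way, of isomorphism classes of planar trees with $k$ cyclically ordered leaves and all other vertices at least trivalent, with morphisms the collapses of interior edges preserving the leaves; $|\mathcal T^k|$ is the Stasheff associahedron of dimension $k-3$. **Theorem.** The Hausdorff space $|\mathrm{Fat}^b|$ has a CW structure with the following properties. 1. The $p$-cells are in bijection with the isomorphism classes $[\Gamma]$ of bordered fat graphs of dimension $p$. 2. For every $p\ge 0$ the map $|\mathcal F^p\mathrm{Fat}^b|\to|\mathrm{Fat}^b|$ induced by the inclusion is a closed embedding whose image is the $p$-skeleton. 3. For $[\Gamma]$ of dimension $p$ there is a homeomorphism from the closed $p$-ball to $|\mathrm{Fat}^b/[\Gamma]|$ that carries the boundary sphere onto the realization of the full subcategory of the non-invertible morphisms $[\tilde\Gamma]\to[\Gamma]$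 (those that collapse at least one edge). The characteristic map of the cell of $[\Gamma]$ is this homeomorphism followed by the map $|\mathrm{Fat}^b/[\Gamma]|\to|\mathrm{Fat}^b|$ induced by the forgetful functor. 4. For every $\Gamma$ there is an isomorphism of categories $\mathrm{Fat}^b/[\Gamma]\cong\prod_v\mathcal T^{\mathrm{val}(v)}$, the product over the interior vertices $v$ of $\Gamma$, such that the induced map $|\mathrm{Fat}^b/[\Gamma]|\to\prod_v|\mathcal T^{\mathrm{val}(v)}|$ is a homeomorphism; so the cell of $[\Gamma]$ is a product of Stasheff associahedra. -/

import Mathlib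

open CategoryTheory Set

/-! ### Finite combinatorial graphs -/

/-- A finite combinatorial graph: finite sets of vertices and of half-edges, the source map `s`
and a fixed-point free involution `i` exchanging the two halves of every edge. -/
structure CombGraph where
  V : Type
  H : Type
  finV : Finite V
  finH : Finite H
  s : H → V
  i : H → H
  i_i : ∀ A, i (i A) = A
  i_ne : ∀ A, i A ≠ A

namespace CombGraph

attribute [instance] CombGraph.finV CombGraph.finH

variable (G : CombGraph)

/-- Vertices and half-edges together. -/
abbrev Elt := G.V ⊕ G.H

/-- The source map, extended by the identity on vertices. -/
def sExt : G.Elt → G.Elt := Sum.elim Sum.inl (fun A => Sum.inl (G.s A))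

/-- The involution, extended by the identity on vertices. -/
def iExt : G.Elt → G.Elt := Sum.elim Sum.inl (fun A => Sum.inr (G.i A))

/-- The involution as a permutation. -/
def iPerm : Equiv.Perm G.H := Function.Involutive.toPerm G.i G.i_i

/-- The valence of a vertex: the number of half-edges incident to it. -/
noncomputable def val (v : G.V) : ℕ := Nat.card {A : G.H // G.s A = v}

/-- One can walk from `u` to `v` along edges that lie in `S`. -/
def Walk (S : Set G.Elt) : G.V → G.V → Prop :=
  Relation.ReflTransGen (fun u v => ∃ A, Sum.inr A ∈ S ∧ G.s A = u ∧ G.s (G.i A) = v)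

/-- `S` is a non-empty subgraph all of whose vertices can be joined by walks inside `S`. -/
structure IsConnectedSubgraph (S : Set G.Elt) : Prop where
  s_mem : ∀ x ∈ S, G.sExt x ∈ S
  i_mem : ∀ x ∈ S, G.iExt x ∈ S
  nonempty : ∃ v, Sum.inl v ∈ S
  walk : ∀ u v, Sum.inl u ∈ S → Sum.inl v ∈ S → G.Walk S u v

/-- `S` is a tree: a connected subgraph with one more vertex than edges (equivalently, a subgraph
with contractible realization).  The number of edges is half the number of half-edges. -/
structure IsTree (S : Set G.Elt) : Prop extends G.IsConnectedSubgraph S where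
  euler : 2 * Nat.card {v : G.V // Sum.inl v ∈ S} = Nat.card {A : G.H // Sum.inr A ∈ S} + 2

end CombGraph

/-! ### Fat graphs with labelled leaves -/

/-- A connected fat graph whose univalent vertices (leaves) are numbered `0, …, n - 1`, with
`n ≥ 1`, and all of whose other vertices are at least trivalent.  The fat structure is encoded by
the permutation `σ` of the half-edges whose cycles are the sets of half-edges at the vertices. -/
structure LeafedFatGraph extends CombGraph where
  connected : toCombGraph.IsConnectedSubgraph Set.univ
  σ : Equiv.Perm H
  s_σ : ∀ A, s (σ A) = s A
  cyclic : ∀ A B, s A = s B → σ.SameCycle A B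
  n : ℕ
  n_pos : 0 < n
  leaf : Fin n → V
  leaf_injective : Function.Injective leaf
  val_leaf : ∀ j, toCombGraph.val (leaf j) = 1
  three_le_val : ∀ v, v ∉ Set.range leaf → 3 ≤ toCombGraph.val v

namespace LeafedFatGraph

/-- The permutation `ω = σ ∘ i`, whose orbits are the boundary cycles. -/
def ω (Γ : LeafedFatGraph) : Equiv.Perm Γ.H := Γ.σ * Γ.iPerm

lemma ω_apply (Γ : LeafedFatGraph) (A : Γ.H) : Γ.ω A = Γ.σ (Γ.i A) := rfl

/-- Interior vertices are those that are not leaves. -/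
abbrev Interior (Γ : LeafedFatGraph) := {v : Γ.V // v ∉ Set.range Γ.leaf}

/-- The dimension: the sum over the interior vertices of valence minus three. -/
noncomputable def dim (Γ : LeafedFatGraph) : ℕ := ∑ᶠ v : Γ.Interior, (Γ.val v.1 - 3)

/-- A morphism: a map on vertices and half-edges commuting with `s` and `i`, such that the preimage
of a vertex is a tree, a half-edge has exactly one half-edge over it, the boundary permutation of
the target is obtained from that of the source by skipping the half-edges that are sent to vertices,
and the `j`-th leaf is sent to the `j`-th leaf. -/
@[ext]
structure Hom (Γ Δ : LeafedFatGraph) where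
  toFun : Γ.Elt → Δ.Elt
  map_s : ∀ x, toFun (Γ.sExt x) = Δ.sExt (toFun x)
  map_i : ∀ x, toFun (Γ.iExt x) = Δ.iExt (toFun x)
  tree : ∀ w : Δ.V, Γ.IsTree (toFun ⁻¹' {Sum.inl w})
  single : ∀ B : Δ.H, ∃! A : Γ.H, toFun (Sum.inr A) = Sum.inr B
  map_ω : ∀ A B, toFun (Sum.inr A) = Sum.inr B → ∃ k, 0 < k ∧
    toFun (Sum.inr ((Γ.ω ^ k) A)) = Sum.inr (Δ.ω B) ∧
    ∀ j, 0 < j → j < k → ∃ w, toFun (Sum.inr ((Γ.ω ^ j) A)) = Sum.inl w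
  n_eq : Γ.n = Δ.n
  map_leaf : ∀ j, toFun (Sum.inl (Γ.leaf j)) = Sum.inl (Δ.leaf (Fin.cast n_eq j))

namespace Hom

variable {Γ Δ Λ : LeafedFatGraph}

lemma map_inl (f : Hom Γ Δ) (v : Γ.V) : ∃ w, f.toFun (Sum.inl v) = Sum.inl w := by
  have h := f.map_s (Sum.inl v)
  rcases hx : f.toFun (Sum.inl v) with w | B
  · exact ⟨w, rfl⟩
  · simp [CombGraph.sExt, hx] at h

/-- The induced map on vertices. -/
noncomputable def onV (f : Hom Γ Δ) (v : Γ.V) : Δ.V := (f.map_inl v).choose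

lemma inl_onV (f : Hom Γ Δ) (v : Γ.V) : f.toFun (Sum.inl v) = Sum.inl (f.onV v) :=
  (f.map_inl v).choose_spec

lemma s_of_inr (f : Hom Γ Δ) {A : Γ.H} {B : Δ.H} (h : f.toFun (Sum.inr A) = Sum.inr B) :
    f.onV (Γ.s A) = Δ.s B := by
  have := f.map_s (Sum.inr A)
  simpa [CombGraph.sExt, h, f.inl_onV] using this

lemma s_of_inl (f : Hom Γ Δ) {A : Γ.H} {w : Δ.V} (h : f.toFun (Sum.inr A) = Sum.inl w) :
    f.onV (Γ.s A) = w := by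
  have := f.map_s (Sum.inr A)
  simpa [CombGraph.sExt, h, f.inl_onV] using this

lemma i_of_inr (f : Hom Γ Δ) {A : Γ.H} {B : Δ.H} (h : f.toFun (Sum.inr A) = Sum.inr B) :
    f.toFun (Sum.inr (Γ.i A)) = Sum.inr (Δ.i B) := by
  have := f.map_i (Sum.inr A)
  simpa [CombGraph.iExt, h] using this

/-- Inside the preimage of a subgraph one can walk between any two vertices lying over the ends of
a walk. -/
lemma walk_preimage (f : Hom Γ Δ) {S : Set Δ.Elt} (hS : Δ.IsConnectedSubgraph S)
    {a b : Δ.V} (ha : Sum.inl a ∈ S) (h : Δ.Walk S a b) :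
    Sum.inl b ∈ S ∧ ∀ u v, f.onV u = a → f.onV v = b → Γ.Walk (f.toFun ⁻¹' S) u v := by
  have fibre : ∀ {c : Δ.V}, Sum.inl c ∈ S → ∀ u v, f.onV u = c → f.onV v = c →
      Γ.Walk (f.toFun ⁻¹' S) u v := by
    intro c hc u v hu hv
    have hw : Γ.Walk _ u v :=
      (f.tree c).walk u v (by simp [f.inl_onV, hu]) (by simp [f.inl_onV, hv])
    refine Relation.ReflTransGen.mono ?_ _ _ hw
    rintro x y ⟨A, hA, h1, h2⟩
    refine ⟨A, ?_, h1, h2⟩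
    have hA' : f.toFun (Sum.inr A) = Sum.inl c := hA
    simpa [hA'] using hc
  induction h with
  | refl => exact ⟨ha, fibre ha⟩
  | @tail c d _ hcd ih =>
    obtain ⟨B, hB, rfl, rfl⟩ := hcd
    have hd : Sum.inl (Δ.s (Δ.i B)) ∈ S := hS.s_mem _ (hS.i_mem _ hB)
    refine ⟨hd, fun u v hu hv => ?_⟩
    obtain ⟨A, hA, -⟩ := f.single B
    have h1 := ih.2 u (Γ.s A) hu (f.s_of_inr hA)
    have h2 := fibre hd (Γ.s (Γ.i A)) v (f.s_of_inr (f.i_of_inr hA)) hv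
    exact (h1.tail ⟨A, by simpa [hA] using hB, rfl, rfl⟩).trans h2

lemma card_V_preimage (f : Hom Γ Δ) (S : Set Δ.Elt) :
    Nat.card {v : Γ.V // Sum.inl v ∈ f.toFun ⁻¹' S} =
      Nat.card (Σ w : {w : Δ.V // Sum.inl w ∈ S},
        {v : Γ.V // Sum.inl v ∈ f.toFun ⁻¹' {Sum.inl w.1}}) := by
  symm
  refine Nat.card_eq_of_bijective (fun x => ⟨x.2.1, ?_⟩) ⟨?_, ?_⟩
  · have h : f.toFun (Sum.inl x.2.1) = Sum.inl x.1.1 := x.2.2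
    simpa [h] using x.1.2
  · rintro ⟨⟨w, hw⟩, ⟨v, hv⟩⟩ ⟨⟨w', hw'⟩, ⟨v', hv'⟩⟩ h
    obtain rfl : v = v' := by simpa using h
    have h1 : f.toFun (Sum.inl v) = Sum.inl w := hv
    have h2 : f.toFun (Sum.inl v) = Sum.inl w' := hv'
    obtain rfl : w = w' := by simpa [h1] using h2
    rfl
  · rintro ⟨v, hv⟩
    refine ⟨⟨⟨f.onV v, ?_⟩, ⟨v, ?_⟩⟩, rfl⟩
    · simpa [f.inl_onV] using hv
    · simp [f.inl_onV]

lemma card_H_preimage (f : Hom Γ Δ) (S : Set Δ.Elt) :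
    Nat.card {A : Γ.H // Sum.inr A ∈ f.toFun ⁻¹' S} =
      Nat.card ((Σ w : {w : Δ.V // Sum.inl w ∈ S},
        {A : Γ.H // Sum.inr A ∈ f.toFun ⁻¹' {Sum.inl w.1}}) ⊕ {B : Δ.H // Sum.inr B ∈ S}) := by
  symm
  choose g hg hg' using f.single
  refine Nat.card_eq_of_bijective
    (Sum.elim (fun x => ⟨x.2.1, ?_⟩) (fun B => ⟨g B.1, ?_⟩)) ⟨?_, ?_⟩
  · have h : f.toFun (Sum.inr x.2.1) = Sum.inl x.1.1 := x.2.2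
    simpa [h] using x.1.2
  · simpa [hg] using B.2
  · rintro (⟨⟨w, hw⟩, ⟨v, hv⟩⟩ | ⟨B, hB⟩) (⟨⟨w', hw'⟩, ⟨v', hv'⟩⟩ | ⟨B', hB'⟩) h
    · obtain rfl : v = v' := by simpa using h
      have h1 : f.toFun (Sum.inr v) = Sum.inl w := hv
      have h2 : f.toFun (Sum.inr v) = Sum.inl w' := hv'
      obtain rfl : w = w' := by simpa [h1] using h2
      rfl
    · obtain rfl : v = g B' := by simpa using h
      have h1 : f.toFun (Sum.inr (g B')) = Sum.inl w := hv
      simp [hg] at h1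
    · obtain rfl : g B = v' := by simpa using h
      have h1 : f.toFun (Sum.inr (g B)) = Sum.inl w' := hv'
      simp [hg] at h1
    · have h1 : g B = g B' := by simpa using h
      have h2 := hg B
      rw [h1, hg] at h2
      obtain rfl : B' = B := by simpa using h2
      rfl
  · rintro ⟨A, hA⟩
    have hA' : f.toFun (Sum.inr A) ∈ S := hA
    rcases hx : f.toFun (Sum.inr A) with w | B
    · rw [hx] at hA'
      exact ⟨Sum.inl ⟨⟨w, hA'⟩, ⟨A, hx⟩⟩, rfl⟩
    · rw [hx] at hA'
      refine ⟨Sum.inr ⟨B, hA'⟩, ?_⟩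
      simp [hg' B A hx]

/-- The preimage of a tree is a tree. -/
lemma isTree_preimage (f : Hom Γ Δ) {S : Set Δ.Elt} (hS : Δ.IsTree S) :
    Γ.IsTree (f.toFun ⁻¹' S) where
  s_mem x hx := by
    show f.toFun _ ∈ S
    rw [f.map_s]
    exact hS.s_mem _ hx
  i_mem x hx := by
    show f.toFun _ ∈ S
    rw [f.map_i]
    exact hS.i_mem _ hx
  nonempty := by
    obtain ⟨w, hw⟩ := hS.nonempty
    obtain ⟨v, hv⟩ := (f.tree w).nonempty
    have hv' : f.toFun (Sum.inl v) = Sum.inl w := hv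
    exact ⟨v, by simpa [hv'] using hw⟩
  walk u v hu hv := by
    have hu' : f.toFun (Sum.inl u) ∈ S := hu
    have hv' : f.toFun (Sum.inl v) ∈ S := hv
    rw [f.inl_onV] at hu' hv'
    exact (f.walk_preimage hS.toIsConnectedSubgraph hu' (hS.walk _ _ hu' hv')).2 u v rfl rfl
  euler := by
    classical
    have := Fintype.ofFinite {w : Δ.V // Sum.inl w ∈ S}
    rw [f.card_V_preimage S, f.card_H_preimage S, Nat.card_sum, Nat.card_sigma, Nat.card_sigma,
      Finset.mul_sum, Finset.sum_congr rfl (fun w _ => (f.tree w.1).euler),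
      Finset.sum_add_distrib]
    have h := hS.euler
    simp only [Finset.sum_const, Finset.card_univ, smul_eq_mul, ← Nat.card_eq_fintype_card]
    omega

/-- The identity morphism. -/
def id (Γ : LeafedFatGraph) : Hom Γ Γ where
  toFun := _root_.id
  map_s _ := rfl
  map_i _ := rfl
  tree w :=
    { s_mem := by rintro x rfl; rfl
      i_mem := by rintro x rfl; rfl
      nonempty := ⟨w, rfl⟩
      walk := by
        intro u v hu hv
        obtain rfl : u = w := by simpa using hu
        obtain rfl : v = u := by simpa using hv
        exact .refl
      euler := by simp }
  single B := ⟨B, rfl, fun A hA => by simpa using hA⟩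
  map_ω A B h := by
    obtain rfl : A = B := by simpa using h
    exact ⟨1, one_pos, rfl, fun j h1 h2 => by omega⟩
  n_eq := rfl
  map_leaf _ := rfl

/-- Iterating the boundary permutation downstairs amounts to iterating it upstairs and skipping
collapsed half-edges. -/
lemma map_ω_pow (f : Hom Γ Δ) {A : Γ.H} {B : Δ.H} (h : f.toFun (Sum.inr A) = Sum.inr B) (m : ℕ)
    (hm : 0 < m) : ∃ k, 0 < k ∧ f.toFun (Sum.inr ((Γ.ω ^ k) A)) = Sum.inr ((Δ.ω ^ m) B) ∧
      ∀ j, 0 < j → j < k → (∃ w, f.toFun (Sum.inr ((Γ.ω ^ j) A)) = Sum.inl w) ∨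
        ∃ l, 0 < l ∧ l < m ∧ f.toFun (Sum.inr ((Γ.ω ^ j) A)) = Sum.inr ((Δ.ω ^ l) B) := by
  induction m, hm using Nat.le_induction with
  | base =>
    obtain ⟨k, hk, h1, h2⟩ := f.map_ω A B h
    exact ⟨k, hk, by simpa using h1, fun j hj hjk => Or.inl (h2 j hj hjk)⟩
  | succ m hm ih =>
    obtain ⟨k, hk, h1, h2⟩ := ih
    obtain ⟨k', hk', h1', h2'⟩ := f.map_ω _ _ h1
    refine ⟨k' + k, by omega, ?_, ?_⟩
    · rw [pow_add, Equiv.Perm.mul_apply, h1', pow_succ', Equiv.Perm.mul_apply]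
    · intro j hj hjk
      rcases lt_trichotomy j k with hlt | rfl | hgt
      · rcases h2 j hj hlt with h3 | ⟨l, hl, hlm, h3⟩
        · exact Or.inl h3
        · exact Or.inr ⟨l, hl, by omega, h3⟩
      · exact Or.inr ⟨m, hm, by omega, h1⟩
      · obtain ⟨i, rfl⟩ := Nat.exists_eq_add_of_lt hgt
        obtain ⟨w, hw⟩ := h2' (i + 1) (by omega) (by omega)
        refine Or.inl ⟨w, ?_⟩
        rw [← hw, ← Equiv.Perm.mul_apply, ← pow_add]
        congr 4
        omega

/-- Composition of morphisms. -/
def comp (f : Hom Γ Δ) (g : Hom Δ Λ) : Hom Γ Λ where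
  toFun := g.toFun ∘ f.toFun
  map_s x := by simp [f.map_s, g.map_s]
  map_i x := by simp [f.map_i, g.map_i]
  tree w := f.isTree_preimage (g.tree w)
  single C := by
    obtain ⟨B, hB, hB'⟩ := g.single C
    obtain ⟨A, hA, hA'⟩ := f.single B
    refine ⟨A, by simp [hA, hB], fun A₁ h => hA' _ ?_⟩
    rcases hx : f.toFun (Sum.inr A₁) with w | B₁
    · simp [hx, g.inl_onV] at h
    · rw [← hB' B₁ (by simpa [hx] using h), hx]
  map_ω A C h := by
    rcases hx : f.toFun (Sum.inr A) with w | B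
    · simp [hx, g.inl_onV] at h
    · have hg : g.toFun (Sum.inr B) = Sum.inr C := by simpa [hx] using h
      obtain ⟨m, hm, h1, h2⟩ := g.map_ω B C hg
      obtain ⟨k, hk, h3, h4⟩ := f.map_ω_pow hx m hm
      refine ⟨k, hk, by simp [h3, h1], fun j hj hjk => ?_⟩
      rcases h4 j hj hjk with ⟨w, hw⟩ | ⟨l, hl, hlm, h5⟩
      · exact ⟨g.onV w, by simp [hw, g.inl_onV]⟩
      · obtain ⟨w, hw⟩ := h2 l hl hlm
        exact ⟨w, by simp [h5, hw]⟩
  n_eq := f.n_eq.trans g.n_eq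
  map_leaf j := by simp [f.map_leaf, g.map_leaf]

end Hom

instance : Category LeafedFatGraph where
  Hom := Hom
  id := Hom.id
  comp := Hom.comp

lemma toFun_comp {Γ Δ Λ : LeafedFatGraph} (f : Γ ⟶ Δ) (g : Δ ⟶ Λ) (x : Γ.Elt) :
    Hom.toFun (f ≫ g) x = Hom.toFun g (Hom.toFun f x) := rfl

lemma toFun_id {Γ : LeafedFatGraph} (x : Γ.Elt) : Hom.toFun (𝟙 Γ) x = x := rfl

section Iso

variable {Γ Δ : LeafedFatGraph} (e : Γ ≅ Δ)

lemma inv_hom_apply (x : Γ.Elt) : Hom.toFun e.inv (Hom.toFun e.hom x) = x := by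
  rw [← toFun_comp, e.hom_inv_id, toFun_id]

lemma hom_inv_apply (x : Δ.Elt) : Hom.toFun e.hom (Hom.toFun e.inv x) = x := by
  rw [← toFun_comp, e.inv_hom_id, toFun_id]

lemma iso_inr (A : Γ.H) : ∃ B, Hom.toFun e.hom (Sum.inr A) = Sum.inr B := by
  rcases hx : Hom.toFun e.hom (Sum.inr A) with w | B
  · have h := inv_hom_apply e (Sum.inr A)
    rw [hx, Hom.inl_onV] at h
    simp at h
  · exact ⟨B, rfl⟩

/-- The map of half-edges underlying an isomorphism. -/
noncomputable def onH (A : Γ.H) : Δ.H := (iso_inr e A).choose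

lemma inr_onH (A : Γ.H) : Hom.toFun e.hom (Sum.inr A) = Sum.inr (onH e A) :=
  (iso_inr e A).choose_spec

lemma onV_bijective : Function.Bijective (Hom.onV e.hom) := by
  constructor
  · intro u v h
    have := congrArg (Hom.toFun e.inv) (congrArg (Sum.inl (β := Δ.H)) h)
    simpa [← Hom.inl_onV, inv_hom_apply] using this
  · intro w
    refine ⟨Hom.onV e.inv w, ?_⟩
    have := hom_inv_apply e (Sum.inl w)
    simpa [Hom.inl_onV] using this

lemma onH_injective : Function.Injective (onH e) := by
  intro A B h
  have := congrArg (Hom.toFun e.inv) (congrArg (Sum.inr (α := Δ.V)) h)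
  simpa [← inr_onH, inv_hom_apply] using this

lemma s_onH (A : Γ.H) : Δ.s (onH e A) = Hom.onV e.hom (Γ.s A) :=
  (Hom.s_of_inr e.hom (inr_onH e A)).symm

lemma i_onH (A : Γ.H) : onH e (Γ.i A) = Δ.i (onH e A) := by
  have := Hom.i_of_inr e.hom (inr_onH e A)
  simpa [inr_onH] using this

lemma ω_onH (A : Γ.H) : onH e (Γ.ω A) = Δ.ω (onH e A) := by
  obtain ⟨k, hk, h1, h2⟩ := Hom.map_ω e.hom A _ (inr_onH e A)
  obtain rfl : k = 1 := by
    by_contra hne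
    obtain ⟨w, hw⟩ := h2 1 one_pos (by omega)
    simp [inr_onH] at hw
  simpa [inr_onH] using h1

lemma σ_onH (A : Γ.H) : onH e (Γ.σ A) = Δ.σ (onH e A) := by
  have := ω_onH e (Γ.i A)
  rwa [ω_apply, Γ.i_i, ω_apply, i_onH, Δ.i_i] at this

lemma val_onV (v : Γ.V) : Δ.val (Hom.onV e.hom v) = Γ.val v := by
  symm
  refine Nat.card_eq_of_bijective (fun A => ⟨onH e A.1, by rw [s_onH, A.2]⟩) ⟨?_, ?_⟩
  · intro A B h
    exact Subtype.ext (onH_injective e (by simpa using h))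
  · rintro ⟨B, hB⟩
    have hB' : Hom.toFun e.hom (Sum.inr (onH e.symm B)) = Sum.inr B := by
      have := hom_inv_apply e (Sum.inr B)
      rwa [show Hom.toFun e.inv (Sum.inr B) = _ from inr_onH e.symm B] at this
    have hB2 : onH e (onH e.symm B) = B := by simpa [inr_onH] using hB'
    refine ⟨⟨onH e.symm B, ?_⟩, Subtype.ext hB2⟩
    apply (onV_bijective e).1
    rw [← s_onH, hB2, hB]

lemma onV_mem_leaf (v : Γ.V) :
    Hom.onV e.hom v ∈ Set.range Δ.leaf ↔ v ∈ Set.range Γ.leaf := by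
  constructor
  · rintro ⟨j, hj⟩
    refine ⟨Fin.cast (Hom.n_eq e.inv) j, (onV_bijective e).1 ?_⟩
    have := Hom.map_leaf e.hom (Fin.cast (Hom.n_eq e.inv) j)
    rw [Hom.inl_onV] at this
    rw [← hj]
    simpa using this
  · rintro ⟨j, rfl⟩
    have := Hom.map_leaf e.hom j
    rw [Hom.inl_onV] at this
    exact ⟨_, (Sum.inl_injective this).symm⟩

lemma dim_eq_of_iso {Γ Δ : LeafedFatGraph} (e : Γ ≅ Δ) : Γ.dim = Δ.dim := by
  refine finsum_eq_of_bijective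
    (fun v => ⟨Hom.onV e.hom v.1, fun h => v.2 ((onV_mem_leaf e v.1).1 h)⟩) ⟨?_, ?_⟩ ?_
  · intro u v h
    exact Subtype.ext ((onV_bijective e).1 (by simpa using h))
  · rintro ⟨w, hw⟩
    obtain ⟨v, rfl⟩ := (onV_bijective e).2 w
    exact ⟨⟨v, fun h => hw ((onV_mem_leaf e v).2 h)⟩, rfl⟩
  · intro v
    simp [val_onV]

end Iso

lemma exists_half_edge (Γ : LeafedFatGraph) (v : Γ.V) : ∃ A, Γ.s A = v := by
  have h : 0 < Γ.val v := by
    by_cases hv : v ∈ Set.range Γ.leaf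
    · obtain ⟨j, rfl⟩ := hv
      simp [Γ.val_leaf]
    · have := Γ.three_le_val v hv
      omega
  obtain ⟨⟨A, hA⟩⟩ := (Nat.card_pos_iff.1 h).1
  exact ⟨A, hA⟩

/-- There is at most one isomorphism between two fat graphs with labelled leaves. -/
lemma iso_unique {Γ Δ : LeafedFatGraph} (e f : Γ ≅ Δ) : e = f := by
  have agree : ∀ {A : Γ.H}, onH e A = onH f A → ∀ B, Γ.s B = Γ.s A → onH e B = onH f B := by
    intro A hA B hB
    obtain ⟨m, -, rfl⟩ := (Γ.cyclic A B hB.symm).exists_pow_eq'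
    clear hB
    induction m with
    | zero => simpa using hA
    | succ m ih =>
      rw [pow_succ', Equiv.Perm.mul_apply, σ_onH, σ_onH, ih]
  let v₀ := Γ.leaf ⟨0, Γ.n_pos⟩
  have leafAgree : ∀ A, Γ.s A = v₀ → onH e A = onH f A := by
    intro A hA
    have he : ∀ g : Γ ≅ Δ, Δ.s (onH g A) = Δ.leaf (Fin.cast (Hom.n_eq e.hom) ⟨0, Γ.n_pos⟩) := by
      intro g
      rw [s_onH, hA]
      have := Hom.map_leaf g.hom ⟨0, Γ.n_pos⟩
      rw [Hom.inl_onV] at this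
      exact Sum.inl_injective this
    have hv := Δ.val_leaf (Fin.cast (Hom.n_eq e.hom) ⟨0, Γ.n_pos⟩)
    have := (Nat.card_eq_one_iff_unique.1 hv).1
    exact congrArg Subtype.val (Subsingleton.elim
      (⟨_, he e⟩ : {B : Δ.H // Δ.s B = Δ.leaf (Fin.cast (Hom.n_eq e.hom) ⟨0, Γ.n_pos⟩)}) ⟨_, he f⟩)
  have all : ∀ v, ∀ A, Γ.s A = v → onH e A = onH f A := by
    intro v
    have h := Γ.connected.walk v₀ v trivial trivial
    induction h with
    | refl => exact leafAgree
    | tail _ h ih =>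
      obtain ⟨C, -, h1, rfl⟩ := h
      refine agree ?_
      rw [i_onH, i_onH, ih C h1]
  apply Iso.ext
  apply Hom.ext
  funext x
  rcases x with v | A
  · obtain ⟨A, rfl⟩ := Γ.exists_half_edge v
    rw [Hom.inl_onV, Hom.inl_onV, ← s_onH, ← s_onH, all _ A rfl]
  · rw [inr_onH, inr_onH, all _ A rfl]

end LeafedFatGraph

/-! ### The category of isomorphism classes -/

universe v u

/-- Between two objects there is at most one isomorphism. -/
class UniqueIsos (C : Type u) [Category.{v} C] : Prop where
  iso_unique : ∀ {X Y : C} (e f : X ≅ Y), e = f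

/-- Isomorphism classes of objects. -/
def IsoClass (C : Type u) [Category.{v} C] : Type u := Quotient (isIsomorphicSetoid C)

namespace IsoClass

variable {C : Type u} [Category.{v} C]

/-- The isomorphism class of an object. -/
def mk (X : C) : IsoClass C := Quotient.mk (isIsomorphicSetoid C) X

lemma mk_eq_mk {X Y : C} : mk X = mk Y ↔ Nonempty (X ≅ Y) :=
  Quotient.eq (r := isIsomorphicSetoid C)

/-- Morphisms between representatives of two isomorphism classes. -/
def PreHom (x y : IsoClass C) := {f : Arrow C // mk f.left = x ∧ mk f.right = y}

/-- Two morphisms are identified when they form the horizontal sides of a commutative square whose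
vertical sides are isomorphisms. -/
def homSetoid (x y : IsoClass C) : Setoid (PreHom x y) where
  r f g := Nonempty (f.1 ≅ g.1)
  iseqv := ⟨fun _ => ⟨Iso.refl _⟩, fun ⟨e⟩ => ⟨e.symm⟩, fun ⟨e⟩ ⟨e'⟩ => ⟨e.trans e'⟩⟩

/-- Composition of representatives, along an isomorphism between the middle objects. -/
noncomputable def preComp {x y z : IsoClass C} (f : PreHom x y) (g : PreHom y z) : PreHom x z :=
  ⟨Arrow.mk (f.1.hom ≫ (mk_eq_mk.1 (f.2.2.trans g.2.1.symm)).some.hom ≫ g.1.hom), f.2.1, g.2.2⟩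

lemma arrow_iso_w {f g : Arrow C} (e : f ≅ g) : e.hom.left ≫ g.hom = f.hom ≫ e.hom.right :=
  e.hom.w

lemma nonempty_arrow_iso {f g : Arrow C} (a : f.left ≅ g.left) (b : f.right ≅ g.right)
    (h : a.hom ≫ g.hom = f.hom ≫ b.hom) : Nonempty (f ≅ g) := ⟨Arrow.isoMk a b h⟩

lemma preComp_iso [UniqueIsos C] {x y z : IsoClass C} (f : PreHom x y) (g : PreHom y z)
    (θ : f.1.right ≅ g.1.left) (h : Arrow C) (a : f.1.left ≅ h.left) (b : g.1.right ≅ h.right)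
    (w : a.hom ≫ h.hom = f.1.hom ≫ θ.hom ≫ g.1.hom ≫ b.hom) :
    Nonempty ((preComp f g).1 ≅ h) := by
  refine nonempty_arrow_iso (f := (preComp f g).1) a b ?_
  have hθ : (mk_eq_mk.1 (f.2.2.trans g.2.1.symm)).some = θ := UniqueIsos.iso_unique _ _
  change a.hom ≫ h.hom = (f.1.hom ≫ (mk_eq_mk.1 (f.2.2.trans g.2.1.symm)).some.hom ≫ g.1.hom) ≫ _
  rw [hθ, w]
  simp

/-- The category whose objects are the isomorphism classes of objects of `C` and whose morphisms
are the equivalence classes of morphisms of `C`. -/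
noncomputable instance [UniqueIsos C] : Category.{max u v} (IsoClass C) where
  Hom x y := Quotient (homSetoid x y)
  id x := Quotient.mk _ ⟨Arrow.mk (𝟙 (Quotient.out x)), Quotient.out_eq x, Quotient.out_eq x⟩
  comp {x y z} := Quotient.map₂ preComp (by
    rintro f f' ⟨e⟩ g g' ⟨e'⟩
    let θ := (mk_eq_mk.1 (f'.2.2.trans g'.2.1.symm)).some
    have we := arrow_iso_w e
    have we' := arrow_iso_w e'
    refine preComp_iso f g (Arrow.rightFunc.mapIso e ≪≫ θ ≪≫ (Arrow.leftFunc.mapIso e').symm)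
      (preComp f' g').1 (Arrow.leftFunc.mapIso e) (Arrow.rightFunc.mapIso e') ?_
    change e.hom.left ≫ f'.1.hom ≫ θ.hom ≫ g'.1.hom =
      f.1.hom ≫ (e.hom.right ≫ θ.hom ≫ e'.inv.left) ≫ g.1.hom ≫ e'.hom.right
    have h2 : e'.inv.left ≫ e'.hom.left = 𝟙 _ := (Arrow.leftFunc.mapIso e').inv_hom_id
    rw [← we', reassoc_of% we]
    simp only [Category.assoc]
    rw [reassoc_of% h2])
  id_comp {x y} f := by
    induction f using Quotient.inductionOn with
    | h f =>
      refine Quotient.sound ?_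
      let θ : Quotient.out x ≅ f.1.left :=
        (mk_eq_mk.1 ((Quotient.out_eq x).trans f.2.1.symm)).some
      exact preComp_iso _ f θ f.1 θ (Iso.refl _) (by simp)
  comp_id {x y} f := by
    induction f using Quotient.inductionOn with
    | h f =>
      refine Quotient.sound ?_
      let θ : f.1.right ≅ Quotient.out y :=
        (mk_eq_mk.1 (f.2.2.trans (Quotient.out_eq y).symm)).some
      refine preComp_iso f ⟨Arrow.mk (𝟙 (Quotient.out y)), Quotient.out_eq y, Quotient.out_eq y⟩ θ f.1 (Iso.refl _) θ.symm ?_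
      simp
  assoc {x y z w} f g h := by
    induction f using Quotient.inductionOn with
    | h f =>
    induction g using Quotient.inductionOn with
    | h g =>
    induction h using Quotient.inductionOn with
    | h h =>
      refine Quotient.sound ?_
      let θ := (mk_eq_mk.1 (g.2.2.trans h.2.1.symm)).some
      refine preComp_iso (preComp f g) h θ (preComp f (preComp g h)).1 (Iso.refl _) (Iso.refl _) ?_
      simp [preComp, θ]

end IsoClass

instance {C : Type u} [Category.{v} C] [UniqueIsos C] (P : ObjectProperty C) :
    UniqueIsos P.FullSubcategory where
  iso_unique e f := by
    have h := UniqueIsos.iso_unique (P.ι.mapIso e) (P.ι.mapIso f)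
    apply Iso.ext
    apply P.ι.map_injective
    exact congrArg Iso.hom h

instance : UniqueIsos LeafedFatGraph := ⟨LeafedFatGraph.iso_unique⟩

/-! ### Bordered fat graphs -/

/-- Every boundary cycle contains exactly one leaf.  (A leaf lies on the boundary cycle of the
unique half-edge issuing from it.)  The boundary cycles are then numbered by their leaves. -/
def LeafedFatGraph.isBordered : ObjectProperty LeafedFatGraph := fun Γ =>
  ∀ A : Γ.H, ∃! j : Fin Γ.n, ∃ B, Γ.s B = Γ.leaf j ∧ Γ.ω.SameCycle A B

/-- Bordered fat graphs and their morphisms. -/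
abbrev BorderedFatGraph := LeafedFatGraph.isBordered.FullSubcategory

/-- The category of isomorphism classes of bordered fat graphs. -/
abbrev Fatb := IsoClass BorderedFatGraph

/-- The dimension of an isomorphism class of bordered fat graphs. -/
noncomputable def Fatb.dim : Fatb → ℕ :=
  Quotient.lift (fun Γ : BorderedFatGraph => Γ.obj.dim)
    (fun _ _ ⟨e⟩ => LeafedFatGraph.dim_eq_of_iso (LeafedFatGraph.isBordered.ι.mapIso e))

/-- Isomorphism classes of dimension at most `p`. -/
def Fatb.dimLE (p : ℕ) : ObjectProperty Fatb := fun X => X.dim ≤ p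

/-! ### Planar trees -/

/-- Planar trees with `k` leaves: the underlying graph is a tree, there are `k` leaves, and
following the boundary from any leaf, the next leaf that one meets is its cyclic successor. -/
def LeafedFatGraph.isPlanarTree (k : ℕ) : ObjectProperty LeafedFatGraph := fun T =>
  T.n = k ∧ T.IsTree Set.univ ∧
    ∀ j : Fin T.n, ∃ A, T.s A = T.leaf j ∧ ∃ m, 0 < m ∧
      T.s ((T.ω ^ m) A) = T.leaf ⟨(j + 1) % T.n, Nat.mod_lt _ T.n_pos⟩ ∧
      ∀ l, 0 < l → l < m → T.s ((T.ω ^ l) A) ∉ Set.range T.leaf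

/-- The category of isomorphism classes of planar trees with `k` cyclically ordered leaves; its
realization is the Stasheff associahedron of dimension `k - 3`. -/
abbrev PlanarTreeCat (k : ℕ) := IsoClass (LeafedFatGraph.isPlanarTree k).FullSubcategory

/-! ### Geometric realization of categories -/

/-- The geometric realization of (the nerve of) a category. -/
noncomputable abbrev Realization (C : Type u) [Category.{v} C] : TopCat.{max u v} :=
  SSet.toTop.obj (nerve C)

/-- The continuous map of realizations induced by a functor. -/
noncomputable def realizationMap {C D : Type u} [Category.{v} C] [Category.{v} D] (F : C ⥤ D) :
    C(Realization C, Realization D) :=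
  (SSet.toTop.map (nerveMap F)).hom

/-- The objects of the category over `X` that form the boundary of the cell of `X`: those whose
structure morphism is not invertible, i.e. collapses at least one edge. -/
def overBoundary {C : Type u} [Category.{v} C] (X : C) : ObjectProperty (Over X) :=
  fun Y => ¬ IsIso Y.hom

/-! The proof has a formal half and a combinatorial half. They meet in the fact that the category
over a bordered fat graph is the poset of dissections of a family of polygons, one for every
interior vertex.

Formal half. A morphism that collapses `m` edges raises the dimension by `m`, and one that collapses
nothing is an isomorphism, hence an identity between isomorphism classes, because isomorphisms are
unique. So the dimension is a `Grading`. In a graded category every point of the realization is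
interior to exactly one simplex with strictly increasing degrees (`exists_strict`, `strict_unique`).
This simplex is detected by continuous functions that are affine or quadratic on simplices, which
also makes the realization Hausdorff and full subcategories closed. Sorting points by the last
vertex `X` of this simplex cuts the realization into pieces, the piece of `X` being the realization
of `Over X` without its boundary. If all categories `Over X` are finite and realize to balls of
dimension equal to the degree, with the right boundary sphere, these pieces are the cells of a CW
complex (`cwComplex`).

From morphisms to dissections. The fibre of a morphism over a vertex is a tree, so each collapsed
edge splits the half-edges at that vertex into two arcs, that is, it gives a diagonal of a polygon.
The ends of the diagonal are the first surviving half-edges met by the boundary walks on the two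
sides of the edge (`Hom.st`). Diagonals of different collapsed edges do not cross, and an edge is
determined by its diagonal because interior vertices have valence at least three. Conversely a
dissection can be expanded to a graph (`Dissection.expand`), every morphism is isomorphic to such an
expansion (`Hom.isoExpand`), and factorizations correspond to inclusions of dissections. This gives
`BorderedFatGraph.overModel`. Planar trees with `k` leaves are treated in the same way over the
corolla, which is terminal among them (`PlanarTreeCat.model`). A dissection of several polygons is a
family of dissections, hence the product decomposition.

From dissections to balls. Let the objects of a thin category be the sets of pairwise compatible
elements of a finite set `E`, ordered by reverse inclusion. A point of the realization amounts to a
function from `E` to the unit interval with compatible support: the superlevel sets of the function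
form the chain, the lengths of the intervals of levels are the coordinates
(`CubeModel.weightHomeo`). These functions are the unit ball, for the supremum norm, of a cone. For
the diagonals of a polygon the cone is a vector space in disguise: the height of a corner is the
total weight of the diagonals that separate it from the base edge, and the weights are recovered
from the level sets of the heights. The heights of the `k - 2` inner corners are arbitrary
non-negative numbers with minimum zero, so their differences are `k - 3` free coordinates
(`Diagonal.chart`). A radial rescaling turns the unit ball of the cone into a round one; its sphere
consists of the points where some weight is one, and these are the points of the boundary category.
-/

section

open Simplicial Opposite

/-! ### Points of the realization of a category -/

namespace Realization

section points

variable {C : Type u} [Category.{v} C]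

/-- The characteristic map of a simplex of the nerve. -/
noncomputable def simplexMap {n : ℕ} (σ : ComposableArrows C n) :
    C(stdSimplex ℝ (Fin (n + 1)), Realization C) :=
  (SSet.toTop.obj (nerve C)).toSSetObjEquiv (op ⦋n⦌)
    ((sSetTopAdj.unit.app (nerve C)).app (op ⦋n⦌) σ)

/-- Naturality of the unit of the adjunction in the simplicial direction: this is the gluing
relation of the realization, for faces and degeneracies alike. -/
lemma simplexMap_whiskerLeft {n m : ℕ} (σ : ComposableArrows C m) (θ : ⦋n⦌ ⟶ ⦋m⦌)
    (t : stdSimplex ℝ (Fin (n + 1))) :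
    simplexMap ((nerve C).map θ.op σ) t = simplexMap σ (stdSimplex.map θ t) := by
  have h := (sSetTopAdj.unit.app (nerve C)).naturality θ.op
  have h2 := congrArg (fun f => (f σ : (TopCat.toSSet.obj (SSet.toTop.obj (nerve C))).obj _)) h
  change (TopCat.toSSetObjEquiv _ (op ⦋n⦌)
    ((sSetTopAdj.unit.app (nerve C)).app (op ⦋n⦌) ((nerve C).map θ.op σ))) t = _
  have h3 : (sSetTopAdj.unit.app (nerve C)).app (op ⦋n⦌) ((nerve C).map θ.op σ) = _ := h2
  rw [h3]
  rfl

lemma realizationMap_simplexMap {D : Type u} [Category.{v} D] (F : C ⥤ D) {n : ℕ}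
    (σ : ComposableArrows C n) (t : stdSimplex ℝ (Fin (n + 1))) :
    realizationMap F (simplexMap σ t) = simplexMap (C := D) (σ ⋙ F) t := by
  have h := sSetTopAdj.unit.naturality (nerveMap F)
  have h2 := congrArg (fun f : nerve C ⟶ TopCat.toSSet.obj (SSet.toTop.obj (nerve D)) =>
    f.app (op ⦋n⦌) σ) h
  have h3 : (sSetTopAdj.unit.app (nerve D)).app (op ⦋n⦌) (σ ⋙ F) = _ := h2
  change _ = (TopCat.toSSetObjEquiv _ (op ⦋n⦌)
    ((sSetTopAdj.unit.app (nerve D)).app (op ⦋n⦌) (σ ⋙ F))) t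
  rw [h3]
  rfl

/-- Continuous functions on the realization that agree on all simplices are equal. -/
lemma hom_ext {Y : TopCat.{max u v}} {f g : Realization C ⟶ Y}
    (h : ∀ (n : ℕ) (σ : ComposableArrows C n) t, f (simplexMap σ t) = g (simplexMap σ t)) :
    f = g := by
  apply (sSetTopAdj.homEquiv _ _).injective
  rw [Adjunction.homEquiv_unit, Adjunction.homEquiv_unit]
  ext n σ
  induction n using Opposite.rec with
  | op n =>
  induction n using SimplexCategory.rec with
  | _ n =>
  apply (TopCat.toSSetObjEquiv _ _).injective
  ext t
  exact h n σ t

/-- A compatible family of continuous functions on the simplices induces a map on the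
realization. -/
lemma exists_desc {Y : Type (max u v)} [TopologicalSpace Y]
    (φ : ∀ n : ℕ, ComposableArrows C n → C(stdSimplex ℝ (Fin (n + 1)), Y))
    (hφ : ∀ (n m : ℕ) (σ : ComposableArrows C m) (θ : ⦋n⦌ ⟶ ⦋m⦌) t,
      φ n ((nerve C).map θ.op σ) t = φ m σ (stdSimplex.map θ t)) :
    ∃ f : C(Realization C, Y), ∀ (n : ℕ) (σ : ComposableArrows C n) t,
      f (simplexMap σ t) = φ n σ t := by
  let g : nerve C ⟶ TopCat.toSSet.obj (TopCat.of Y) :=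
    { app n := ↾fun σ => ((TopCat.of Y).toSSetObjEquiv n).symm (φ n.unop.len σ)
      naturality n m θ := by
        ext σ
        apply (TopCat.toSSetObjEquiv _ _).injective
        ext t
        have := hφ _ _ σ θ.unop t
        exact this }
  refine ⟨((sSetTopAdj.homEquiv _ _).symm g).hom, fun n σ t => ?_⟩
  have h := (sSetTopAdj.homEquiv (nerve C) (TopCat.of Y)).apply_symm_apply g
  rw [Adjunction.homEquiv_unit] at h
  have h2 := congrArg (fun f : nerve C ⟶ TopCat.toSSet.obj (TopCat.of Y) =>
    TopCat.toSSetObjEquiv _ _ (f.app (op ⦋n⦌) σ) t) h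
  exact h2

/-- Every map to an indiscrete space is continuous. The indicator of the points hit by simplices and
the constant `True` are thus two continuous maps that agree on all simplices, and `hom_ext`
identifies them. -/
lemma exists_simplexMap_eq (x : Realization C) :
    ∃ (n : ℕ) (σ : ComposableArrows C n) (t : stdSimplex ℝ (Fin (n + 1))),
      simplexMap σ t = x := by
  classical
  let : TopologicalSpace (ULift.{max u v} Prop) := ⊤
  let f : Realization C ⟶ TopCat.of (ULift.{max u v} Prop) :=
    TopCat.ofHom ⟨fun x => ⟨∃ (n : ℕ) (σ : ComposableArrows C n)
      (t : stdSimplex ℝ (Fin (n + 1))), simplexMap σ t = x⟩, continuous_top⟩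
  let g : Realization C ⟶ TopCat.of (ULift.{max u v} Prop) :=
    TopCat.ofHom ⟨fun x => ⟨True⟩, continuous_top⟩
  have h : f = g := by
    apply hom_ext
    intro n σ t
    exact congrArg ULift.up (eq_true ⟨n, σ, t, rfl⟩)
  have h2 := congrArg (fun k : Realization C ⟶ TopCat.of (ULift.{max u v} Prop) =>
    ULift.down.{max u v} (show ULift.{max u v} Prop from k x)) h
  exact of_eq_true h2

lemma exists_desc_of_small {Y : Type} [TopologicalSpace Y]
    (φ : ∀ n : ℕ, ComposableArrows C n → C(stdSimplex ℝ (Fin (n + 1)), Y))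
    (hφ : ∀ (n m : ℕ) (σ : ComposableArrows C m) (θ : ⦋n⦌ ⟶ ⦋m⦌) t,
      φ n ((nerve C).map θ.op σ) t = φ m σ (stdSimplex.map θ t)) :
    ∃ f : C(Realization C, Y), ∀ (n : ℕ) (σ : ComposableArrows C n) t,
      f (simplexMap σ t) = φ n σ t := by
  obtain ⟨f, hf⟩ := exists_desc (C := C) (Y := ULift.{max u v} Y)
    (fun n σ => ⟨fun t => ⟨φ n σ t⟩, continuous_uliftUp.comp (φ n σ).continuous⟩)
    (fun n m σ θ t => congrArg ULift.up (hφ n m σ θ t))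
  exact ⟨⟨fun x => (f x).down, continuous_uliftDown.comp f.continuous⟩,
    fun n σ t => congrArg ULift.down (hf n σ t)⟩

lemma continuous_of_simplexMap {Y : Type (max u v)} [TopologicalSpace Y] (f : Realization C → Y)
    (h : ∀ (n : ℕ) (σ : ComposableArrows C n), Continuous (fun t => f (simplexMap σ t))) :
    Continuous f := by
  obtain ⟨g, hg⟩ := exists_desc (fun n (σ : ComposableArrows C n) => ⟨_, h n σ⟩)
    (fun n m σ θ t => congrArg f (simplexMap_whiskerLeft σ θ t))
  have : f = g := by
    funext x
    obtain ⟨n, σ, t, rfl⟩ := exists_simplexMap_eq x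
    exact (hg n σ t).symm
  rw [this]
  exact g.continuous

/-- The realization has the weak topology with respect to its simplices. -/
lemma isClosed_of_preimage (A : Set (Realization C))
    (h : ∀ (n : ℕ) (σ : ComposableArrows C n), IsClosed (simplexMap σ ⁻¹' A)) : IsClosed A := by
  -- Open sets are the continuous maps to the Sierpiński space `Prop`, so the universal property of
  -- the realization decides which sets are open.
  have h1 : Continuous (fun x : Realization C => ULift.up.{max u v} (x ∉ A)) := by
    refine continuous_of_simplexMap _ (fun n σ => continuous_uliftUp.comp ?_)
    exact continuous_Prop.2 (h n σ).isOpen_compl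
  exact isOpen_compl_iff.1 (continuous_Prop.1 (continuous_uliftDown.comp h1))

end points

end Realization

end

section

/-! ### Continuous functions on the realization -/

open Simplicial Opposite

namespace Realization

section functions

variable {C : Type u} [Category.{v} C]

/-- Change of variables for the push-forward of barycentric coordinates; it makes the affine and
quadratic functions below respect the gluing of simplices. -/
lemma sum_mul_stdSimplex_map {n m : ℕ} (θ : Fin (n + 1) → Fin (m + 1))
    (t : stdSimplex ℝ (Fin (n + 1))) (F : Fin (m + 1) → ℝ) :
    ∑ j, F j * stdSimplex.map θ t j = ∑ a, F (θ a) * t a := by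
  classical
  simp only [stdSimplex.map_coe, FunOnFinite.linearMap_apply_apply, Finset.mul_sum]
  rw [← Finset.sum_fiberwise Finset.univ θ]
  refine Finset.sum_congr rfl fun j _ => Finset.sum_congr (by simp) fun a ha => ?_
  simp only [Finset.mem_filter, Finset.mem_univ, true_and] at ha
  rw [ha]

lemma exists_lin (c : C → ℝ) : ∃ f : C(Realization C, ℝ),
    ∀ (n : ℕ) (σ : ComposableArrows C n) (t : stdSimplex ℝ (Fin (n + 1))),
      f (simplexMap σ t) = ∑ i, c (σ.obj i) * t i := by
  refine exists_desc_of_small (fun n σ => ⟨fun t => ∑ i, c (σ.obj i) * t i, ?_⟩) ?_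
  · refine continuous_finsetSum _ fun i _ => continuous_const.mul ?_
    exact (continuous_apply i).comp continuous_subtype_val
  · intro n m σ θ t
    exact (sum_mul_stdSimplex_map θ t (fun j => c (σ.obj j))).symm

/-- The function on the realization that is affine on simplices and has prescribed values on
the objects. -/
noncomputable def lin (c : C → ℝ) : C(Realization C, ℝ) := (exists_lin c).choose

lemma lin_simplexMap (c : C → ℝ) {n : ℕ} (σ : ComposableArrows C n)
    (t : stdSimplex ℝ (Fin (n + 1))) : lin c (simplexMap σ t) = ∑ i, c (σ.obj i) * t i :=
  (exists_lin c).choose_spec n σ t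

-- Affine functions see only the objects of a simplex. A quadratic form also sees its morphisms,
-- which separates simplices with the same vertices when the category is not thin. Vanishing on
-- identities makes the form compatible with degeneracies.
open Classical in
lemma exists_quad (q : Arrow C → ℝ) (hq : ∀ X, q (Arrow.mk (𝟙 X)) = 0) :
    ∃ f : C(Realization C, ℝ),
    ∀ (n : ℕ) (σ : ComposableArrows C n) (t : stdSimplex ℝ (Fin (n + 1))),
      f (simplexMap σ t) =
        ∑ i, ∑ j, (if h : i ≤ j then q (Arrow.mk (σ.map (homOfLE h))) else 0) * t i * t j := by
  refine exists_desc_of_small (fun n σ => ⟨fun t => ∑ i, ∑ j,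
    (if h : i ≤ j then q (Arrow.mk (σ.map (homOfLE h))) else 0) * t i * t j, ?_⟩) ?_
  · refine continuous_finsetSum _ fun i _ => continuous_finsetSum _ fun j _ =>
      (continuous_const.mul ?_).mul ?_
    · exact (continuous_apply i).comp continuous_subtype_val
    · exact (continuous_apply j).comp continuous_subtype_val
  · intro n m σ θ t
    let Q : Fin (m + 1) → Fin (m + 1) → ℝ := fun i j =>
      if h : i ≤ j then q (Arrow.mk (σ.map (homOfLE h))) else 0
    have h1 : ∀ i, ∑ j, Q i j * stdSimplex.map θ t i * stdSimplex.map θ t j =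
        (∑ b, Q i (θ b) * t b) * stdSimplex.map θ t i := by
      intro i
      rw [← sum_mul_stdSimplex_map θ t (Q i), Finset.sum_mul]
      refine Finset.sum_congr rfl fun j _ => ?_
      ring
    change ∑ a : Fin (n + 1), ∑ b : Fin (n + 1), (if h : a ≤ b then
      q (Arrow.mk (((nerve C).map θ.op σ : ComposableArrows C n).map (homOfLE h))) else 0) *
        t a * t b = ∑ i, ∑ j, Q i j * stdSimplex.map θ t i * stdSimplex.map θ t j
    simp only [h1]
    rw [sum_mul_stdSimplex_map θ t (fun i => ∑ b, Q i (θ b) * t b)]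
    refine Finset.sum_congr rfl fun a _ => ?_
    rw [Finset.sum_mul]
    refine Finset.sum_congr rfl fun b _ => ?_
    have h2 : (if h : a ≤ b then q (Arrow.mk (((nerve C).map θ.op σ : ComposableArrows C n).map
        (homOfLE h))) else 0) = Q (θ a) (θ b) := by
      by_cases hab : a ≤ b
      · have hθ : θ a ≤ θ b := θ.toOrderHom.monotone hab
        simp only [Q, hab, hθ, dif_pos]
        rfl
      · simp only [Q, hab, dif_neg, not_false_eq_true]
        -- A degeneracy may send `b < a` to the same vertex. The right side then contains the value
        -- on an identity, which is zero.
        split_ifs with h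
        · have h3 : θ b ≤ θ a := θ.toOrderHom.monotone (le_of_not_ge hab)
          have h4 : ∀ (i j : Fin (m + 1)) (h : i ≤ j), i = j →
              q (Arrow.mk (σ.map (homOfLE h))) = 0 := by
            rintro i j h rfl
            have : homOfLE h = 𝟙 i := rfl
            rw [this, σ.map_id, hq]
          exact (h4 _ _ h (le_antisymm h h3)).symm
        · rfl
    rw [h2]
    ring

open Classical in
/-- The function on the realization that is a given quadratic form on the simplices. -/
noncomputable def quad (q : Arrow C → ℝ) (hq : ∀ X, q (Arrow.mk (𝟙 X)) = 0) :
    C(Realization C, ℝ) := (exists_quad q hq).choose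

open Classical in
lemma quad_simplexMap (q : Arrow C → ℝ) (hq : ∀ X, q (Arrow.mk (𝟙 X)) = 0) {n : ℕ}
    (σ : ComposableArrows C n) (t : stdSimplex ℝ (Fin (n + 1))) :
    quad q hq (simplexMap σ t) =
      ∑ i, ∑ j, (if h : i ≤ j then q (Arrow.mk (σ.map (homOfLE h))) else 0) * t i * t j :=
  (exists_quad q hq).choose_spec n σ t

lemma lin_realizationMap {D : Type u} [Category.{v} D] (F : C ⥤ D) (c : D → ℝ)
    (x : Realization C) : lin c (realizationMap F x) = lin (fun X => c (F.obj X)) x := by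
  obtain ⟨n, σ, t, rfl⟩ := exists_simplexMap_eq x
  rw [realizationMap_simplexMap, lin_simplexMap, lin_simplexMap]
  rfl

lemma quad_realizationMap {D : Type u} [Category.{v} D] (F : C ⥤ D) (q : Arrow D → ℝ)
    (hq : ∀ X, q (Arrow.mk (𝟙 X)) = 0) (x : Realization C) :
    quad q hq (realizationMap F x) = quad (fun f => q (F.mapArrow.obj f))
      (fun X => by
        have : F.mapArrow.obj (Arrow.mk (𝟙 X)) = Arrow.mk (𝟙 (F.obj X)) := by
          simp [Functor.mapArrow]
        rw [this, hq]) x := by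
  obtain ⟨n, σ, t, rfl⟩ := exists_simplexMap_eq x
  rw [realizationMap_simplexMap, quad_simplexMap, quad_simplexMap]
  rfl

/-- A point of a simplex supported on a set of vertices lies on the corresponding face. -/
lemma exists_face {n : ℕ} (t : stdSimplex ℝ (Fin (n + 1))) (S : Finset (Fin (n + 1)))
    (h : ∀ i ∉ S, t i = 0) {m : ℕ} (hm : S.card = m + 1) :
    ∃ t' : stdSimplex ℝ (Fin (m + 1)), stdSimplex.map (S.orderEmbOfFin hm) t' = t ∧
      ∀ a, t' a = t (S.orderEmbOfFin hm a) := by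
  have hs : ∑ a, t (S.orderEmbOfFin hm a) = 1 := by
    rw [← stdSimplex.sum_eq_one t, ← Finset.sum_subset (Finset.subset_univ S)
      (fun i _ hi => h i hi)]
    refine (Finset.sum_map Finset.univ (S.orderEmbOfFin hm).toEmbedding (fun i => t i)).symm.trans
      (Finset.sum_congr ?_ fun _ _ => rfl)
    ext i
    have := Finset.range_orderEmbOfFin S hm
    rw [Set.ext_iff] at this
    simp
  refine ⟨⟨fun a => t (S.orderEmbOfFin hm a), fun a => stdSimplex.zero_le t _, hs⟩, ?_,
    fun a => rfl⟩
  ext j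
  classical
  have := sum_mul_stdSimplex_map (S.orderEmbOfFin hm)
    ⟨fun a => t (S.orderEmbOfFin hm a), fun a => stdSimplex.zero_le t _, hs⟩
    (fun i => if i = j then 1 else 0)
  simp only [ite_mul, one_mul, zero_mul, Finset.sum_ite_eq', Finset.mem_univ, if_true] at this
  rw [this]
  by_cases hj : j ∈ S
  · have h2 : j ∈ Set.range (S.orderEmbOfFin hm) := by
      rw [Finset.range_orderEmbOfFin]; exact hj
    obtain ⟨a, rfl⟩ := h2
    rw [Finset.sum_eq_single a]
    · rw [if_pos rfl]; rfl
    · intro b _ hb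
      rw [if_neg]
      exact fun h => hb ((S.orderEmbOfFin hm).injective h)
    · simp
  · rw [h j hj]
    refine Finset.sum_eq_zero fun a _ => if_neg ?_
    rintro rfl
    exact hj (Finset.orderEmbOfFin_mem S hm a)

end functions

end Realization

end

section

/-! ### Graded categories -/

open Simplicial Opposite

/-- A grading of the objects of a category that is strictly increasing along all morphisms but the
identities. -/
structure Grading (C : Type u) [Category.{v} C] where
  d : C → ℕ
  lt_or : ∀ {X Y : C} (f : X ⟶ Y), d X < d Y ∨ ∃ h : X = Y, f = eqToHom h

namespace Realization

variable {C : Type u} [Category.{v} C]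

/-- A simplex is strict if the degrees of its vertices are strictly increasing. -/
def IsStrict (G : Grading C) {n : ℕ} (σ : ComposableArrows C n) : Prop :=
  StrictMono fun i => G.d (σ.obj i)

/-- The composite `ρ` of the degeneracy and the face moves only the vertex `k + 1`, to `k`. The
arrow between these two being an identity, precomposition with `ρ` changes nothing, and functors are
compared up to equality. -/
lemma degenerate_of_eqToHom {m : ℕ} (σ : ComposableArrows C (m + 1)) (k : Fin (m + 1))
    (h : ∃ e : σ.obj k.castSucc = σ.obj k.succ,
      σ.map (homOfLE (Fin.castSucc_le_succ k)) = eqToHom e) :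
    (nerve C).map (SimplexCategory.σ k).op
      ((nerve C).map (SimplexCategory.δ k.succ).op σ) = σ := by
  obtain ⟨e, he⟩ := h
  let ρ : Fin (m + 2) →o Fin (m + 2) :=
    ((SimplexCategory.σ k ≫ SimplexCategory.δ k.succ).toOrderHom)
  have hρ : ∀ i, ρ i = i ∨ (i = k.succ ∧ ρ i = k.castSucc) := by
    intro i
    change k.succ.succAbove (k.predAbove i) = i ∨ _ ∧ k.succ.succAbove (k.predAbove i) = _
    by_cases h : i = k.succ
    · subst h
      right
      simp
    · left
      exact Fin.succ_succAbove_predAbove h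
  have hle : ∀ i, ρ i ≤ i := fun i => by
    rcases hρ i with h | ⟨h, h'⟩
    · rw [h]
    · rw [h', h]; exact Fin.castSucc_le_succ k
  have key : ∀ i j (hj : j = i ∨ (i = k.succ ∧ j = k.castSucc)) (hij : j ≤ i),
      ∃ e : σ.obj j = σ.obj i, σ.map (homOfLE hij) = eqToHom e := by
    rintro i j (rfl | ⟨rfl, rfl⟩) hij
    · exact ⟨rfl, σ.map_id _⟩
    · exact ⟨e, he⟩
  change ρ.monotone.functor ⋙ σ = σ
  refine Functor.ext_of_iso (NatIso.ofComponents (fun i =>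
    eqToIso (key i (ρ i) (hρ i) (hle i)).choose) ?_)
    (fun i => (key i (ρ i) (hρ i) (hle i)).choose) (fun i => rfl)
  intro i j f
  change σ.map (ρ.monotone.functor.map f) ≫ eqToHom (key j (ρ j) (hρ j) (hle j)).choose =
    eqToHom (key i (ρ i) (hρ i) (hle i)).choose ≫ σ.map f
  have hij : σ.map (homOfLE (ρ.monotone (leOfHom f))) ≫ σ.map (homOfLE (hle j)) =
      σ.map (homOfLE (hle i)) ≫ σ.map f := by
    rw [← σ.map_comp, ← σ.map_comp]
    congr 1
  rw [(key i (ρ i) (hρ i) (hle i)).choose_spec, (key j (ρ j) (hρ j) (hle j)).choose_spec] at hij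
  exact hij

/-- Every point lies in the interior of a strict simplex. -/
lemma exists_strict (G : Grading C) (x : Realization C) :
    ∃ (n : ℕ) (σ : ComposableArrows C n) (t : stdSimplex ℝ (Fin (n + 1))),
      IsStrict G σ ∧ (∀ i, 0 < t i) ∧ simplexMap σ t = x := by
  obtain ⟨n, σ, t, h⟩ := exists_simplexMap_eq x
  induction n using Nat.strong_induction_on with
  | _ n ih =>
  -- Two reductions lower the dimension: a simplex that is not strict has two consecutive vertices
  -- joined by an identity, so it is degenerate; a vanishing coordinate moves the point to a face.
  by_cases ht : ∀ i, 0 < t i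
  · by_cases hσ : IsStrict G σ
    · exact ⟨n, σ, t, hσ, ht, h⟩
    · rcases n with _ | m
      · exact (hσ fun i j h => absurd (Fin.lt_def.1 h) (by omega)).elim
      · rw [IsStrict, Fin.strictMono_iff_lt_succ] at hσ
        push Not at hσ
        obtain ⟨k, hk⟩ := hσ
        have h1 := degenerate_of_eqToHom σ k
          ((G.lt_or (σ.map (homOfLE (Fin.castSucc_le_succ k)))).resolve_left (not_lt.2 hk))
        have h2 := simplexMap_whiskerLeft ((nerve C).map (SimplexCategory.δ k.succ).op σ)
          (SimplexCategory.σ k) t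
        exact ih m (Nat.lt_succ_self m) _ _
          (h2.symm.trans ((congrArg (fun τ => simplexMap τ t) h1).trans h))
  · push Not at ht
    obtain ⟨k, hk⟩ := ht
    have hk0 : t k = 0 := le_antisymm hk (stdSimplex.zero_le t k)
    rcases n with _ | m
    · have := stdSimplex.sum_eq_one t
      rw [Finset.sum_eq_zero fun i _ => (by rwa [show i = k from Fin.ext (by omega)])] at this
      exact (zero_ne_one this).elim
    · have hm : (Finset.univ.erase k).card = m + 1 := by simp
      obtain ⟨t', ht', -⟩ := exists_face t (Finset.univ.erase k) (by simp [hk0]) hm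
      let θ : ⦋m⦌ ⟶ ⦋m + 1⦌ := SimplexCategory.mkHom
        ((Finset.univ.erase k).orderEmbOfFin hm).toOrderHom
      rw [← ht'] at h
      have h2 := simplexMap_whiskerLeft σ θ t'
      exact ih m (Nat.lt_succ_self m) _ t' (h2.trans h)

/-- This lets a continuous function test which objects occur in the simplex carrying a point. -/
lemma lin_indicator_pos_iff {n : ℕ} (σ : ComposableArrows C n) (t : stdSimplex ℝ (Fin (n + 1)))
    (ht : ∀ i, 0 < t i) (P : C → Prop) [DecidablePred P] :
    0 < lin (fun Y => if P Y then (1 : ℝ) else 0) (simplexMap σ t) ↔ ∃ i, P (σ.obj i) := by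
  rw [lin_simplexMap]
  constructor
  · intro h
    by_contra hne
    push Not at hne
    simp [hne] at h
  · rintro ⟨i, hi⟩
    refine Finset.sum_pos' (fun j _ => ?_) ⟨i, Finset.mem_univ _, ?_⟩
    · split_ifs <;> simp
    · simp [hi, ht i]

/-- Comparing elements of `Arrow C` avoids transport along the equalities of objects; for `i = j`
the arrows are identities and need no hypothesis. -/
lemma arrow_eq_of_functor {n : ℕ} {σ τ : ComposableArrows C n} (h : ∀ i, σ.obj i = τ.obj i)
    (hm : ∀ i j (hij : i < j), Arrow.mk (σ.map (homOfLE hij.le)) = Arrow.mk (τ.map (homOfLE hij.le))) :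
    σ = τ := by
  refine Functor.hext h fun i j f => ?_
  have hf : f = homOfLE (leOfHom f) := rfl
  rw [hf]
  rcases (leOfHom f).lt_or_eq with hlt | heq
  · have := hm i j hlt
    rw [Arrow.mk_eq_mk_iff] at this
    obtain ⟨h1, h2, h3⟩ := this
    rw [h3]
    simp
  · have key : ∀ (j) (hij : i ≤ j), i = j → HEq (σ.map (homOfLE hij)) (τ.map (homOfLE hij)) := by
      rintro _ hij rfl
      have : homOfLE hij = 𝟙 i := rfl
      rw [this, σ.map_id, τ.map_id, h]
    exact key j _ heq

/-- Linear functions determine the vertices of the strict simplex in whose interior a point lies,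
and the position of the point. -/
lemma strict_unique_obj (G : Grading C) {n n' : ℕ} {σ : ComposableArrows C n}
    {σ' : ComposableArrows C n'} {t : stdSimplex ℝ (Fin (n + 1))}
    {t' : stdSimplex ℝ (Fin (n' + 1))} (hσ : IsStrict G σ) (hσ' : IsStrict G σ')
    (ht : ∀ i, 0 < t i) (ht' : ∀ i, 0 < t' i)
    (hl : ∀ c : C → ℝ, lin c (simplexMap σ t) = lin c (simplexMap σ' t')) :
    n = n' ∧ ∀ (i : Fin (n + 1)) (j : Fin (n' + 1)), i.1 = j.1 →
      σ.obj i = σ'.obj j ∧ t i = t' j := by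
  classical
  have hinj : ∀ {i j}, σ.obj i = σ.obj j → i = j := fun h => hσ.injective (congrArg G.d h)
  have hinj' : ∀ {i j}, σ'.obj i = σ'.obj j → i = j := fun h => hσ'.injective (congrArg G.d h)
  have hr : ∀ X, (∃ i, σ.obj i = X) ↔ ∃ i, σ'.obj i = X := by
    intro X
    rw [← lin_indicator_pos_iff σ t ht (fun Y => Y = X), hl, lin_indicator_pos_iff σ' t' ht']
  have hn : n = n' := by
    have e : Fin (n + 1) ≃ Fin (n' + 1) := by
      refine (Equiv.ofInjective σ.obj fun _ _ h => hinj h).trans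
        ((Equiv.setCongr ?_).trans (Equiv.ofInjective σ'.obj fun _ _ h => hinj' h).symm)
      ext X
      exact hr X
    have := Fintype.card_congr e
    simpa using this
  subst hn
  -- The two simplices have the same vertices, hence the same degrees, and a strictly increasing
  -- sequence is determined by its range.
  have hd : (fun i => G.d (σ.obj i)) = fun i => G.d (σ'.obj i) := by
    refine (StrictMono.range_inj hσ hσ').1 ?_
    ext k
    constructor
    · rintro ⟨i, rfl⟩
      obtain ⟨j, hj⟩ := (hr _).1 ⟨i, rfl⟩
      exact ⟨j, by simp [hj]⟩
    · rintro ⟨i, rfl⟩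
      obtain ⟨j, hj⟩ := (hr _).2 ⟨i, rfl⟩
      exact ⟨j, by simp [hj]⟩
  have ho : ∀ i, σ.obj i = σ'.obj i := by
    intro i
    obtain ⟨j, hj⟩ := (hr _).1 ⟨i, rfl⟩
    have h1 : G.d (σ'.obj j) = G.d (σ'.obj i) := by rw [hj]; exact congrFun hd i
    rw [← hj, hσ'.injective h1]
  refine ⟨rfl, fun i j hij => ?_⟩
  obtain rfl := Fin.ext hij
  refine ⟨ho i, ?_⟩
  · have := hl (fun Y => if Y = σ.obj i then 1 else 0)
    rw [lin_simplexMap, lin_simplexMap, Finset.sum_eq_single i, Finset.sum_eq_single i] at this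
    · simpa [ho] using this
    · intro b _ hb
      rw [if_neg, zero_mul]
      rw [ho]
      exact fun h => hb (hinj' h)
    · simp
    · intro b _ hb
      rw [if_neg, zero_mul]
      exact fun h => hb (hinj h)
    · simp

/-- Linear and quadratic functions determine the strict simplex in whose interior a point lies, and
the position of the point. -/
lemma strict_unique (G : Grading C) {n n' : ℕ} {σ : ComposableArrows C n}
    {σ' : ComposableArrows C n'} {t : stdSimplex ℝ (Fin (n + 1))}
    {t' : stdSimplex ℝ (Fin (n' + 1))} (hσ : IsStrict G σ) (hσ' : IsStrict G σ')
    (ht : ∀ i, 0 < t i) (ht' : ∀ i, 0 < t' i)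
    (hl : ∀ c : C → ℝ, lin c (simplexMap σ t) = lin c (simplexMap σ' t'))
    (hq : ∀ q hq, quad q hq (simplexMap σ t) = quad (C := C) q hq (simplexMap σ' t')) :
    (⟨n, σ, t⟩ : Σ n, ComposableArrows C n × stdSimplex ℝ (Fin (n + 1))) = ⟨n', σ', t'⟩ := by
  classical
  have hinj : ∀ {i j}, σ.obj i = σ.obj j → i = j := fun h => hσ.injective (congrArg G.d h)
  have hinj' : ∀ {i j}, σ'.obj i = σ'.obj j → i = j := fun h => hσ'.injective (congrArg G.d h)
  obtain ⟨rfl, hu⟩ := strict_unique_obj G hσ hσ' ht ht' hl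
  have ho : ∀ i, σ.obj i = σ'.obj i := fun i => (hu i i rfl).1
  obtain rfl : t = t' := by
    ext i
    exact (hu i i rfl).2
  have hσσ : σ = σ' := by
    refine arrow_eq_of_functor ho fun i j hij => ?_
    -- The form attached to the indicator of `f` is at least `t i * t j > 0` at the point, so `f`
    -- also occurs among the arrows of `σ'`; its source and target leave only the place `(i, j)`.
    let f := Arrow.mk (σ.map (homOfLE hij.le))
    have hf : ∀ X, (if Arrow.mk (𝟙 X) = f then (1 : ℝ) else 0) = 0 := by
      intro X
      refine if_neg fun h => ?_
      have h1 : X = σ.obj i := congrArg (fun a : Arrow C => a.left) h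
      have h2 : X = σ.obj j := congrArg (fun a : Arrow C => a.right) h
      exact hij.ne (hinj (h1.symm.trans h2))
    have h1 := hq (fun a => if a = f then 1 else 0) hf
    rw [quad_simplexMap, quad_simplexMap] at h1
    have hpos : 0 < ∑ a, ∑ b, (if h : a ≤ b then
        (if Arrow.mk (σ.map (homOfLE h)) = f then (1 : ℝ) else 0) else 0) * t a * t b := by
      have hnn : ∀ a b, 0 ≤ (if h : a ≤ b then
        (if Arrow.mk (σ.map (homOfLE h)) = f then (1 : ℝ) else 0) else 0) * t a * t b := by
        intro a b
        refine mul_nonneg (mul_nonneg ?_ (ht a).le) (ht b).le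
        split_ifs <;> simp
      refine Finset.sum_pos' (fun a _ => Finset.sum_nonneg fun b _ => hnn a b)
        ⟨i, Finset.mem_univ _, Finset.sum_pos' (fun b _ => hnn i b) ⟨j, Finset.mem_univ _, ?_⟩⟩
      rw [dif_pos hij.le, if_pos rfl, one_mul]
      exact mul_pos (ht i) (ht j)
    rw [h1] at hpos
    obtain ⟨a, -, ha⟩ := Finset.exists_ne_zero_of_sum_ne_zero hpos.ne'
    obtain ⟨b, -, hb⟩ := Finset.exists_ne_zero_of_sum_ne_zero ha
    by_cases hab : a ≤ b
    · rw [dif_pos hab] at hb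
      by_cases hf' : Arrow.mk (σ'.map (homOfLE hab)) = f
      · have h2 : σ'.obj a = σ.obj i := congrArg (fun a : Arrow C => a.left) hf'
        have h3 : σ'.obj b = σ.obj j := congrArg (fun a : Arrow C => a.right) hf'
        rw [ho] at h2 h3
        obtain rfl := hinj' h2
        obtain rfl := hinj' h3
        exact hf'.symm
      · simp [hf'] at hb
    · simp [hab] at hb
  rw [hσσ]

lemma eq_of_lin_quad (G : Grading C) {x y : Realization C} (hl : ∀ c : C → ℝ, lin c x = lin c y)
    (hq : ∀ q hq, quad (C := C) q hq x = quad q hq y) : x = y := by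
  obtain ⟨n, σ, t, hσ, ht, hx⟩ := exists_strict G x
  obtain ⟨n', σ', t', hσ', ht', hy⟩ := exists_strict G y
  have h := strict_unique G hσ hσ' ht ht' (fun c => by rw [hx, hy, hl])
    (fun q hq' => by rw [hx, hy, hq])
  rw [← hx, ← hy]
  obtain ⟨rfl, h⟩ := Sigma.mk.inj_iff.1 h
  obtain ⟨rfl, rfl⟩ := Prod.mk.inj (eq_of_heq h)
  rfl

/-- In a thin category, linear functions separate points. -/
lemma eq_of_lin (G : Grading C) [Quiver.IsThin C] {x y : Realization C}
    (hl : ∀ c : C → ℝ, lin c x = lin c y) : x = y := by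
  obtain ⟨n, σ, t, hσ, ht, hx⟩ := exists_strict G x
  obtain ⟨n', σ', t', hσ', ht', hy⟩ := exists_strict G y
  obtain ⟨rfl, hu⟩ := strict_unique_obj G hσ hσ' ht ht' (fun c => by rw [hx, hy, hl])
  obtain rfl : σ = σ' := by
    refine Functor.hext (fun i => (hu i i rfl).1) fun i j f => ?_
    have key : ∀ (X X' Y Y' : C) (f : X ⟶ Y) (g : X' ⟶ Y'), X = X' → Y = Y' → HEq f g := by
      rintro X _ Y _ f g rfl rfl
      exact heq_of_eq (Subsingleton.elim _ _)
    exact key _ _ _ _ _ _ (hu i i rfl).1 (hu j j rfl).1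
  obtain rfl : t = t' := by
    ext i
    exact (hu i i rfl).2
  rw [← hx, ← hy]

/-- The affine and quadratic functions together map the realization continuously and injectively
into a product of real lines. -/
lemma t2Space (G : Grading C) : T2Space (Realization C) := by
  let Q := {q : Arrow C → ℝ // ∀ X, q (Arrow.mk (𝟙 X)) = 0}
  let Φ : Realization C → ((C → ℝ) → ℝ) × (Q → ℝ) :=
    fun x => (fun c => lin c x, fun q => quad q.1 q.2 x)
  have hΦ : Continuous Φ := by fun_prop
  refine T2Space.of_injective_continuous (f := Φ) (fun x y h => ?_) hΦ
  exact eq_of_lin_quad G (fun c => congrFun (congrArg Prod.fst h) c)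
    (fun q hq => congrFun (congrArg Prod.snd h) ⟨q, hq⟩)

/-! ### Full subcategories -/

section sub

variable (P : ObjectProperty C)

/-- The grading of a full subcategory. -/
def _root_.Grading.full (G : Grading C) : Grading P.FullSubcategory where
  d X := G.d X.obj
  lt_or f := by
    rcases G.lt_or (P.ι.map f) with h | ⟨h, h'⟩
    · exact Or.inl h
    · have e := ObjectProperty.FullSubcategory.ext h
      refine Or.inr ⟨e, P.ι.map_injective ?_⟩
      subst e
      exact h'

lemma lin_full_extend (c : P.FullSubcategory → ℝ) :
    ∃ c' : C → ℝ, ∀ X : P.FullSubcategory, c' X.obj = c X := by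
  classical
  exact ⟨fun X => if h : P X then c ⟨X, h⟩ else 0, fun X => by simp [X.property]⟩

/-- Because the subcategory is full, its affine and quadratic functions extend by zero to the whole
category, so points that they separate stay separated. -/
lemma realizationMap_ι_injective (G : Grading C) :
    Function.Injective (realizationMap P.ι) := by
  classical
  intro x y h
  refine eq_of_lin_quad (G.full P) (fun c => ?_) (fun q hq => ?_)
  · obtain ⟨c', hc'⟩ := lin_full_extend P c
    have h1 := lin_realizationMap P.ι c' x
    have h2 := lin_realizationMap P.ι c' y
    have e : (fun X : P.FullSubcategory => c' (P.ι.obj X)) = c := funext hc'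
    rw [e] at h1 h2
    rw [← h1, ← h2, h]
  · let q' : Arrow C → ℝ := fun f => if h : P f.left ∧ P f.right then
      q (Arrow.mk (Y := ⟨f.right, h.2⟩) (X := (⟨f.left, h.1⟩ : P.FullSubcategory)) ⟨f.hom⟩)
      else 0
    have hq' : ∀ X, q' (Arrow.mk (𝟙 X)) = 0 := by
      intro X
      by_cases hX : P X
      · have h1 : P (Arrow.mk (𝟙 X)).left ∧ P (Arrow.mk (𝟙 X)).right := ⟨hX, hX⟩
        simp only [q', h1]
        exact hq ⟨X, hX⟩
      · simp [q', hX]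
    have h1 := quad_realizationMap P.ι q' hq' x
    have h2 := quad_realizationMap P.ι q' hq' y
    have e : (fun f : Arrow P.FullSubcategory => q' (P.ι.mapArrow.obj f)) = q := by
      funext f
      have h3 : P (P.ι.mapArrow.obj f).left ∧ P (P.ι.mapArrow.obj f).right :=
        ⟨f.left.property, f.right.property⟩
      simp only [q', h3]
      rfl
    simp only [e] at h1 h2
    rw [← h1, ← h2, h]

/-- A point of a simplex supported on vertices in a full subcategory lies in the realization of
the subcategory. -/
lemma exists_lift_face {n : ℕ} (σ : ComposableArrows C n) (S : Finset (Fin (n + 1)))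
    (hS : ∀ i ∈ S, P (σ.obj i)) {m : ℕ} (hm : S.card = m + 1) :
    ∃ ρ : ComposableArrows P.FullSubcategory m, ∀ t',
      realizationMap P.ι (simplexMap ρ t') =
        simplexMap σ (stdSimplex.map (S.orderEmbOfFin hm) t') := by
  let θ : ⦋m⦌ ⟶ ⦋n⦌ := SimplexCategory.mkHom (S.orderEmbOfFin hm).toOrderHom
  refine ⟨P.lift ((nerve C).map θ.op σ : ComposableArrows C m)
    (fun a => hS _ (Finset.orderEmbOfFin_mem S hm a)), fun t' => ?_⟩
  rw [realizationMap_simplexMap]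
  exact simplexMap_whiskerLeft σ θ t'

-- The function measures the total weight of the vertices outside `P`. If it vanishes, the point
-- lies on the face spanned by the vertices in `P`, and by fullness this face is a simplex of the
-- subcategory.
open Classical in
lemma mem_range_realizationMap_ι (x : Realization C) :
    x ∈ Set.range (realizationMap P.ι) ↔
      lin (fun X => if P X then (0 : ℝ) else 1) x = 0 := by
  constructor
  · rintro ⟨y, rfl⟩
    obtain ⟨n, σ, t, rfl⟩ := exists_simplexMap_eq y
    rw [lin_realizationMap, lin_simplexMap]
    refine Finset.sum_eq_zero fun i _ => ?_
    have h : (if P (P.ι.obj (σ.obj i)) then (0 : ℝ) else 1) = 0 := if_pos (σ.obj i).property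
    rw [h, zero_mul]
  · obtain ⟨n, σ, t, rfl⟩ := exists_simplexMap_eq x
    intro h
    rw [lin_simplexMap, Finset.sum_eq_zero_iff_of_nonneg] at h
    · let S : Finset (Fin (n + 1)) := Finset.univ.filter fun i => P (σ.obj i)
      have ht : ∀ i ∉ S, t i = 0 := by
        intro i hi
        have := h i (Finset.mem_univ _)
        simpa [show ¬ P (σ.obj i) by simpa [S] using hi] using this
      have hS : S.Nonempty := by
        by_contra hS
        rw [Finset.not_nonempty_iff_eq_empty] at hS
        have := stdSimplex.sum_eq_one t
        rw [Finset.sum_eq_zero fun i _ => ht i (by simp [hS])] at this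
        exact zero_ne_one this
      obtain ⟨m, hm⟩ := Nat.exists_eq_succ_of_ne_zero hS.card_pos.ne'
      obtain ⟨t', ht', -⟩ := exists_face t S ht hm
      obtain ⟨ρ, hρ⟩ := exists_lift_face P σ S (by simp [S]) hm
      exact ⟨simplexMap ρ t', by rw [hρ, ht']⟩
    · intro i _
      refine mul_nonneg ?_ (stdSimplex.zero_le t i)
      split_ifs <;> simp

/-- The realization of a full subcategory of a graded category is a closed subspace. -/
lemma isClosedEmbedding_realizationMap_ι (G : Grading C) :
    Topology.IsClosedEmbedding (realizationMap P.ι) := by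
  classical
  have : T2Space (Realization C) := t2Space G
  refine .of_continuous_injective_isClosedMap (realizationMap P.ι).continuous
    (realizationMap_ι_injective P G) fun A hA => ?_
  -- In a given simplex, the image of `A` lies in the face spanned by the vertices in `P`, where it
  -- is the image of a compact set.
  refine isClosed_of_preimage _ fun n σ => ?_
  let S : Finset (Fin (n + 1)) := Finset.univ.filter fun i => P (σ.obj i)
  have hsupp : ∀ t ∈ simplexMap σ ⁻¹' (realizationMap P.ι '' A), ∀ i ∉ S, t i = 0 := by
    rintro t ⟨y, -, hy⟩ i hi
    have h : simplexMap σ t ∈ Set.range (realizationMap P.ι) := ⟨y, hy⟩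
    rw [mem_range_realizationMap_ι, lin_simplexMap, Finset.sum_eq_zero_iff_of_nonneg] at h
    · simpa [show ¬ P (σ.obj i) by simpa [S] using hi] using h i (Finset.mem_univ _)
    · intro i _
      refine mul_nonneg ?_ (stdSimplex.zero_le t i)
      split_ifs <;> simp
  rcases Nat.eq_zero_or_pos S.card with h0 | hpos
  · convert isClosed_empty
    rw [Set.eq_empty_iff_forall_notMem]
    intro t ht
    rw [Finset.card_eq_zero] at h0
    have := stdSimplex.sum_eq_one t
    rw [Finset.sum_eq_zero fun i _ => hsupp t ht i (by simp [h0])] at this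
    exact zero_ne_one this
  · obtain ⟨m, hm⟩ := Nat.exists_eq_succ_of_ne_zero hpos.ne'
    obtain ⟨ρ, hρ⟩ := exists_lift_face P σ S (by simp [S]) hm
    have : simplexMap σ ⁻¹' (realizationMap P.ι '' A) =
        stdSimplex.map (S.orderEmbOfFin hm) '' (simplexMap ρ ⁻¹' A) := by
      ext t
      constructor
      · intro ht
        obtain ⟨t', ht', -⟩ := exists_face t S (hsupp t ht) hm
        obtain ⟨y, hy, hyt⟩ := ht
        refine ⟨t', ?_, ht'⟩
        rw [← ht', ← hρ] at hyt
        rwa [Set.mem_preimage, ← realizationMap_ι_injective P G hyt]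
      · rintro ⟨t', ht', rfl⟩
        exact ⟨_, ht', hρ t'⟩
    rw [this]
    exact ((hA.preimage (simplexMap ρ).continuous).isCompact.image
      (stdSimplex.continuous_map _)).isClosed

end sub

end Realization

end

section

/-! ### The cells of the realization of a graded category -/

open Simplicial Opposite

namespace Realization

section overCategory

variable {C : Type u} [Category.{v} C]

/-- A simplex together with a morphism out of its last vertex gives a simplex of the over
category. -/
def overLift {n : ℕ} (σ : ComposableArrows C n) {X : C} (a : σ.obj (Fin.last n) ⟶ X) :
    ComposableArrows (Over X) n where
  obj i := Over.mk (σ.map (homOfLE (Fin.le_last i)) ≫ a)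
  map {i j} f := Over.homMk (σ.map f) (by
    change σ.map f ≫ σ.map _ ≫ a = σ.map _ ≫ a
    rw [← Category.assoc, ← σ.map_comp]
    rfl)
  map_id i := by
    ext
    exact σ.map_id i
  map_comp f g := by
    ext
    exact σ.map_comp f g

/-- The structure maps of a chain over `X` are composites of the chain with the last structure map.
-/
lemma overLift_eq {n : ℕ} {X : C} (τ : ComposableArrows (Over X) n) :
    overLift (τ ⋙ Over.forget X) (τ.obj (Fin.last n)).hom = τ := by
  have hobj : ∀ i, (overLift (τ ⋙ Over.forget X) (τ.obj (Fin.last n)).hom).obj i = τ.obj i := by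
    intro i
    change Over.mk ((τ.map (homOfLE (Fin.le_last i))).left ≫ (τ.obj (Fin.last n)).hom) =
      Over.mk (τ.obj i).hom
    rw [Over.w]
  refine Functor.ext_of_iso (NatIso.ofComponents (fun i => Over.isoMk (Iso.refl _) ?_) ?_)
    hobj ?_
  · change 𝟙 _ ≫ (τ.obj i).hom =
      (τ.map (homOfLE (Fin.le_last i))).left ≫ (τ.obj (Fin.last n)).hom
    rw [Over.w, Category.id_comp]
  · intro i j f
    ext
    change (τ.map f).left ≫ 𝟙 _ = 𝟙 _ ≫ (τ.map f).left
    rw [Category.comp_id, Category.id_comp]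
  · intro i
    ext
    rw [Over.eqToHom_left]
    rfl

/-- The grading of an over category. -/
def _root_.Grading.over (G : Grading C) (X : C) : Grading (Over X) where
  d Y := G.d Y.left
  lt_or {Y Z} f := by
    rcases G.lt_or f.left with h | ⟨h, h'⟩
    · exact Or.inl h
    · right
      have key : ∀ (A B : C) (a : A ⟶ X) (b : B ⟶ X) (g : Over.mk a ⟶ Over.mk b) (e : A = B),
          g.left = eqToHom e → ∃ e' : Over.mk a = Over.mk b, g = eqToHom e' := by
        rintro A _ a b g rfl hg
        have h1 := Over.w g
        rw [hg] at h1
        have h2 : b = a := by simpa using h1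
        subst h2
        exact ⟨rfl, Over.OverMorphism.ext hg⟩
      exact key _ _ Y.hom Z.hom f h h'

lemma _root_.Grading.isIso_iff (G : Grading C) {X Y : C} (a : X ⟶ Y) : IsIso a ↔ G.d X = G.d Y := by
  constructor
  · intro h
    rcases G.lt_or a with h1 | ⟨rfl, -⟩
    · rcases G.lt_or (inv a) with h2 | ⟨h2, -⟩
      · omega
      · rw [h2]
    · rfl
  · intro h
    rcases G.lt_or a with h1 | ⟨e, h'⟩
    · omega
    · rw [h']; infer_instance

lemma _root_.Grading.le (G : Grading C) {X Y : C} (a : X ⟶ Y) : G.d X ≤ G.d Y := by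
  rcases G.lt_or a with h1 | ⟨rfl, -⟩
  · exact h1.le
  · rfl

variable {C : Type u} [Category.{u} C]

lemma realizationMap_forget_overLift {n : ℕ} (σ : ComposableArrows C n) {X : C}
    (a : σ.obj (Fin.last n) ⟶ X) (t : stdSimplex ℝ (Fin (n + 1))) :
    realizationMap (Over.forget X) (simplexMap (overLift σ a) t) = simplexMap σ t :=
  realizationMap_simplexMap _ _ _

/-- Points over `X` outside of the boundary come from simplices that end in `X`. -/
lemma exists_eq_overLift (G : Grading C) {X : C} (y : Realization (Over X))
    (hy : y ∉ Set.range (realizationMap (overBoundary X).ι)) :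
    ∃ (n : ℕ) (σ : ComposableArrows C n) (t : stdSimplex ℝ (Fin (n + 1))),
      IsStrict G σ ∧ (∀ i, 0 < t i) ∧ (⟨X, y⟩ : Σ X : C, Realization (Over X)) =
        ⟨σ.obj (Fin.last n), simplexMap (overLift σ (𝟙 _)) t⟩ := by
  classical
  obtain ⟨n, τ, t, hτ, ht, rfl⟩ := exists_strict (G.over X) y
  rw [mem_range_realizationMap_ι] at hy
  have h1 : 0 < lin (fun Y : Over X => if ¬ overBoundary X Y then (1 : ℝ) else 0)
      (simplexMap τ t) := by
    refine lt_of_le_of_ne ?_ (Ne.symm ?_)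
    · rw [lin_simplexMap]
      refine Finset.sum_nonneg fun i _ => mul_nonneg ?_ (stdSimplex.zero_le t i)
      split_ifs <;> simp
    · simpa only [ite_not] using hy
  rw [lin_indicator_pos_iff τ t ht] at h1
  obtain ⟨i, hi⟩ := h1
  -- Some vertex has the degree of `X`. Degrees do not decrease along the chain, so the last vertex
  -- has it too, and its structure map is an identity.
  rw [overBoundary, not_not, G.isIso_iff] at hi
  have h2 : G.d (τ.obj (Fin.last n)).left = G.d X := by
    refine le_antisymm (G.le (τ.obj (Fin.last n)).hom) ?_
    have := G.le (τ.map (homOfLE (Fin.le_last i))).left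
    exact hi.symm.le.trans this
  rcases G.lt_or (τ.obj (Fin.last n)).hom with h3 | ⟨h3, h4⟩
  · exact absurd h3 (by rw [h2]; exact lt_irrefl _)
  · refine ⟨n, τ ⋙ Over.forget X, t, hτ, ht, ?_⟩
    have key : ∀ (ρ : ComposableArrows C n) (X : C) (a : ρ.obj (Fin.last n) ⟶ X)
        (e : ρ.obj (Fin.last n) = X), a = eqToHom e →
        (⟨X, simplexMap (overLift ρ a) t⟩ : Σ X : C, Realization (Over X)) =
        ⟨ρ.obj (Fin.last n), simplexMap (overLift ρ (𝟙 _)) t⟩ := by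
      rintro ρ _ a rfl rfl
      rfl
    have := key (τ ⋙ Over.forget X) X (τ.obj (Fin.last n)).hom h3 h4
    rwa [overLift_eq] at this

/-- Outside of the boundaries, a point of the realization of `C` lies in exactly one cell. -/
lemma eq_of_realizationMap_forget_eq (G : Grading C) {X X' : C} {y : Realization (Over X)}
    {y' : Realization (Over X')} (hy : y ∉ Set.range (realizationMap (overBoundary X).ι))
    (hy' : y' ∉ Set.range (realizationMap (overBoundary X').ι))
    (h : realizationMap (Over.forget X) y = realizationMap (Over.forget X') y') :
    (⟨X, y⟩ : Σ X : C, Realization (Over X)) = ⟨X', y'⟩ := by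
  obtain ⟨n, σ, t, hσ, ht, e⟩ := exists_eq_overLift G y hy
  obtain ⟨n', σ', t', hσ', ht', e'⟩ := exists_eq_overLift G y' hy'
  have hx : simplexMap σ t = simplexMap σ' t' := by
    rw [← realizationMap_forget_overLift σ (𝟙 _) t, ← realizationMap_forget_overLift σ' (𝟙 _) t']
    have key : ∀ s s' : Σ X : C, Realization (Over X), s = s' →
      realizationMap (Over.forget s.1) s.2 = realizationMap (Over.forget s'.1) s'.2 := by
      rintro s _ rfl
      rfl
    exact (key _ _ e).symm.trans (h.trans (key _ _ e'))
  have hu := strict_unique G hσ hσ' ht ht' (fun c => by rw [hx]) (fun q hq => by rw [hx])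
  rw [e, e']
  obtain ⟨rfl, hu⟩ := Sigma.mk.inj_iff.1 hu
  obtain ⟨rfl, rfl⟩ := Prod.mk.inj (eq_of_heq hu)
  rfl

/-- The point is assigned to the last vertex of its strict simplex. Lifted with the identity as last
structure map, the simplex has a vertex of positive weight outside the boundary. -/
lemma exists_notMem_boundary (G : Grading C) (x : Realization C) :
    ∃ (X : C) (y : Realization (Over X)),
      y ∉ Set.range (realizationMap (overBoundary X).ι) ∧
      realizationMap (Over.forget X) y = x := by
  classical
  obtain ⟨n, σ, t, hσ, ht, rfl⟩ := exists_strict G x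
  refine ⟨_, simplexMap (overLift σ (𝟙 _)) t, ?_, realizationMap_forget_overLift _ _ _⟩
  rw [mem_range_realizationMap_ι]
  have := (lin_indicator_pos_iff (overLift σ (𝟙 _)) t ht (fun Y => ¬ overBoundary _ Y)).2
    ⟨Fin.last n, by
      rw [overBoundary, not_not]
      rw [G.isIso_iff]
      rfl⟩
  simp only [ite_not] at this
  exact this.ne'

/-- Boundary points lie in cells of smaller degree. -/
lemma exists_of_mem_boundary (G : Grading C) {X : C} {y : Realization (Over X)}
    (hy : y ∈ Set.range (realizationMap (overBoundary X).ι)) :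
    ∃ (Y : Over X) (z : Realization (Over Y.left)), G.d Y.left < G.d X ∧
      realizationMap (Over.forget Y.left) z = realizationMap (Over.forget X) y := by
  obtain ⟨w, rfl⟩ := hy
  obtain ⟨n, τ, t, rfl⟩ := exists_simplexMap_eq w
  have h1 : ¬ IsIso (τ.obj (Fin.last n)).obj.hom := (τ.obj (Fin.last n)).property
  rw [G.isIso_iff] at h1
  -- The whole chain lies over its last object, whose degree is smaller than that of `X` since its
  -- structure map is not invertible.
  refine ⟨(τ.obj (Fin.last n)).obj,
    simplexMap (overLift ((τ ⋙ (overBoundary X).ι) ⋙ Over.forget X) (𝟙 _)) t,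
    lt_of_le_of_ne (G.le (τ.obj (Fin.last n)).obj.hom) h1, ?_⟩
  rw [realizationMap_simplexMap (overBoundary X).ι, realizationMap_simplexMap (Over.forget X)]
  exact realizationMap_forget_overLift _ _ _

/-- Replacing a boundary point by one over an object of smaller degree has to stop. -/
lemma exists_notMem_boundary_le (G : Grading C) {X : C} (y : Realization (Over X)) :
    ∃ (Z : C) (w : Realization (Over Z)),
      w ∉ Set.range (realizationMap (overBoundary Z).ι) ∧ G.d Z ≤ G.d X ∧
      realizationMap (Over.forget Z) w = realizationMap (Over.forget X) y := by
  induction hn : G.d X using Nat.strong_induction_on generalizing X with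
  | _ n ih =>
    by_cases hy : y ∈ Set.range (realizationMap (overBoundary X).ι)
    · obtain ⟨Y, z, hY, hz⟩ := exists_of_mem_boundary G hy
      obtain ⟨Z, w, hw, hZ, hwz⟩ := ih _ (hn ▸ hY) z rfl
      exact ⟨Z, w, hw, by omega, hwz.trans hz⟩
    · exact ⟨X, y, hy, hn.le, rfl⟩

end overCategory

/-! ### The CW structure obtained from balls over all objects -/

section cells

open Metric Topology

variable {C : Type u} [Category.{u} C] (G : Grading C)
  (h : ∀ (p : ℕ) (X : {X : C // G.d X = p}),
    closedBall (0 : Fin p → ℝ) 1 ≃ₜ Realization (Over X.1))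

open Classical in
/-- The characteristic map of a cell, extended by a constant to the complement of the ball. -/
noncomputable def charMap (p : ℕ) (X : {X : C // G.d X = p}) (x : Fin p → ℝ) : Realization C :=
  realizationMap (Over.forget X.1)
    (h p X (if hx : x ∈ closedBall 0 1 then ⟨x, hx⟩ else ⟨0, mem_closedBall_self zero_le_one⟩))

variable {G}

lemma charMap_of_mem {p : ℕ} (X : {X : C // G.d X = p}) {x : Fin p → ℝ}
    (hx : x ∈ closedBall (0 : Fin p → ℝ) 1) :
    charMap G h p X x = realizationMap (Over.forget X.1) (h p X ⟨x, hx⟩) := by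
  rw [charMap, dif_pos hx]

lemma range_subset_charMap_image {p : ℕ} (X : {X : C // G.d X = p}) :
    charMap G h p X '' closedBall 0 1 = Set.range (realizationMap (Over.forget X.1)) := by
  ext x
  constructor
  · rintro ⟨y, hy, rfl⟩
    rw [charMap_of_mem h X hy]
    exact ⟨_, rfl⟩
  · rintro ⟨y, rfl⟩
    refine ⟨((h p X).symm y).1, ((h p X).symm y).2, ?_⟩
    rw [charMap_of_mem h X ((h p X).symm y).2]
    simp

lemma continuousOn_charMap {p : ℕ} (X : {X : C // G.d X = p}) :
    ContinuousOn (charMap G h p X) (closedBall 0 1) := by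
  rw [continuousOn_iff_continuous_domRestrict]
  have : (closedBall (0 : Fin p → ℝ) 1).domRestrict (charMap G h p X) =
      fun x => realizationMap (Over.forget X.1) (h p X x) := by
    funext x
    exact charMap_of_mem h X x.2
  rw [this]
  exact (realizationMap _).continuous.comp (h p X).continuous

variable (hb : ∀ p X x, x.1 ∈ sphere (0 : Fin p → ℝ) 1 ↔
    h p X x ∈ Set.range (realizationMap (overBoundary X.1).ι))

include hb

/-- Points of the open ball lie off the boundary, where `eq_of_realizationMap_forget_eq` recovers
both the object and the point over it. Disjointness of the open cells and injectivity on each of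
them are obtained together. -/
lemma charMap_eq {p p' : ℕ} {X : {X : C // G.d X = p}} {X' : {X : C // G.d X = p'}}
    {x : Fin p → ℝ} {x' : Fin p' → ℝ} (hx : x ∈ ball 0 1) (hx' : x' ∈ ball 0 1)
    (e : charMap G h p X x = charMap G h p' X' x') :
    (⟨p, X, x⟩ : Σ p, {X : C // G.d X = p} × (Fin p → ℝ)) = ⟨p', X', x'⟩ := by
  have nb : ∀ {p : ℕ} {X : {X : C // G.d X = p}} {x : Fin p → ℝ} (hx : x ∈ ball 0 1),
      h p X ⟨x, ball_subset_closedBall hx⟩ ∉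
        Set.range (realizationMap (overBoundary X.1).ι) := by
    intro p X x hx
    rw [← hb]
    simp only [mem_sphere, mem_ball] at hx ⊢
    exact hx.ne
  rw [charMap_of_mem h X (ball_subset_closedBall hx),
    charMap_of_mem h X' (ball_subset_closedBall hx')] at e
  have := eq_of_realizationMap_forget_eq G (nb hx) (nb hx') e
  obtain ⟨X, rfl⟩ := X
  obtain ⟨X', rfl⟩ := X'
  obtain ⟨h1, h2⟩ := Sigma.mk.inj_iff.1 this
  dsimp only at h1
  subst h1
  have := (h _ _).injective (eq_of_heq h2)
  rw [Subtype.mk.injEq] at this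
  rw [this]

/-- The boundary is covered by the cells of the sources of morphisms to `X`, of which there are
finitely many. -/
lemma charMap_mem_iUnion [∀ X : C, Finite (Over X)] {p : ℕ} (X : {X : C // G.d X = p}) :
    ∃ I : Π m, Finset {X : C // G.d X = m}, MapsTo (charMap G h p X) (sphere 0 1)
      (⋃ (m < p) (j ∈ I m), charMap G h m j '' closedBall 0 1) := by
  refine ⟨fun m => (((Set.finite_range (fun Y : Over X.1 => Y.left)).preimage
    Subtype.val_injective.injOn).toFinset : Finset {X : C // G.d X = m}), fun x hx => ?_⟩
  have hx' := sphere_subset_closedBall hx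
  obtain ⟨Y, z, hY, hz⟩ := exists_of_mem_boundary G ((hb p X ⟨x, hx'⟩).1 hx)
  rw [X.2] at hY
  simp only [Set.mem_iUnion]
  refine ⟨G.d Y.left, hY, ⟨Y.left, rfl⟩, by simp, ?_⟩
  rw [range_subset_charMap_image, charMap_of_mem h X hx']
  exact ⟨z, hz⟩

/-- The realization of a graded category is a CW complex if the over categories of all objects
realize to balls of the right dimension. -/
@[reducible] noncomputable def cwComplex [∀ X : C, Finite (Over X)] :
    CWComplex (Set.univ : Set (Realization C)) where
  cell p := {X : C // G.d X = p}
  map p X := InjOn.toPartialEquiv (charMap G h p X) (ball 0 1) fun x hx y hy e => by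
    have := charMap_eq h hb hx hy e
    simpa using this
  source_eq p X := rfl
  continuousOn p X := continuousOn_charMap h X
  continuousOn_symm p X := by
    have : T2Space (Realization C) := t2Space G
    have hinj : InjOn (charMap G h p X) (ball 0 1) := fun x hx y hy e => by
      have := charMap_eq h hb hx hy e
      simpa using this
    rw [continuousOn_iff_isClosed]
    intro K hK
    -- This image is compact, hence closed. It meets the open cell only in images of points of the
    -- open ball, since points of the sphere are carried to open cells of smaller degree.
    refine ⟨charMap G h p X '' (K ∩ closedBall 0 1), ?_, ?_⟩
    · exact (((isCompact_closedBall _ _).inter_left hK).image_of_continuousOn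
        ((continuousOn_charMap h X).mono Set.inter_subset_right)).isClosed
    · ext y
      constructor
      · rintro ⟨hy, x, hx, rfl⟩
        refine ⟨⟨x, ⟨?_, ball_subset_closedBall hx⟩, rfl⟩, ⟨x, hx, rfl⟩⟩
        have := hinj.leftInvOn_invFunOn hx
        rw [Set.mem_preimage] at hy
        convert hy
        exact this.symm
      · rintro ⟨⟨x, ⟨hxK, hx⟩, rfl⟩, x', hx', e⟩
        have hxb : x ∈ ball (0 : Fin p → ℝ) 1 := by
          by_contra hxb
          have hs : x ∈ sphere (0 : Fin p → ℝ) 1 := by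
            simp only [mem_sphere, mem_ball, mem_closedBall] at hx hxb ⊢
            exact le_antisymm hx (not_lt.1 hxb)
          obtain ⟨Y, z, hY, hz⟩ := exists_of_mem_boundary G ((hb p X ⟨x, hx⟩).1 hs)
          obtain ⟨Z, w, hw, hZ, hwz⟩ := exists_notMem_boundary_le G z
          have hx'' : h p X ⟨x', ball_subset_closedBall hx'⟩ ∉
              Set.range (realizationMap (overBoundary X.1).ι) := by
            rw [← hb]
            exact (mem_ball.1 hx').ne
          rw [charMap_of_mem h X hx, charMap_of_mem h X (ball_subset_closedBall hx'), ← hz,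
            ← hwz] at e
          have := (Sigma.mk.inj_iff.1 (eq_of_realizationMap_forget_eq G hx'' hw e)).1
          rw [← this] at hZ
          omega
        refine ⟨?_, x, hxb, rfl⟩
        have := hinj.leftInvOn_invFunOn hxb
        rw [Set.mem_preimage]
        convert hxK
        exact this
  pairwiseDisjoint' := by
    rintro ⟨p, X⟩ - ⟨p', X'⟩ - hne
    rw [Function.onFun, Set.disjoint_left]
    rintro _ ⟨x, hx, rfl⟩ ⟨x', hx', e⟩
    have := charMap_eq h hb hx' hx e
    refine hne ?_
    obtain ⟨rfl, h2⟩ := Sigma.mk.inj_iff.1 this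
    obtain ⟨rfl, -⟩ := Prod.mk.inj (eq_of_heq h2)
    rfl
  mapsTo' p X := charMap_mem_iUnion h hb X
  -- A simplex lies in the closed cell of its last vertex, so the weak topology for cells follows
  -- from the one for simplices.
  closed' A _ hA := by
    refine isClosed_of_preimage _ fun n σ => ?_
    have h1 := hA (G.d (σ.obj (Fin.last n))) ⟨σ.obj (Fin.last n), rfl⟩
    have h2 : simplexMap σ ⁻¹' A = simplexMap σ ⁻¹' (A ∩ charMap G h _
        ⟨σ.obj (Fin.last n), rfl⟩ '' closedBall 0 1) := by
      ext t
      refine ⟨fun ht => ⟨ht, ?_⟩, fun ht => ht.1⟩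
      rw [range_subset_charMap_image]
      exact ⟨_, realizationMap_forget_overLift σ (𝟙 _) t⟩
    rw [h2]
    exact h1.preimage (simplexMap σ).continuous
  union' := by
    refine Set.eq_univ_of_forall fun x => ?_
    obtain ⟨X, y, -, rfl⟩ := exists_notMem_boundary G x
    simp only [Set.mem_iUnion]
    refine ⟨G.d X, ⟨X, rfl⟩, ?_⟩
    change _ ∈ charMap G h _ _ '' _
    rw [range_subset_charMap_image]
    exact ⟨y, rfl⟩

/-- A chain of objects of degree at most `p` lies in the closed cell of its last vertex; conversely
all objects over `X` have at most the degree of `X`. -/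
lemma range_realizationMap_eq_skeleton [∀ X : C, Finite (Over X)] [T2Space (Realization C)]
    (p : ℕ) :
    letI := cwComplex h hb
    Set.range (realizationMap (ObjectProperty.ι fun X : C => G.d X ≤ p)) =
      (CWComplex.skeleton (Set.univ : Set (Realization C)) (p : ℕ∞) : Set (Realization C)) := by
  classical
  let := cwComplex h hb
  rw [RelCWComplex.coe_skeletonLT, Set.empty_union]
  ext x
  simp only [Set.mem_iUnion]
  constructor
  · rintro ⟨y, rfl⟩
    obtain ⟨n, τ, t, rfl⟩ := exists_simplexMap_eq y
    rw [realizationMap_simplexMap]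
    have hl := (τ.obj (Fin.last n)).property
    refine ⟨_, ?_, ⟨(τ.obj (Fin.last n)).obj, rfl⟩, ?_⟩
    -- The `p`-skeleton is expressed by the cells of dimension strictly below `p + 1`.
    · exact_mod_cast Nat.lt_succ_of_le hl
    · change _ ∈ charMap G h _ _ '' _
      rw [range_subset_charMap_image]
      exact ⟨_, realizationMap_forget_overLift (τ ⋙ ObjectProperty.ι _) (𝟙 _) t⟩
  · rintro ⟨m, hm, X, hx⟩
    have hm' : m ≤ p := Nat.lt_succ_iff.1 (by exact_mod_cast hm)
    change _ ∈ charMap G h _ _ '' _ at hx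
    rw [range_subset_charMap_image] at hx
    obtain ⟨y, rfl⟩ := hx
    obtain ⟨n, τ, t, rfl⟩ := exists_simplexMap_eq y
    rw [mem_range_realizationMap_ι, lin_realizationMap, lin_simplexMap]
    refine Finset.sum_eq_zero fun i _ => ?_
    have h1 : G.d ((Over.forget X.1).obj (τ.obj i)) ≤ p := by
      have := G.le (τ.obj i).hom
      exact this.trans ((show G.d X.1 = m from X.2).le.trans hm')
    rw [if_pos h1, zero_mul]

end cells

end Realization

end

section

/-! ### Categories modelled by sets of pairwise compatible elements -/

open Simplicial Opposite

/-- A thin category whose objects correspond to the sets of pairwise compatible elements of `E`,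
with morphisms the reverse inclusions. -/
structure CubeModel (C : Type u) [Category.{v} C] (E : Type) (R : E → E → Prop) where
  D : C → Set E
  thin : Quiver.IsThin C
  nonempty_hom_iff : ∀ X Y, Nonempty (X ⟶ Y) ↔ D Y ⊆ D X
  injective : Function.Injective D
  compat : ∀ X, ∀ e ∈ D X, ∀ e' ∈ D X, R e e'
  exists_eq : ∀ S : Set E, (∀ e ∈ S, ∀ e' ∈ S, R e e') → ∃ X, D X = S

/-- Weights in the unit interval with pairwise compatible support. -/
def cubeWeights {E : Type} (R : E → E → Prop) : Set (E → ℝ) :=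
  {w | (∀ e, 0 ≤ w e) ∧ (∀ e, w e ≤ 1) ∧ ∀ e e', 0 < w e → 0 < w e' → R e e'}

namespace CubeModel

open Realization

variable {C : Type u} [Category.{v} C] {E : Type} {R : E → E → Prop} (M : CubeModel C E R)

/-- The grading by the number of missing elements. -/
noncomputable def grading [Finite E] : Grading C where
  d X := Nat.card E - (M.D X).ncard
  lt_or {X Y} f := by
    have := M.thin
    have h := (M.nonempty_hom_iff X Y).1 ⟨f⟩
    rcases h.eq_or_ssubset with h | h
    · have e := M.injective h
      subst e
      exact Or.inr ⟨rfl, Subsingleton.elim _ _⟩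
    · left
      have h1 := Set.ncard_lt_ncard h
      have h2 := Set.ncard_le_card (M.D X)
      omega

open Classical in
/-- The weight function of a point. -/
noncomputable def weight (x : Realization C) (e : E) : ℝ :=
  lin (fun X => if e ∈ M.D X then 1 else 0) x

lemma continuous_weight : Continuous M.weight :=
  continuous_pi fun _ => (lin _).continuous

open Classical in
lemma weight_simplexMap {n : ℕ} (σ : ComposableArrows C n) (t : stdSimplex ℝ (Fin (n + 1)))
    (e : E) : M.weight (simplexMap σ t) e = ∑ i, if e ∈ M.D (σ.obj i) then t i else 0 := by
  rw [weight, lin_simplexMap]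
  refine Finset.sum_congr rfl fun i _ => ?_
  split_ifs <;> simp

lemma D_anti {n : ℕ} (σ : ComposableArrows C n) {i j : Fin (n + 1)} (h : i ≤ j) :
    M.D (σ.obj j) ⊆ M.D (σ.obj i) :=
  (M.nonempty_hom_iff _ _).1 ⟨σ.map (homOfLE h)⟩

/-- The sets decrease along the chain. Two elements of positive weight therefore lie together in the
larger of two sets containing one of them each. -/
lemma weight_mem (x : Realization C) : M.weight x ∈ cubeWeights R := by
  classical
  obtain ⟨n, σ, t, rfl⟩ := exists_simplexMap_eq x
  refine ⟨fun e => ?_, fun e => ?_, fun e e' he he' => ?_⟩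
  · rw [weight_simplexMap]
    exact Finset.sum_nonneg fun i _ => by split_ifs <;> simp
  · rw [weight_simplexMap, ← stdSimplex.sum_eq_one t]
    refine Finset.sum_le_sum fun i _ => ?_
    split_ifs
    · rfl
    · exact stdSimplex.zero_le t i
  · rw [weight_simplexMap] at he he'
    obtain ⟨i, -, hi⟩ := Finset.exists_ne_zero_of_sum_ne_zero he.ne'
    obtain ⟨j, -, hj⟩ := Finset.exists_ne_zero_of_sum_ne_zero he'.ne'
    have hi' : e ∈ M.D (σ.obj i) := by by_contra h; simp [h] at hi
    have hj' : e' ∈ M.D (σ.obj j) := by by_contra h; simp [h] at hj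
    rcases le_total i j with h | h
    · exact M.compat _ _ hi' _ (M.D_anti σ h hj')
    · exact M.compat _ _ (M.D_anti σ h hi') _ hj'

/-- The values of affine functions are determined by the superlevel sets of the weight function. -/
lemma lin_eq_integral (c : C → ℝ) (g : Set E → ℝ) (hg : ∀ X, g (M.D X) = c X)
    (x : Realization C) : lin c x = ∫ s in (0 : ℝ)..1, g {e | s ≤ M.weight x e} := by
  classical
  obtain ⟨n, σ, t, rfl⟩ := exists_simplexMap_eq x
  let t' : ℕ → ℝ := fun k => if h : k < n + 1 then t ⟨k, h⟩ else 0
  have ht' : ∀ i : Fin (n + 1), t' i = t i := fun i => by simp only [t', i.2, dif_pos]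
  have ht0 : ∀ k, 0 ≤ t' k := fun k => by
    simp only [t']; split_ifs <;> simp
  -- As the sets decrease along the chain, the weight of `e` is `T (m + 1)` for the last index `m`
  -- whose set contains `e`, or zero if there is none. Hence the superlevel set is constantly `M.D
  -- (σ.obj i)` for levels in `Ioc (T i) (T (i + 1))`, and the integral becomes a finite sum.
  let T : ℕ → ℝ := fun k => ∑ j ∈ Finset.range k, t' j
  have hTs : ∀ k, T (k + 1) = T k + t' k := fun k => Finset.sum_range_succ _ _
  have hmono : Monotone T := monotone_nat_of_le_succ fun k => by rw [hTs]; linarith [ht0 k]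
  have hT1 : T (n + 1) = 1 := by
    rw [← stdSimplex.sum_eq_one t]
    simp only [T, ← ht']
    exact (Fin.sum_univ_eq_sum_range t' (n + 1)).symm
  have hw : ∀ e, M.weight (simplexMap σ t) e =
      ∑ k ∈ Finset.range (n + 1), if ∃ h : k < n + 1, e ∈ M.D (σ.obj ⟨k, h⟩) then t' k else 0 := by
    intro e
    rw [weight_simplexMap, ← Fin.sum_univ_eq_sum_range
      (fun k => if ∃ h : k < n + 1, e ∈ M.D (σ.obj ⟨k, h⟩) then t' k else 0)]
    refine Finset.sum_congr rfl fun i _ => ?_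
    simp only [ht', i.2, exists_true_left]
  have hlevel : ∀ i : Fin (n + 1), ∀ s ∈ Set.Ioc (T i) (T (i + 1)),
      {e | s ≤ M.weight (simplexMap σ t) e} = M.D (σ.obj i) := by
    intro i s hs
    ext e
    rw [Set.mem_ofPred_eq, hw]
    constructor
    · intro h
      by_contra he
      have : ∑ k ∈ Finset.range (n + 1),
          (if ∃ h : k < n + 1, e ∈ M.D (σ.obj ⟨k, h⟩) then t' k else 0) ≤ T i := by
        rw [← Finset.sum_subset (Finset.range_mono i.2.le)]
        · refine Finset.sum_le_sum fun k _ => ?_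
          split_ifs
          · rfl
          · exact ht0 k
        · intro k hk hki
          refine if_neg ?_
          rintro ⟨h, hk'⟩
          refine he (M.D_anti σ ?_ hk')
          simpa [Fin.le_def] using hki
      linarith [hs.1]
    · intro he
      refine hs.2.trans ?_
      have h1 : T (i + 1) = ∑ k ∈ Finset.range (i + 1),
          (if ∃ h : k < n + 1, e ∈ M.D (σ.obj ⟨k, h⟩) then t' k else 0) := by
        refine Finset.sum_congr rfl fun k hk => ?_
        rw [Finset.mem_range] at hk
        have hkn : k < n + 1 := by have := i.2; omega
        rw [if_pos ⟨hkn, M.D_anti σ (Fin.le_def.2 (Nat.lt_succ_iff.1 hk)) he⟩]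
      rw [h1]
      refine Finset.sum_le_sum_of_subset_of_nonneg (Finset.range_mono i.2) fun k _ _ => ?_
      split_ifs
      · exact ht0 k
      · rfl
  have hint : ∀ k < n + 1, ∀ h : k < n + 1,
      Set.EqOn (fun s => g {e | s ≤ M.weight (simplexMap σ t) e})
        (fun _ => c (σ.obj ⟨k, h⟩)) (Set.uIoc (T k) (T (k + 1))) := by
    intro k _ h s hs
    rw [Set.uIoc_of_le (hmono (Nat.le_succ k))] at hs
    change g _ = _
    rw [hlevel ⟨k, h⟩ s hs, hg]
  have h0 : T 0 = 0 := rfl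
  rw [← h0, ← hT1, ← intervalIntegral.sum_integral_adjacent_intervals]
  · rw [lin_simplexMap, ← Fin.sum_univ_eq_sum_range
      (fun k => ∫ s in T k..T (k + 1), g {e | s ≤ M.weight (simplexMap σ t) e})]
    refine Finset.sum_congr rfl fun i _ => ?_
    rw [intervalIntegral.integral_congr_ae (g := fun _ => c (σ.obj i))]
    · rw [intervalIntegral.integral_const, hTs, ht']
      simp [mul_comm]
    · exact Filter.Eventually.of_forall fun s hs => hint i i.2 i.2 hs
  · intro k hk
    exact (intervalIntegrable_congr (hint k hk hk)).2 intervalIntegrable_const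

/-- By the integral formula the weights determine all affine functions, and these separate points in
a thin category. -/
lemma weight_injective [Finite E] : Function.Injective M.weight := by
  classical
  intro x y h
  have := M.thin
  refine eq_of_lin M.grading fun c => ?_
  let g : Set E → ℝ := fun S => if h : ∃ X, M.D X = S then c h.choose else 0
  have hg : ∀ X, g (M.D X) = c X := by
    intro X
    have h : ∃ X', M.D X' = M.D X := ⟨X, rfl⟩
    simp only [g, h, dif_pos]
    rw [M.injective h.choose_spec]
  rw [M.lin_eq_integral c g hg, M.lin_eq_integral c g hg, h]

/-- The positive values of `w`, together with `1`, are listed in increasing order. Their superlevel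
sets form the chain, and the gaps between consecutive values are the barycentric coordinates. -/
lemma exists_weight_eq [Finite E] {w : E → ℝ} (hw : w ∈ cubeWeights R) :
    ∃ x, M.weight x = w := by
  classical
  have := Fintype.ofFinite E
  have := M.thin
  obtain ⟨h0, h1, hR⟩ := hw
  -- The value `1` makes the gaps add up to one; if no weight equals `1`, its superlevel set is
  -- empty, which is also an admissible set.
  let S : Finset ℝ := insert 1 ((Finset.univ.image w).filter (0 < ·))
  have hSpos : ∀ v ∈ S, 0 < v := by
    intro v hv
    simp only [S, Finset.mem_insert, Finset.mem_filter] at hv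
    rcases hv with rfl | hv
    · exact one_pos
    · exact hv.2
  have hSle : ∀ v ∈ S, v ≤ 1 := by
    intro v hv
    simp only [S, Finset.mem_insert, Finset.mem_filter, Finset.mem_image, Finset.mem_univ,
      true_and] at hv
    rcases hv with rfl | ⟨⟨e, rfl⟩, -⟩
    · exact le_rfl
    · exact h1 e
  have hcard : S.card ≠ 0 := Finset.card_ne_zero.2 ⟨1, Finset.mem_insert_self _ _⟩
  obtain ⟨n, hn⟩ := Nat.exists_eq_succ_of_ne_zero hcard
  let v : Fin (n + 1) ↪o ℝ := S.orderEmbOfFin hn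
  have hvS : ∀ i, v i ∈ S := Finset.orderEmbOfFin_mem S hn
  have hSv : ∀ a ∈ S, ∃ i, v i = a := by
    intro a ha
    have : a ∈ Set.range v := by rw [Finset.range_orderEmbOfFin]; exact ha
    exact this
  -- The list `v` shifted by one, with `V 0 = 0`, so that the first gap starts at level zero.
  let V : ℕ → ℝ := fun k => if h : 0 < k ∧ k - 1 < n + 1 then v ⟨k - 1, h.2⟩ else 0
  have hV : ∀ i : Fin (n + 1), V (i + 1) = v i := fun i => by
    have : 0 < i.1 + 1 ∧ i.1 + 1 - 1 < n + 1 := ⟨by omega, by omega⟩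
    simp only [V, this, dif_pos, and_self]
    rfl
  have hVpos : ∀ i : Fin (n + 1), 0 < V (i + 1) := fun i => hV i ▸ hSpos _ (hvS i)
  have hlast : V (n + 1) = 1 := by
    obtain ⟨i, hi⟩ := hSv 1 (Finset.mem_insert_self _ _)
    refine le_antisymm ((hV (Fin.last n)).symm ▸ hSle _ (hvS _)) ?_
    rw [← hi]
    exact (v.monotone (Fin.le_last i)).trans (hV (Fin.last n)).ge
  have hVmono : ∀ i : Fin (n + 1), V i ≤ V (i + 1) := by
    intro i
    rcases Nat.eq_zero_or_pos i.1 with hi | hi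
    · rw [hi]
      have : V 0 = 0 := by simp [V]
      rw [this]
      have := hVpos i
      rw [hi] at this
      exact this.le
    · have h := hV ⟨i - 1, by omega⟩
      simp only at h
      rw [Nat.sub_add_cancel hi] at h
      rw [h, hV]
      exact v.monotone (Fin.le_def.2 (Nat.sub_le _ _))
  have hsum : ∀ k, k ≤ n + 1 → ∑ j ∈ Finset.range k, (V (j + 1) - V j) = V k := by
    intro k _
    rw [Finset.sum_range_sub]
    simp [V]
  let t : stdSimplex ℝ (Fin (n + 1)) := ⟨fun i => V (i + 1) - V i,
    fun i => sub_nonneg.2 (hVmono i), by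
      rw [Fin.sum_univ_eq_sum_range (fun k => V (k + 1) - V k), hsum _ le_rfl, hlast]⟩
  have hclique : ∀ i, ∃ X, M.D X = {e | v i ≤ w e} := fun i =>
    M.exists_eq _ fun e he e' he' => hR e e' ((hSpos _ (hvS i)).trans_le he)
      ((hSpos _ (hvS i)).trans_le he')
  choose X hX using hclique
  let σ : ComposableArrows C n :=
    { obj := X
      map := fun {i j} f => ((M.nonempty_hom_iff _ _).2 (by
        rw [hX, hX]
        exact fun e he => (v.monotone (leOfHom f)).trans he)).some
      map_id := fun _ => Subsingleton.elim _ _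
      map_comp := fun _ _ => Subsingleton.elim _ _ }
  refine ⟨simplexMap σ t, ?_⟩
  funext e
  rw [weight_simplexMap]
  have h2 : ∀ i : Fin (n + 1), e ∈ M.D (σ.obj i) ↔ v i ≤ w e := fun i => by
    change e ∈ M.D (X i) ↔ _
    rw [hX]; rfl
  simp only [h2]
  rcases (h0 e).lt_or_eq with he | he
  · obtain ⟨j, hj⟩ := hSv (w e) (by
      simp only [S, Finset.mem_insert, Finset.mem_filter, Finset.mem_image, Finset.mem_univ,
        true_and]
      exact Or.inr ⟨⟨e, rfl⟩, he⟩)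
    rw [← hj]
    simp only [v.le_iff_le]
    have h3 : ∀ i : Fin (n + 1), (if i ≤ j then t i else 0) =
        (fun k => if k < j.1 + 1 then V (k + 1) - V k else 0) i.1 := by
      intro i
      simp only [Fin.le_def, Nat.lt_succ_iff]
      rfl
    rw [Finset.sum_congr rfl fun i _ => h3 i, Fin.sum_univ_eq_sum_range
      (fun k => if k < j.1 + 1 then V (k + 1) - V k else 0), ← hV j,
      ← hsum (j + 1) (by omega), ← Finset.sum_filter]
    refine Finset.sum_congr ?_ fun _ _ => rfl
    ext k
    simp only [Finset.mem_filter, Finset.mem_range]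
    omega
  · rw [← he]
    refine Finset.sum_eq_zero fun i _ => if_neg ?_
    exact not_le.2 (hSpos _ (hvS i))

include M in
lemma t2Space [Finite E] : T2Space (Realization C) := by
  have := M.thin
  exact Realization.t2Space M.grading

include M in
lemma finite [Finite E] : Finite C := Finite.of_injective M.D M.injective

-- There are finitely many objects and, by thinness, finitely many chains of each length. The
-- vertices of a strict simplex are distinct, so finitely many compact simplices cover the
-- realization.
include M in
lemma compactSpace [Finite E] : CompactSpace (Realization C) := by
  have := M.finite
  have := M.thin
  have := Fintype.ofFinite C
  have hfin : ∀ n, Finite (ComposableArrows C n) := by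
    intro n
    refine Finite.of_injective (fun (σ : ComposableArrows C n) => σ.obj) fun σ τ h => ?_
    refine Functor.hext (fun i => congrFun h i) fun i j f => ?_
    have key : ∀ (X X' Y Y' : C) (f : X ⟶ Y) (g : X' ⟶ Y'), X = X' → Y = Y' → HEq f g := by
      rintro X _ Y _ f g rfl rfl
      exact heq_of_eq (Subsingleton.elim _ _)
    exact key _ _ _ _ _ _ (congrFun h i) (congrFun h j)
  refine ⟨?_⟩
  have : (Set.univ : Set (Realization C)) = ⋃ (n : Fin (Fintype.card C + 1)),
      ⋃ σ : ComposableArrows C n, Set.range (simplexMap σ) := by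
    symm
    refine Set.eq_univ_of_forall fun x => ?_
    obtain ⟨n, σ, t, hσ, -, rfl⟩ := exists_strict M.grading x
    have hinj : Function.Injective σ.obj := fun i j h =>
      hσ.injective (congrArg M.grading.d h)
    have := Fintype.card_le_of_injective _ hinj
    simp only [Fintype.card_fin] at this
    simp only [Set.mem_iUnion]
    exact ⟨⟨n, by omega⟩, σ, t, rfl⟩
  rw [this]
  refine isCompact_iUnion fun n => ?_
  have := hfin n
  exact isCompact_iUnion fun σ => isCompact_range (simplexMap σ).continuous

/-- The last set of a chain is the smallest one: if it is not empty, any of its elements belongs to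
all sets of the chain and has weight one. -/
lemma mem_range_realizationMap_ι_iff [Finite E] {P : ObjectProperty C}
    (hP : ∀ X, P X ↔ (M.D X).Nonempty) (x : Realization C) :
    x ∈ Set.range (realizationMap P.ι) ↔ ∃ e, M.weight x e = 1 := by
  classical
  have := M.thin
  obtain ⟨n, σ, t, -, ht, rfl⟩ := exists_strict M.grading x
  rw [Realization.mem_range_realizationMap_ι]
  have hsum := stdSimplex.sum_eq_one t
  rw [lin_simplexMap]
  constructor
  · intro h
    rw [Finset.sum_eq_zero_iff_of_nonneg] at h
    · have h1 := h (Fin.last n) (Finset.mem_univ _)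
      have hPl : P (σ.obj (Fin.last n)) := by
        by_contra hPl
        simp [hPl, (ht (Fin.last n)).ne'] at h1
      obtain ⟨e, he⟩ := (hP _).1 hPl
      refine ⟨e, ?_⟩
      rw [weight_simplexMap, ← hsum]
      exact Finset.sum_congr rfl fun i _ => if_pos (M.D_anti σ (Fin.le_last i) he)
    · intro i _
      split_ifs <;> simp
  · rintro ⟨e, he⟩
    rw [weight_simplexMap, ← hsum] at he
    have h2 := (Finset.sum_eq_sum_iff_of_le (fun i _ => by
      split_ifs
      · exact le_rfl
      · exact stdSimplex.zero_le t i)).1 he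
    refine Finset.sum_eq_zero fun i hi => ?_
    have h3 := h2 i hi
    have h4 : e ∈ M.D (σ.obj i) := by
      by_contra h
      rw [if_neg h] at h3
      exact (ht i).ne h3
    rw [if_pos ((hP _).2 ⟨e, h4⟩), zero_mul]

end CubeModel

lemma cubeWeights_norm_eq_one {E : Type} [Fintype E] {R : E → E → Prop} {w : E → ℝ}
    (hw : w ∈ cubeWeights R) : ‖w‖ = 1 ↔ ∃ e, w e = 1 := by
  constructor
  · intro h
    by_contra! hne
    have : ‖w‖ < 1 := (pi_norm_lt_iff one_pos).2 fun e => by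
      rw [Real.norm_of_nonneg (hw.1 e)]
      exact lt_of_le_of_ne (hw.2.1 e) (hne e)
    exact this.ne h
  · rintro ⟨e, he⟩
    refine le_antisymm ((pi_norm_le_iff_of_nonneg zero_le_one).2 fun e => ?_) ?_
    · rw [Real.norm_of_nonneg (hw.1 e)]
      exact hw.2.1 e
    · have := norm_le_pi_norm w e
      rwa [he, norm_one] at this

namespace CubeModel

open Realization

/-- The empty set belongs to the terminal object, and an object over `X` with invertible structure
map is mutually connected with the terminal one. -/
lemma overBoundary_iff {C : Type u} [Category.{v} C] {X : C} {E : Type} {R : E → E → Prop}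
    (M : CubeModel (Over X) E R) (Y : Over X) : overBoundary X Y ↔ (M.D Y).Nonempty := by
  have htop : M.D (Over.mk (𝟙 X)) = ∅ := by
    obtain ⟨Y, hY⟩ := M.exists_eq ∅ (by simp)
    have := (M.nonempty_hom_iff Y (Over.mk (𝟙 X))).1 ⟨Over.mkIdTerminal.from Y⟩
    rw [hY] at this
    exact Set.subset_empty_iff.1 this
  rw [overBoundary, Set.nonempty_iff_ne_empty, not_iff_not]
  constructor
  · intro h
    have h1 := (M.nonempty_hom_iff (Over.mk (𝟙 X)) Y).1 ⟨Over.homMk (inv Y.hom) (by simp)⟩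
    rw [htop] at h1
    exact Set.subset_empty_iff.1 h1
  · intro h
    obtain rfl := M.injective (h.trans htop.symm)
    change IsIso (𝟙 X)
    infer_instance

/-! ### Products of cube models -/

section Product

variable {ι : Type} {E : ι → Type} {R : ∀ v, E v → E v → Prop}

/-- Compatibility in a disjoint union: elements of different summands are compatible. -/
def SigmaRel (R : ∀ v, E v → E v → Prop) (x y : Σ v, E v) : Prop :=
  ∀ v a b, x = ⟨v, a⟩ → y = ⟨v, b⟩ → R v a b

variable {C : Type u} [Category.{v} C] (M : CubeModel C (Σ v, E v) (SigmaRel R))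
  {D : ι → Type u} [∀ v, Category.{v} (D v)] (N : ∀ v, CubeModel (D v) (E v) (R v))

lemma exists_slice (X : C) (v : ι) : ∃ Y, (N v).D Y = {a | ⟨v, a⟩ ∈ M.D X} :=
  (N v).exists_eq _ fun _ ha _ hb => M.compat X _ ha _ hb v _ _ rfl rfl

/-- The object of a factor given by the elements in one summand. -/
noncomputable def slice (X : C) (v : ι) : D v := (exists_slice M N X v).choose

lemma mem_slice {X : C} {v : ι} {a : E v} : a ∈ (N v).D (slice M N X v) ↔ ⟨v, a⟩ ∈ M.D X := by
  rw [slice, (exists_slice M N X v).choose_spec]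
  rfl

/-- A cube model over a disjoint union maps to the product of the cube models of the summands. -/
noncomputable def toProduct : C ⥤ ∀ v, D v where
  obj X v := slice M N X v
  map {X Y} f v := (((N v).nonempty_hom_iff _ _).2 fun a ha => by
    rw [mem_slice] at ha ⊢
    exact (M.nonempty_hom_iff X Y).1 ⟨f⟩ ha).some
  map_id X := by
    have := fun v => (N v).thin
    funext v
    exact Subsingleton.elim _ _
  map_comp f g := by
    have := fun v => (N v).thin
    funext v
    exact Subsingleton.elim _ _

/-- A compatible subset of a disjoint union is an arbitrary family of compatible subsets of the
summands. -/
lemma toProduct_bijective : Function.Bijective (toProduct M N).obj := by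
  constructor
  · intro X Y h
    refine M.injective ?_
    ext ⟨v, a⟩
    rw [← mem_slice M N, ← mem_slice M N]
    exact iff_of_eq (congrArg (fun Z : ∀ v, D v => a ∈ (N v).D (Z v)) h)
  · intro Z
    obtain ⟨X, hX⟩ := M.exists_eq {x | x.2 ∈ (N x.1).D (Z x.1)} (by
      rintro _ ha _ hb v a b rfl rfl
      exact (N v).compat _ _ ha _ hb)
    refine ⟨X, funext fun v => (N v).injective ?_⟩
    ext a
    refine (mem_slice M N).trans ?_
    rw [hX]
    rfl

lemma toProduct_isEquivalence : (toProduct M N).IsEquivalence where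
  faithful := ⟨fun _ => M.thin _ _ |>.elim _ _⟩
  full := ⟨fun {X Y} f => by
    have := fun v => (N v).thin
    have hXY : M.D Y ⊆ M.D X := by
      rintro ⟨v, a⟩ ha
      rw [← mem_slice M N] at ha ⊢
      exact ((N v).nonempty_hom_iff _ _).1 ⟨f v⟩ ha
    exact ⟨((M.nonempty_hom_iff _ _).2 hXY).some, funext fun v => Subsingleton.elim _ _⟩⟩
  essSurj := ⟨fun Z => by
    obtain ⟨X, rfl⟩ := (toProduct_bijective M N).2 Z
    exact ⟨X, ⟨Iso.refl _⟩⟩⟩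

lemma weight_realizationMap_toProduct (x : Realization C) (v : ι) (a : E v) :
    (N v).weight (realizationMap (toProduct M N ⋙ Pi.eval _ v) x) a = M.weight x ⟨v, a⟩ := by
  classical
  rw [weight, lin_realizationMap, weight]
  congr 2
  funext X
  exact if_congr (mem_slice M N) rfl rfl

/-- The map is continuous from a compact to a Hausdorff space. It is bijective because, in terms of
weights, it restricts a function on the disjoint union to the summands. -/
lemma isHomeomorph_toProduct [Finite ι] [∀ v, Finite (E v)] :
    IsHomeomorph (fun (x : Realization C) (v : ι) =>
      realizationMap (toProduct M N ⋙ Pi.eval _ v) x) := by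
  have := M.compactSpace
  have := fun v => (N v).t2Space
  rw [isHomeomorph_iff_continuous_bijective]
  refine ⟨continuous_pi fun v => (realizationMap _).continuous, ?_, ?_⟩
  · intro x y h
    refine M.weight_injective (funext fun ⟨v, a⟩ => ?_)
    rw [← weight_realizationMap_toProduct M N, ← weight_realizationMap_toProduct M N]
    exact congrArg (fun z : ∀ v, Realization (D v) => (N v).weight (z v) a) h
  · intro y
    obtain ⟨x, hx⟩ := M.exists_weight_eq (w := fun e => (N e.1).weight (y e.1) e.2) (by
      refine ⟨fun e => ((N e.1).weight_mem _).1 _, fun e => ((N e.1).weight_mem _).2.1 _, ?_⟩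
      rintro _ _ ha hb v a b rfl rfl
      exact ((N v).weight_mem _).2.2 _ _ ha hb)
    refine ⟨x, funext fun v => (N v).weight_injective (funext fun a => ?_)⟩
    rw [weight_realizationMap_toProduct M N, hx]

end Product

end CubeModel

end

section

open Simplicial Opposite

/-! ### Radial rescaling -/

/-- Non-negative functions with pairwise compatible support. -/
def weightCone {E : Type} (R : E → E → Prop) : Set (E → ℝ) :=
  {w | (∀ e, 0 ≤ w e) ∧ ∀ e e', 0 < w e → 0 < w e' → R e e'}

lemma smul_mem_weightCone {E : Type} {R : E → E → Prop} {w : E → ℝ} (hw : w ∈ weightCone R)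
    {c : ℝ} (hc : 0 ≤ c) : c • w ∈ weightCone R :=
  ⟨fun e => mul_nonneg hc (hw.1 e), fun e e' he he' =>
    hw.2 e e' (pos_of_mul_pos_right he hc) (pos_of_mul_pos_right he' hc)⟩

lemma mem_cubeWeights_iff {E : Type} [Fintype E] {R : E → E → Prop} {w : E → ℝ} :
    w ∈ cubeWeights R ↔ w ∈ weightCone R ∧ ‖w‖ ≤ 1 := by
  constructor
  · rintro ⟨h0, h1, h2⟩
    refine ⟨⟨h0, h2⟩, (pi_norm_le_iff_of_nonneg zero_le_one).2 fun e => ?_⟩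
    rw [Real.norm_of_nonneg (h0 e)]
    exact h1 e
  · rintro ⟨⟨h0, h2⟩, h1⟩
    refine ⟨h0, fun e => ?_, h2⟩
    have := (pi_norm_le_iff_of_nonneg zero_le_one).1 h1 e
    rwa [Real.norm_of_nonneg (h0 e)] at this

/-- A continuous parametrization of the cone of weights by a vector space, inverse to a linear
map. -/
structure ConeChart (E F : Type) (R : E → E → Prop) where
  ψ : (F → ℝ) → E → ℝ
  L : (E → ℝ) →ₗ[ℝ] (F → ℝ)
  continuous_ψ : Continuous ψ
  mem : ∀ y, ψ y ∈ weightCone R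
  L_ψ : ∀ y, L (ψ y) = y
  ψ_L : ∀ w ∈ weightCone R, ψ (L w) = w

namespace ConeChart

variable {E F : Type} {R : E → E → Prop} (P : ConeChart E F R)

/-- On the cone, which is stable under scaling, `ψ` inverts a linear map; this makes it positively
homogeneous without being linear. -/
lemma ψ_smul {c : ℝ} (hc : 0 ≤ c) (y : F → ℝ) : P.ψ (c • y) = c • P.ψ y := by
  rw [← P.ψ_L _ (smul_mem_weightCone (P.mem y) hc), map_smul, P.L_ψ]

lemma ψ_zero : P.ψ 0 = 0 := by
  have := P.ψ_smul le_rfl 0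
  simpa using this

lemma ψ_ne_zero {y : F → ℝ} (hy : y ≠ 0) : P.ψ y ≠ 0 := fun h => hy (by
  rw [← P.L_ψ y, h, map_zero])

lemma L_ne_zero {w : E → ℝ} (hw : w ∈ weightCone R) (h : w ≠ 0) : P.L w ≠ 0 := fun h' => h (by
  rw [← P.ψ_L w hw, h', ψ_zero])

variable [Fintype E] [Fintype F]

/-- The norm preserving rescaling of the parametrization. -/
noncomputable def radial (y : F → ℝ) : E → ℝ := (‖y‖ / ‖P.ψ y‖) • P.ψ y

lemma norm_radial (y : F → ℝ) : ‖P.radial y‖ = ‖y‖ := by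
  by_cases hy : y = 0
  · simp [radial, hy]
  · have := norm_ne_zero_iff.2 (P.ψ_ne_zero hy)
    rw [radial, norm_smul, Real.norm_of_nonneg (by positivity)]
    field_simp

/-- Away from the origin the norms in the quotient do not vanish; at the origin preservation of the
norm suffices. -/
lemma continuous_radial : Continuous P.radial := by
  rw [continuous_iff_continuousAt]
  intro y
  by_cases hy : y = 0
  · subst hy
    have h0 : P.radial 0 = 0 := by simp [radial]
    rw [ContinuousAt, h0, tendsto_zero_iff_norm_tendsto_zero]
    simp only [norm_radial]
    have := (continuous_norm (E := F → ℝ)).tendsto 0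
    rwa [norm_zero] at this
  · exact (continuousAt_id.norm.div P.continuous_ψ.continuousAt.norm
      (norm_ne_zero_iff.2 (P.ψ_ne_zero hy))).smul P.continuous_ψ.continuousAt

/-- The inverse of the rescaled parametrization. -/
noncomputable def radialInv (w : E → ℝ) : F → ℝ := (‖w‖ / ‖P.L w‖) • P.L w

lemma norm_radialInv {w : E → ℝ} (hw : w ∈ weightCone R) : ‖P.radialInv w‖ = ‖w‖ := by
  by_cases h : w = 0
  · simp [radialInv, h]
  · have := norm_ne_zero_iff.2 (P.L_ne_zero hw h)
    rw [radialInv, norm_smul, Real.norm_of_nonneg (by positivity)]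
    field_simp

lemma radialInv_radial (y : F → ℝ) : P.radialInv (P.radial y) = y := by
  by_cases hy : y = 0
  · simp [radialInv, radial, hy, ψ_zero]
  · have h1 := norm_ne_zero_iff.2 (P.ψ_ne_zero hy)
    have h2 := norm_ne_zero_iff.2 hy
    rw [radialInv, norm_radial, radial, map_smul, P.L_ψ, norm_smul,
      Real.norm_of_nonneg (by positivity), smul_smul]
    convert one_smul ℝ y
    field_simp

lemma radial_radialInv {w : E → ℝ} (hw : w ∈ weightCone R) : P.radial (P.radialInv w) = w := by
  by_cases h : w = 0
  · simp [radialInv, radial, h]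
  · have h1 := norm_ne_zero_iff.2 (P.L_ne_zero hw h)
    have h2 := norm_ne_zero_iff.2 h
    rw [radial, P.norm_radialInv hw, radialInv, P.ψ_smul (by positivity), P.ψ_L w hw, norm_smul,
      Real.norm_of_nonneg (by positivity), smul_smul]
    convert one_smul ℝ w
    field_simp

/-- The closed unit ball is homeomorphic to the space of weights bounded by one. -/
noncomputable def ballHomeo : Metric.closedBall (0 : F → ℝ) 1 ≃ₜ cubeWeights R :=
  Continuous.homeoOfEquivCompactToT2 (f :=
    { toFun := fun y => ⟨P.radial y.1, mem_cubeWeights_iff.2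
        ⟨smul_mem_weightCone (P.mem _) (by positivity), by
          rw [norm_radial]; exact mem_closedBall_zero_iff.1 y.2⟩⟩
      invFun := fun w => ⟨P.radialInv w.1, by
        have := mem_cubeWeights_iff.1 w.2
        rw [mem_closedBall_zero_iff, P.norm_radialInv this.1]
        exact this.2⟩
      left_inv := fun y => Subtype.ext (P.radialInv_radial y.1)
      right_inv := fun w => Subtype.ext (P.radial_radialInv (mem_cubeWeights_iff.1 w.2).1) })
    ((P.continuous_radial.comp continuous_subtype_val).subtype_mk _)

lemma norm_ballHomeo (y : Metric.closedBall (0 : F → ℝ) 1) :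
    ‖(P.ballHomeo y).1‖ = ‖y.1‖ := P.norm_radial y.1

omit [Fintype E] [Fintype F] in
lemma _root_.continuous_sigma_family {ι : Type} {E F : ι → Type} {f : ∀ v, (F v → ℝ) → E v → ℝ}
    (hf : ∀ v, Continuous (f v)) :
    Continuous fun (y : (Σ v, F v) → ℝ) (e : Σ v, E v) => f e.1 (fun i => y ⟨e.1, i⟩) e.2 :=
  continuous_pi fun e => (continuous_apply e.2).comp
    ((hf e.1).comp (continuous_pi fun _ => continuous_apply _))

/-- The product of a family of charts. -/
def sigma {ι : Type} {E F : ι → Type} {R : ∀ v, E v → E v → Prop}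
    (P : ∀ v, ConeChart (E v) (F v) (R v)) :
    ConeChart (Σ v, E v) (Σ v, F v) (CubeModel.SigmaRel R) where
  ψ y e := (P e.1).ψ (fun i => y ⟨e.1, i⟩) e.2
  L :=
    { toFun := fun w i => (P i.1).L (fun e => w ⟨i.1, e⟩) i.2
      map_add' := fun w w' => funext fun i =>
        congrFun ((P i.1).L.map_add (fun e => w ⟨i.1, e⟩) (fun e => w' ⟨i.1, e⟩)) i.2
      map_smul' := fun c w => funext fun i =>
        congrFun ((P i.1).L.map_smul c (fun e => w ⟨i.1, e⟩)) i.2 }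
  continuous_ψ := continuous_sigma_family fun v => (P v).continuous_ψ
  mem y := by
    refine ⟨fun e => ((P e.1).mem _).1 _, ?_⟩
    rintro _ _ h h' v a b rfl rfl
    exact ((P v).mem _).2 _ _ h h'
  L_ψ y := funext fun i => congrFun ((P i.1).L_ψ fun j => y ⟨i.1, j⟩) i.2
  ψ_L w hw := funext fun e => congrFun ((P e.1).ψ_L (fun a => w ⟨e.1, a⟩)
    ⟨fun a => hw.1 _, fun a b ha hb => hw.2 _ _ ha hb e.1 a b rfl rfl⟩) e.2

/-- Reindexing the coordinates of a chart. -/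
def reindex {E F F' : Type} {R : E → E → Prop} (P : ConeChart E F R) (e : F ≃ F') :
    ConeChart E F' R where
  ψ y := P.ψ (fun i => y (e i))
  L := (LinearMap.funLeft ℝ ℝ e.symm).comp P.L
  continuous_ψ := P.continuous_ψ.comp (continuous_pi fun i => continuous_apply _)
  mem y := P.mem _
  L_ψ y := by
    funext i
    simp [LinearMap.funLeft, P.L_ψ]
  ψ_L w hw := by
    have : (fun i => ((LinearMap.funLeft ℝ ℝ e.symm).comp P.L) w (e i)) = P.L w := by
      funext i
      simp [LinearMap.funLeft]
    rw [this, P.ψ_L w hw]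

end ConeChart

/-! ### The realization of a cube model as a ball -/

namespace CubeModel

open Realization

variable {C : Type u} [Category.{v} C] {E : Type} [Fintype E] {R : E → E → Prop}
  (M : CubeModel C E R)

/-- The realization of a cube model is the space of weights. -/
noncomputable def weightHomeo : Realization C ≃ₜ cubeWeights R :=
  have := M.compactSpace
  Continuous.homeoOfEquivCompactToT2 (f := Equiv.ofBijective
    (fun x => (⟨M.weight x, M.weight_mem x⟩ : cubeWeights R))
    ⟨fun _ _ h => M.weight_injective (congrArg Subtype.val h),
      fun w => (M.exists_weight_eq w.2).imp fun _ h => Subtype.ext h⟩)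
    (M.continuous_weight.subtype_mk _)

/-- A chart of the cone of weights identifies the realization with a ball. -/
noncomputable def ballHomeo {F : Type} [Fintype F] (P : ConeChart E F R) :
    Metric.closedBall (0 : F → ℝ) 1 ≃ₜ Realization C :=
  P.ballHomeo.trans M.weightHomeo.symm

/-- The identification with weights preserves the supremum norm, and norm one means that some weight
is one. -/
lemma mem_sphere_iff {F : Type} [Fintype F] (P : ConeChart E F R) {B : ObjectProperty C}
    (hB : ∀ X, B X ↔ (M.D X).Nonempty) (y : Metric.closedBall (0 : F → ℝ) 1) :
    y.1 ∈ Metric.sphere (0 : F → ℝ) 1 ↔ M.ballHomeo P y ∈ Set.range (realizationMap B.ι) := by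
  have h : M.weight (M.ballHomeo P y) = (P.ballHomeo y).1 :=
    congrArg Subtype.val (M.weightHomeo.apply_symm_apply (P.ballHomeo y))
  rw [M.mem_range_realizationMap_ι_iff hB, ← cubeWeights_norm_eq_one (M.weight_mem _), h,
    P.norm_ballHomeo, mem_sphere_zero_iff_norm]

end CubeModel

/-! ### Diagonals of polygons -/

/-- The diagonals of a polygon with corners `0, …, k - 1`. -/
abbrev Diagonal (k : ℕ) :=
  {x : ℕ × ℕ // x.1 + 2 ≤ x.2 ∧ x.2 < k ∧ ¬ (x.1 = 0 ∧ x.2 + 1 = k)}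

instance (k : ℕ) : Finite (Diagonal k) :=
  Set.Finite.to_subtype (Set.Finite.subset ((Finset.range k ×ˢ Finset.range k).finite_toSet)
    fun x hx => by
      have h1 := hx.1
      have h2 := hx.2.1
      simp only [Finset.coe_product, Finset.coe_range, Set.mem_prod, Set.mem_Iio]
      omega)

noncomputable instance (k : ℕ) : Fintype (Diagonal k) := Fintype.ofFinite _

/-- Two diagonals do not cross. -/
def Diagonal.Noncrossing {k : ℕ} (x y : Diagonal k) : Prop :=
  ¬ (x.1.1 < y.1.1 ∧ y.1.1 < x.1.2 ∧ x.1.2 < y.1.2) ∧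
    ¬ (y.1.1 < x.1.1 ∧ x.1.1 < y.1.2 ∧ y.1.2 < x.1.2)

namespace Diagonal

variable {k : ℕ}

/-- The diagonal separates the corner `j` from the base edge. -/
def Covers (e : Diagonal k) (j : ℕ) : Prop := e.1.1 < j ∧ j < e.1.2

instance (e : Diagonal k) (j : ℕ) : Decidable (e.Covers j) := inferInstanceAs (Decidable (_ ∧ _))

/-- The sum of the weights of the diagonals separating `j` from the base edge. -/
noncomputable def height (w : Diagonal k → ℝ) (j : ℕ) : ℝ := ∑ e, if e.Covers j then w e else 0

/-- Termwise comparison: `d` contributes at `j` and not at `i`, and no other diagonal contributes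
more at `i` than at `j`. -/
lemma height_add_le {w : Diagonal k → ℝ} (hw : ∀ e, 0 ≤ w e) {i j : ℕ} (d : Diagonal k)
    (hdi : ¬ d.Covers i) (hdj : d.Covers j)
    (h : ∀ e, 0 < w e → e.Covers i → e.Covers j) : w d + height w i ≤ height w j := by
  classical
  have hd : w d = ∑ e, if e = d then w d else 0 := by simp
  rw [hd, height, ← Finset.sum_add_distrib]
  refine Finset.sum_le_sum fun e _ => ?_
  by_cases hed : e = d
  · subst hed
    simp [hdi, hdj]
  · rw [if_neg hed, zero_add]
    by_cases hi : e.Covers i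
    · rcases (hw e).lt_or_eq with he | he
      · rw [if_pos hi, if_pos (h e he hi)]
      · rw [← he]; simp
    · rw [if_neg hi]
      split_ifs
      · exact hw e
      · rfl

lemma height_le_add {w : Diagonal k → ℝ} (hw : ∀ e, 0 ≤ w e) {i j : ℕ} (d : Diagonal k)
    (h : ∀ e, 0 < w e → e ≠ d → e.Covers j → e.Covers i) : height w j ≤ w d + height w i := by
  classical
  have hd : w d = ∑ e, if e = d then w d else 0 := by simp
  rw [hd, height, height, ← Finset.sum_add_distrib]
  refine Finset.sum_le_sum fun e _ => ?_
  have h0 : 0 ≤ if e.Covers i then w e else 0 := by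
    split_ifs
    · exact hw e
    · rfl
  by_cases hed : e = d
  · subst hed
    rw [if_pos rfl]
    split_ifs <;> simp [hw e]
  · rw [if_neg hed, zero_add]
    by_cases hj : e.Covers j
    · rcases (hw e).lt_or_eq with he | he
      · rw [if_pos hj, if_pos (h e he hed hj)]
      · rw [← he]; simp
    · rwa [if_neg hj]

/-- Between `p` and `q` there is a corner that is separated from the base edge only by diagonals
reaching over `(p, q)`. -/
lemma exists_gap {w : Diagonal k → ℝ} (hw : w ∈ weightCone Noncrossing) {p q : ℕ}
    (hpq : p + 2 ≤ q) : ∃ j, p < j ∧ j < q ∧ ∀ e, 0 < w e → e.Covers j →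
      e.1.1 < p ∨ (e.1.1 = p ∧ q ≤ e.1.2) := by
  classical
  -- The corner is the far end of the longest diagonal of positive weight that starts at `p` and
  -- ends before `q`, or `p + 1` if there is none.
  by_cases hS : ∃ r, r < q ∧ ∃ h, 0 < w ⟨(p, r), h⟩
  · let T := (Finset.range q).filter fun r => ∃ h, 0 < w ⟨(p, r), h⟩
    have hT : T.Nonempty := by
      obtain ⟨r, h1, h2⟩ := hS
      exact ⟨r, by simp only [T, Finset.mem_filter, Finset.mem_range]; exact ⟨h1, h2⟩⟩
    obtain ⟨j, ⟨hjq, hj, hwj⟩, hmax⟩ : ∃ j, (j < q ∧ ∃ h, 0 < w ⟨(p, j), h⟩) ∧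
        ∀ r, (r < q ∧ ∃ h, 0 < w ⟨(p, r), h⟩) → r ≤ j := by
      refine ⟨T.max' hT, ?_, fun r hr => T.le_max' r ?_⟩
      · have := T.max'_mem hT
        simp only [T, Finset.mem_filter, Finset.mem_range] at this
        exact this
      · simp only [T, Finset.mem_filter, Finset.mem_range]
        exact hr
    refine ⟨j, by omega, hjq, ?_⟩
    rintro ⟨⟨a, b⟩, hab⟩ he ⟨h1, h2⟩
    simp only at h1 h2 hab ⊢
    have h3 := hw.2 _ _ he hwj
    simp only [Noncrossing] at h3
    by_contra! hcon
    rcases lt_trichotomy a p with h4 | h4 | h4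
    · omega
    · subst h4
      have := hmax b ⟨by omega, hab, he⟩
      omega
    · omega
  · refine ⟨p + 1, by omega, by omega, ?_⟩
    rintro ⟨⟨a, b⟩, hab⟩ he ⟨h1, h2⟩
    simp only at h1 h2 hab ⊢
    by_contra! hcon
    have : a = p := by omega
    subst this
    exact hS ⟨b, by omega, hab, he⟩

lemma nonempty_Ioo (e : Diagonal k) : (Finset.Ioo e.1.1 e.1.2).Nonempty := ⟨e.1.1 + 1, by
  have := e.2.1
  simp only [Finset.mem_Ioo]
  omega⟩

/-- The weight of a diagonal in terms of a height function. -/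
noncomputable def weightOf (x : ℕ → ℝ) (e : Diagonal k) : ℝ :=
  max 0 ((Finset.Ioo e.1.1 e.1.2).inf' e.nonempty_Ioo x - max (x e.1.1) (x e.1.2))

/-- By noncrossing, every corner strictly between `p` and `q` is higher by at least `w d` than both
ends when `w d` is positive. The corner supplied by `exists_gap` exceeds the higher end by at most
`w d`. -/
lemma weightOf_height {w : Diagonal k → ℝ} (hw : w ∈ weightCone Noncrossing) :
    weightOf (height w) = w := by
  funext e
  obtain ⟨⟨p, q⟩, hpq⟩ := e
  simp only at hpq
  set d : Diagonal k := ⟨(p, q), hpq⟩ with hd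
  obtain ⟨j, hpj, hjq, hj⟩ := exists_gap hw hpq.1
  have hupper : height w j ≤ w d + max (height w p) (height w q) := by
    -- If some diagonal of positive weight runs from `p` beyond `q`, noncrossing forces all those
    -- over `j`, except `d`, to cover `q` as well. Otherwise all of them, except `d`, start before
    -- `p` and so cover `p`.
    by_cases hb : ∃ b, q < b ∧ ∃ h, 0 < w ⟨(p, b), h⟩
    · obtain ⟨b, hqb, h, hwb⟩ := hb
      refine (height_le_add hw.1 d ?_).trans (add_le_add_right (le_max_right _ _) _)
      rintro ⟨⟨a, b'⟩, hab⟩ he hne hcov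
      have h1 := hj _ he hcov
      have h2 := hw.2 _ _ he hwb
      have h3 : ¬ (a = p ∧ b' = q) := fun h3 => hne (Subtype.ext (Prod.ext h3.1 h3.2))
      simp only [Covers, Noncrossing] at *
      omega
    · refine (height_le_add hw.1 d ?_).trans (add_le_add_right (le_max_left _ _) _)
      rintro ⟨⟨a, b'⟩, hab⟩ he hne hcov
      have h1 := hj _ he hcov
      have h3 : ¬ (a = p ∧ b' = q) := fun h3 => hne (Subtype.ext (Prod.ext h3.1 h3.2))
      simp only [Covers] at *
      rcases h1 with h1 | ⟨rfl, h1⟩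
      · omega
      · exact absurd ⟨b', by omega, hab, he⟩ hb
  have hinf : (Finset.Ioo p q).inf' ⟨j, by simp [hpj, hjq]⟩ (height w) ≤ height w j :=
    Finset.inf'_le _ (by simp [hpj, hjq])
  change max 0 ((Finset.Ioo p q).inf' ⟨j, by simp [hpj, hjq]⟩ (height w) -
    max (height w p) (height w q)) = w d
  refine le_antisymm (max_le (hw.1 d) (by linarith)) ?_
  rcases (hw.1 d).lt_or_eq with hpos | h0
  · refine le_max_of_le_right (le_sub_iff_add_le.2 ?_)
    refine Finset.le_inf' _ _ fun i hi => ?_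
    rw [Finset.mem_Ioo] at hi
    rcases max_cases (height w p) (height w q) with ⟨h, -⟩ | ⟨h, -⟩
    · rw [h]
      refine height_add_le hw.1 d (by simp [Covers, hd]) hi ?_
      rintro e he ⟨h1, h2⟩
      have h3 := hw.2 _ _ he hpos
      simp only [Covers, Noncrossing, hd] at *
      omega
    · rw [h]
      refine height_add_le hw.1 d (by simp [Covers, hd]) hi ?_
      rintro e he ⟨h1, h2⟩
      have h3 := hw.2 _ _ he hpos
      simp only [Covers, Noncrossing, hd] at *
      omega
  · rw [← h0]
    exact le_max_left _ _

lemma weightOf_pos_iff {x : ℕ → ℝ} {e : Diagonal k} :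
    0 < weightOf x e ↔ ∀ j, e.Covers j → x e.1.1 < x j ∧ x e.1.2 < x j := by
  rw [weightOf, lt_max_iff, or_iff_right (lt_irrefl 0), sub_pos, Finset.lt_inf'_iff]
  simp only [max_lt_iff, Finset.mem_Ioo]
  rfl

/-- Each of two crossing diagonals covers an end of the other; positive weights would make each of
these two corners strictly higher than the other. -/
lemma weightOf_mem (x : ℕ → ℝ) : weightOf (k := k) x ∈ weightCone Noncrossing := by
  refine ⟨fun e => le_max_left _ _, fun e e' he he' => ?_⟩
  rw [weightOf_pos_iff] at he he'
  constructor
  · rintro ⟨h1, h2, h3⟩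
    have := he _ ⟨h1, h2⟩
    have := he' _ ⟨h2, h3⟩
    linarith
  · rintro ⟨h1, h2, h3⟩
    have := he' _ ⟨h1, h2⟩
    have := he _ ⟨h2, h3⟩
    linarith

-- For a level `t` in `Ioc 0 (x j)` the maximal run of corners around `j` of height at least `t` is
-- bounded by the ends of a diagonal. So the level intervals `I e` of the diagonals covering `j`
-- partition `Ioc 0 (x j)`, and their lengths are the weights.
open MeasureTheory in
lemma height_weightOf {x : ℕ → ℝ} (h0 : ∀ j, 0 ≤ x j) (hl : x 0 = 0) (hr : x (k - 1) = 0)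
    (hm : ∃ j, 0 < j ∧ j < k - 1 ∧ x j = 0) {j : ℕ} (hj : 0 < j) (hjk : j < k - 1) :
    height (weightOf (k := k) x) j = x j := by
  classical
  let I : Diagonal k → Set ℝ := fun e => Set.Ioc (max (x e.1.1) (x e.1.2))
    ((Finset.Ioo e.1.1 e.1.2).inf' e.nonempty_Ioo x)
  have hI : ∀ e t, t ∈ I e ↔ (x e.1.1 < t ∧ x e.1.2 < t) ∧ ∀ i, e.Covers i → t ≤ x i := by
    intro e t
    simp only [I]
    rw [Set.mem_Ioc, max_lt_iff, Finset.le_inf'_iff]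
    simp only [Finset.mem_Ioo]
    rfl
  let S : Finset (Diagonal k) := Finset.univ.filter fun e => e.Covers j
  have hunion : ⋃ e ∈ S, I e = Set.Ioc 0 (x j) := by
    ext t
    simp only [Set.mem_iUnion, hI, S, Finset.mem_filter, Finset.mem_univ, true_and,
      Set.mem_Ioc]
    constructor
    · rintro ⟨e, he, ⟨h1, h2⟩, h3⟩
      exact ⟨(h0 _).trans_lt h1, h3 j he⟩
    · rintro ⟨ht, htj⟩
      -- The ends `p` and `q` are the nearest corners below level `t` on the two sides of `j`; they
      -- exist because the height is zero at both ends of the base edge.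
      let A := (Finset.range j).filter fun i => x i < t
      have hA : A.Nonempty := ⟨0, by simp [A, hj, hl, ht]⟩
      obtain ⟨p, hAm, hAx⟩ : ∃ p, (p < j ∧ x p < t) ∧ ∀ i, i < j ∧ x i < t → i ≤ p :=
        ⟨A.max' hA, by simpa [A] using A.max'_mem hA, fun i hi => A.le_max' i (by simpa [A])⟩
      let B := (Finset.Ioo j k).filter fun i => x i < t
      have hB : B.Nonempty := ⟨k - 1, by
        simp only [B, Finset.mem_filter, Finset.mem_Ioo, hr, ht, and_true]
        omega⟩
      obtain ⟨q, hBm, hBx⟩ : ∃ q, ((j < q ∧ q < k) ∧ x q < t) ∧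
          ∀ i, (j < i ∧ i < k) ∧ x i < t → q ≤ i :=
        ⟨B.min' hB, by simpa [B] using B.min'_mem hB, fun i hi => B.min'_le i (by simpa [B])⟩
      have hlevel : ∀ i, p < i → i < q → t ≤ x i := by
        intro i hpi hiq
        by_contra! hcon
        rcases lt_trichotomy i j with h | h | h
        · have := hAx i ⟨h, hcon⟩
          omega
        · subst h
          exact hcon.not_ge htj
        · have := hBx i ⟨⟨h, by omega⟩, hcon⟩
          omega
      refine ⟨⟨(p, q), by simp only; omega, hBm.1.2, ?_⟩, ⟨hAm.1, hBm.1.1⟩, ⟨hAm.2, hBm.2⟩,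
        fun i hi => hlevel i hi.1 hi.2⟩
      -- The inner corner of height zero keeps the run from reaching across the whole polygon, where
      -- it would give the base edge.
      rintro ⟨hp0, hqk⟩
      simp only at hp0 hqk
      obtain ⟨m, hm0, hmk, hxm⟩ := hm
      have := hlevel m (by omega) (by omega)
      rw [hxm] at this
      exact ht.not_ge this
  have hdisj : Set.PairwiseDisjoint (↑S : Set (Diagonal k)) I := by
    rintro ⟨⟨p, q⟩, h⟩ he ⟨⟨p', q'⟩, h'⟩ he' hne
    refine Set.disjoint_left.2 fun t ht ht' => hne ?_
    rw [hI] at ht ht'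
    simp only [S, Finset.coe_filter, Finset.mem_univ, true_and] at he he'
    change Covers _ _ at he
    change Covers _ _ at he'
    simp only [Covers] at he he' ht ht'
    refine Subtype.ext (Prod.ext ?_ ?_)
    · by_contra hp
      simp only at hp
      rcases Nat.lt_or_gt_of_ne hp with hp | hp
      · exact (ht.2 p' ⟨hp, by omega⟩).not_gt ht'.1.1
      · exact (ht'.2 p ⟨hp, by omega⟩).not_gt ht.1.1
    · by_contra hp
      simp only at hp
      rcases Nat.lt_or_gt_of_ne hp with hp | hp
      · exact (ht'.2 q ⟨by omega, hp⟩).not_gt ht.1.2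
      · exact (ht.2 q' ⟨by omega, hp⟩).not_gt ht'.1.2
  have hvol := measure_biUnion_finset (μ := volume) hdisj (fun e _ => measurableSet_Ioc)
  rw [hunion, Real.volume_Ioc, sub_zero] at hvol
  have := congrArg ENNReal.toReal hvol
  rw [ENNReal.toReal_ofReal (h0 j), ENNReal.toReal_sum (fun e _ => by
    simp only [I, Real.volume_Ioc]; exact ENNReal.ofReal_ne_top)] at this
  rw [this, height, ← Finset.sum_filter]
  refine Finset.sum_congr rfl fun e _ => ?_
  simp only [I, Real.volume_Ioc, ENNReal.toReal_ofReal', weightOf, max_comm]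

/-- The height function with prescribed differences and minimum zero. -/
noncomputable def heightOf (k : ℕ) (y : Fin (k - 3) → ℝ) (j : ℕ) : ℝ :=
  if 0 < j ∧ j < k - 1 then
    -- Corner `1` has coordinate zero and corner `j ≥ 2` has coordinate `y (j - 2)`, before the
    -- minimum is subtracted. The maximum with `2` keeps the interval non-empty for small `k`; it is
    -- `k - 1` once `k ≥ 3`.
    (if h : 2 ≤ j ∧ j - 2 < k - 3 then y ⟨j - 2, h.2⟩ else 0) -
      (Finset.Ioo 0 (max (k - 1) 2)).inf' ⟨1, by simp⟩
        (fun i => if h : 2 ≤ i ∧ i - 2 < k - 3 then y ⟨i - 2, h.2⟩ else 0)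
  else 0

lemma continuous_heightOf (j : ℕ) : Continuous fun y => heightOf k y j := by
  unfold heightOf
  split_ifs
  all_goals first
    | exact continuous_const
    | refine Continuous.sub (by fun_prop) ?_
      refine Continuous.finset_inf'_apply _ fun i _ => ?_
      split_ifs <;> fun_prop

lemma continuous_weightOf_heightOf :
    Continuous fun y => weightOf (k := k) (heightOf k y) := by
  refine continuous_pi fun e => ?_
  unfold weightOf
  refine continuous_const.max (Continuous.sub ?_
    ((continuous_heightOf _).max (continuous_heightOf _)))
  exact Continuous.finset_inf'_apply _ fun i _ => continuous_heightOf i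

/-- The differences of the heights, as a linear map. -/
noncomputable def heightDiff (k : ℕ) : (Diagonal k → ℝ) →ₗ[ℝ] (Fin (k - 3) → ℝ) where
  toFun w i := height w (i + 2) - height w 1
  map_add' w w' := by
    funext i
    simp only [height, Pi.add_apply]
    rw [← add_sub_add_comm, ← Finset.sum_add_distrib, ← Finset.sum_add_distrib]
    congr 1 <;> exact Finset.sum_congr rfl fun e _ => by split_ifs <;> simp
  map_smul' c w := by
    funext i
    simp only [height, Pi.smul_apply, smul_eq_mul, RingHom.id_apply, mul_sub, Finset.mul_sum]
    congr 1 <;> exact Finset.sum_congr rfl fun e _ => by split_ifs <;> simp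

/-- By `exists_gap` for the base edge some inner corner is covered by no diagonal of positive
weight. The minimum of the heights is therefore zero, and subtracting the minimum undoes the
normalization at corner `1`. -/
lemma heightOf_heightDiff (hk : 3 ≤ k) {w : Diagonal k → ℝ} (hw : w ∈ weightCone Noncrossing) :
    heightOf k (heightDiff k w) = height w := by
  have hv : ∀ i, 0 < i → i < k - 1 → (if h : 2 ≤ i ∧ i - 2 < k - 3 then
      heightDiff k w ⟨i - 2, h.2⟩ else 0) = height w i - height w 1 := by
    intro i h0 hi
    split_ifs with h
    · change height w (i - 2 + 2) - _ = _
      rw [Nat.sub_add_cancel h.1]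
    · have : i = 1 := by omega
      rw [this, sub_self]
  have hnn : ∀ i, 0 ≤ height w i := fun i => Finset.sum_nonneg fun e _ => by
    split_ifs
    · exact hw.1 e
    · rfl
  have hz : ∀ i, (∀ e, 0 < w e → ¬ e.Covers i) → height w i = 0 := by
    intro i hi
    refine Finset.sum_eq_zero fun e _ => ?_
    split_ifs with hc
    · exact ((hw.1 e).lt_or_eq.resolve_left fun h => hi e h hc).symm
    · rfl
  obtain ⟨m, hm0, hmk, hm⟩ := exists_gap hw (p := 0) (q := k - 1) (by omega)
  have hxm : height w m = 0 := hz m fun e he hc => by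
    have h1 := hm e he hc
    have h2 := e.2
    omega
  have hinf : (Finset.Ioo 0 (max (k - 1) 2)).inf' ⟨1, by simp⟩
        (fun i => if h : 2 ≤ i ∧ i - 2 < k - 3 then heightDiff k w ⟨i - 2, h.2⟩ else 0) =
      - height w 1 := by
    have hmax : max (k - 1) 2 = k - 1 := by omega
    refine le_antisymm ?_ ?_
    · refine (Finset.inf'_le _ (b := m) ?_).trans ?_
      · rw [hmax]; simp [hm0, hmk]
      · rw [hv m hm0 hmk, hxm, zero_sub]
    · refine Finset.le_inf' _ _ fun i hi => ?_
      rw [hmax, Finset.mem_Ioo] at hi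
      rw [hv i hi.1 hi.2]
      linarith [hnn i]
  funext j
  unfold heightOf
  rw [hinf]
  split_ifs with h1 h2
  · have := hv j h1.1 h1.2
    rw [dif_pos h2] at this
    rw [this]; ring
  · have := hv j h1.1 h1.2
    rw [dif_neg h2] at this
    linarith
  · refine (hz j fun e _ hc => ?_).symm
    have h2 := e.2
    have h3 := hc.1
    have h4 := hc.2
    omega

/-- The normalized heights satisfy the hypotheses of `height_weightOf`, the minimum being attained
at an inner corner; subtracting it does not affect differences. -/
lemma heightDiff_weightOf (hk : 3 ≤ k) (y : Fin (k - 3) → ℝ) :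
    heightDiff k (weightOf (heightOf k y)) = y := by
  have hmax : max (k - 1) 2 = k - 1 := by omega
  let f : ℕ → ℝ := fun i => if h : 2 ≤ i ∧ i - 2 < k - 3 then y ⟨i - 2, h.2⟩ else 0
  have hne : (Finset.Ioo 0 (max (k - 1) 2)).Nonempty := ⟨1, by simp⟩
  have hval : ∀ j, heightOf k y j =
      if 0 < j ∧ j < k - 1 then f j - (Finset.Ioo 0 (max (k - 1) 2)).inf' hne f else 0 :=
    fun _ => rfl
  have h : ∀ j, 0 < j → j < k - 1 → height (weightOf (k := k) (heightOf k y)) j = heightOf k y j := by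
    intro j hj hjk
    refine height_weightOf ?_ ?_ ?_ ?_ hj hjk
    · intro i
      rw [hval]
      split_ifs with hi
      · exact sub_nonneg.2 (Finset.inf'_le _ (by rw [hmax]; simpa using hi))
      · rfl
    · rw [hval, if_neg (by omega)]
    · rw [hval, if_neg (by omega)]
    · obtain ⟨m, hm, hm'⟩ := Finset.exists_mem_eq_inf' hne f
      rw [hmax, Finset.mem_Ioo] at hm
      exact ⟨m, hm.1, hm.2, by rw [hval, if_pos hm, hm', sub_self]⟩
  funext i
  change height _ (i + 2) - height _ 1 = y i
  have hi := i.2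
  rw [h _ (by omega) (by omega), h _ (by omega) (by omega), hval, hval, if_pos (by omega),
    if_pos (by omega), sub_sub_sub_cancel_right]
  have h1 : f 1 = 0 := by simp [f]
  have h2 : f (i + 2) = y i := by
    have : 2 ≤ i.1 + 2 ∧ i.1 + 2 - 2 < k - 3 := ⟨by omega, by omega⟩
    simp only [f, this, and_self, dif_pos]
    rfl
  rw [h1, h2, sub_zero]

/-- Heights parametrize the weights of the diagonals of a polygon. -/
noncomputable def chart (hk : 3 ≤ k) : ConeChart (Diagonal k) (Fin (k - 3)) Noncrossing where
  ψ y := weightOf (heightOf k y)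
  L := heightDiff k
  continuous_ψ := continuous_weightOf_heightOf
  mem y := weightOf_mem _
  L_ψ y := heightDiff_weightOf hk y
  ψ_L w hw := by rw [heightOf_heightDiff hk hw, weightOf_height hw]

end Diagonal

end

/-! ### Fibres of a morphism of fat graphs -/

namespace CombGraph

variable {G : CombGraph}

lemma walk_symm {S : Set G.Elt} (hS : ∀ x ∈ S, G.iExt x ∈ S) {a b : G.V} (h : G.Walk S a b) :
    G.Walk S b a := by
  induction h with
  | refl => exact .refl
  | tail _ h ih =>
    obtain ⟨A, hA, rfl, rfl⟩ := h
    exact .head ⟨G.i A, hS _ hA, rfl, by rw [G.i_i]⟩ ih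

/-- A connected graph has at most one more vertex than edges. -/
lemma IsConnectedSubgraph.card_le {S : Set G.Elt} (hS : G.IsConnectedSubgraph S) :
    2 * Nat.card {v : G.V // Sum.inl v ∈ S} ≤ Nat.card {A : G.H // Sum.inr A ∈ S} + 2 := by
  classical
  have := Fintype.ofFinite {v : G.V // Sum.inl v ∈ S}
  have := Fintype.ofFinite {A : G.H // Sum.inr A ∈ S}
  -- Loops and parallel edges are dropped. The darts that remain inject into the half-edges of `S`,
  -- and connectedness of the simple graph bounds their number from below.
  let K : SimpleGraph {v : G.V // Sum.inl v ∈ S} :=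
    { Adj := fun u v => u ≠ v ∧ ∃ A, Sum.inr A ∈ S ∧ G.s A = u.1 ∧ G.s (G.i A) = v.1
      symm := ⟨by
        rintro u v ⟨h, A, hA, h1, h2⟩
        exact ⟨h.symm, G.i A, hS.i_mem _ hA, h2, by rw [G.i_i, h1]⟩⟩
      loopless := ⟨fun u h => h.1 rfl⟩ }
  have hK : K.Connected := by
    obtain ⟨v₀, hv₀⟩ := hS.nonempty
    have : Nonempty {v : G.V // Sum.inl v ∈ S} := ⟨⟨v₀, hv₀⟩⟩
    refine ⟨fun u v => ?_⟩
    have key : ∀ b, G.Walk S u.1 b → ∃ hb : Sum.inl b ∈ S, K.Reachable u ⟨b, hb⟩ := by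
      intro b hb
      induction hb with
      | refl => exact ⟨u.2, .refl _⟩
      | tail _ h ih =>
        obtain ⟨A, hA, rfl, rfl⟩ := h
        obtain ⟨h1, h2⟩ := ih
        have h3 : Sum.inl (G.s (G.i A)) ∈ S := hS.s_mem _ (hS.i_mem _ hA)
        refine ⟨h3, ?_⟩
        by_cases heq : G.s A = G.s (G.i A)
        · convert h2 using 2
          exact heq.symm
        · exact h2.trans (SimpleGraph.Adj.reachable ⟨fun h => heq (congrArg Subtype.val h),
            A, hA, rfl, rfl⟩)
    exact (key v.1 (hS.walk _ _ u.2 v.2)).2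
  have h1 := hK.card_vert_le_card_edgeSet_add_one
  have h2 := K.dart_card_eq_twice_card_edges
  choose c hc using fun d : K.Dart => d.adj.2
  have h3 : Fintype.card K.Dart ≤ Fintype.card {A : G.H // Sum.inr A ∈ S} := by
    refine Fintype.card_le_of_injective (fun d => ⟨c d, (hc d).1⟩) fun d d' h => ?_
    have h' : c d = c d' := congrArg Subtype.val h
    refine SimpleGraph.Dart.ext _ _ (Prod.ext (Subtype.ext ?_) (Subtype.ext ?_))
    · rw [← (hc d).2.1, h', (hc d').2.1]
    · rw [← (hc d).2.2, h', (hc d').2.2]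
  have h4 : Nat.card K.edgeSet = K.edgeFinset.card := by
    rw [Nat.card_eq_fintype_card, SimpleGraph.edgeFinset_card]
  rw [Nat.card_eq_fintype_card (α := {A : G.H // Sum.inr A ∈ S})]
  omega

end CombGraph

/-- The permutation has finite order, so `x` is a forward iterate of `π x`. -/
lemma Equiv.Perm.mem_of_map_mem {α : Type*} [Finite α] (π : Equiv.Perm α) {P : α → Prop}
    (h : ∀ x, P x → P (π x)) {x : α} (hx : P (π x)) : P x := by
  have key : ∀ n, P ((π ^ n) (π x)) := by
    intro n
    induction n with
    | zero => simpa
    | succ n ih =>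
      rw [pow_succ', Equiv.Perm.mul_apply]
      exact h _ ih
  have h1 := key (orderOf π - 1)
  rw [← Equiv.Perm.mul_apply, ← pow_succ, Nat.sub_add_cancel (orderOf_pos π), pow_orderOf_eq_one]
    at h1
  exact h1

namespace LeafedFatGraph

/-- A property that is stable under the cyclic permutation holds for all half-edges at a vertex
if it holds for one. -/
lemma forall_of_σ {Γ : LeafedFatGraph} {P : Γ.H → Prop} (h : ∀ A, P A → P (Γ.σ A)) {A B : Γ.H}
    (hAB : Γ.s A = Γ.s B) (hA : P A) : P B := by
  obtain ⟨n, -, rfl⟩ := (Γ.cyclic A B hAB).exists_pow_eq'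
  clear hAB
  induction n with
  | zero => simpa
  | succ n ih =>
    rw [pow_succ', Equiv.Perm.mul_apply]
    exact h _ ih

lemma σ_ne_self (Γ : LeafedFatGraph) {A : Γ.H} (h : 3 ≤ Γ.val (Γ.s A)) : Γ.σ A ≠ A := by
  intro h1
  have hall : ∀ B, Γ.s B = Γ.s A → B = A := fun B hB =>
    forall_of_σ (P := fun B => B = A) (fun C hC => by rw [hC, h1]) hB.symm rfl
  have : Γ.val (Γ.s A) ≤ 1 := by
    have : Subsingleton {B : Γ.H // Γ.s B = Γ.s A} :=
      ⟨fun B C => Subtype.ext ((hall _ B.2).trans (hall _ C.2).symm)⟩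
    exact Finite.card_le_one_iff_subsingleton.2 this
  omega

lemma σ_σ_ne_self (Γ : LeafedFatGraph) {A : Γ.H} (h : 3 ≤ Γ.val (Γ.s A)) :
    Γ.σ (Γ.σ A) ≠ A := by
  intro h1
  have hall : ∀ B, Γ.s B = Γ.s A → B = A ∨ B = Γ.σ A := fun B hB =>
    forall_of_σ (P := fun B => B = A ∨ B = Γ.σ A) (by
      rintro C (rfl | rfl)
      · exact Or.inr rfl
      · exact Or.inl h1) hB.symm (Or.inl rfl)
  have : Γ.val (Γ.s A) ≤ 2 := by
    classical
    refine (Nat.card_le_card_of_injective (fun B : {B : Γ.H // Γ.s B = Γ.s A} =>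
      decide (B.1 = A)) ?_).trans (by simp)
    intro B C hBC
    have h3 : (B.1 = A) ↔ (C.1 = A) := by simpa using hBC
    refine Subtype.ext ?_
    rcases hall _ B.2 with hB | hB
    · rw [hB, h3.1 hB]
    · rcases hall _ C.2 with hC | hC
      · rw [hC, h3.2 hC]
      · rw [hB, hC]
  omega

lemma eq_of_s_leaf (Γ : LeafedFatGraph) {A B : Γ.H} {j : Fin Γ.n} (hA : Γ.s A = Γ.leaf j)
    (hB : Γ.s B = Γ.leaf j) : A = B := by
  have := (Nat.card_eq_one_iff_unique.1 (Γ.val_leaf j)).1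
  exact congrArg Subtype.val
    (Subsingleton.elim (⟨A, hA⟩ : {C : Γ.H // Γ.s C = Γ.leaf j}) ⟨B, hB⟩)

namespace Hom

variable {Γ Δ : LeafedFatGraph} (f : Hom Γ Δ)

/-- A half-edge is collapsed if it is sent to a vertex. -/
def Collapsed (A : Γ.H) : Prop := ∃ w, f.toFun (Sum.inr A) = Sum.inl w

/-- The unique half-edge over a half-edge. -/
noncomputable def lift (B : Δ.H) : Γ.H := (f.single B).choose

lemma map_lift (B : Δ.H) : f.toFun (Sum.inr (f.lift B)) = Sum.inr B :=
  (f.single B).choose_spec.1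

lemma eq_lift {A : Γ.H} {B : Δ.H} (h : f.toFun (Sum.inr A) = Sum.inr B) : A = f.lift B :=
  (f.single B).choose_spec.2 A h

lemma lift_injective : Function.Injective f.lift := fun B C h => by
  have := f.map_lift B
  rw [h, f.map_lift] at this
  exact (Sum.inr_injective this).symm

lemma not_collapsed_lift (B : Δ.H) : ¬ f.Collapsed (f.lift B) := by
  rintro ⟨w, hw⟩
  rw [f.map_lift] at hw
  cases hw

lemma exists_lift_of_not_collapsed {A : Γ.H} (h : ¬ f.Collapsed A) : ∃ B, A = f.lift B := by
  rcases hx : f.toFun (Sum.inr A) with w | B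
  · exact absurd ⟨w, hx⟩ h
  · exact ⟨B, f.eq_lift hx⟩

lemma i_lift (B : Δ.H) : Γ.i (f.lift B) = f.lift (Δ.i B) :=
  f.eq_lift (f.i_of_inr (f.map_lift B))

lemma onV_s_lift (B : Δ.H) : f.onV (Γ.s (f.lift B)) = Δ.s B := f.s_of_inr (f.map_lift B)

variable {f}

lemma Collapsed.i {A : Γ.H} (h : f.Collapsed A) : f.Collapsed (Γ.i A) := by
  obtain ⟨w, hw⟩ := h
  have := f.map_i (Sum.inr A)
  simp only [CombGraph.iExt, Sum.elim_inr, hw, Sum.elim_inl] at this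
  exact ⟨w, this⟩

lemma Collapsed.onV_s_i {A : Γ.H} (h : f.Collapsed A) :
    f.onV (Γ.s (Γ.i A)) = f.onV (Γ.s A) := by
  obtain ⟨w, hw⟩ := h
  have := f.map_i (Sum.inr A)
  simp only [CombGraph.iExt, Sum.elim_inr, hw, Sum.elim_inl] at this
  rw [f.s_of_inl hw, f.s_of_inl this]

lemma Collapsed.map {A : Γ.H} (h : f.Collapsed A) :
    f.toFun (Sum.inr A) = Sum.inl (f.onV (Γ.s A)) := by
  obtain ⟨w, hw⟩ := h
  rw [hw, f.s_of_inl hw]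

variable (f)

/-- The half-edges that can be reached from the far end of `A` inside a fibre without traversing
the edge of `A`. -/
inductive Far (A : Γ.H) : Γ.H → Prop
  | base : Far A (Γ.i A)
  | σ (X : Γ.H) : Far A X → Far A (Γ.σ X)
  | i (X : Γ.H) : f.Collapsed X → X ≠ A → X ≠ Γ.i A → Far A X → Far A (Γ.i X)

variable {f}

lemma Far.of_σ {A X : Γ.H} (h : f.Far A (Γ.σ X)) : f.Far A X :=
  Γ.σ.mem_of_map_mem (fun X hX => Far.σ X hX) h

lemma Far.of_s {A X Y : Γ.H} (h : f.Far A X) (hXY : Γ.s X = Γ.s Y) : f.Far A Y :=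
  forall_of_σ (fun X hX => Far.σ X hX) hXY h

lemma Far.i_iff {A X : Γ.H} (hX : f.Collapsed X) (h1 : X ≠ A) (h2 : X ≠ Γ.i A) :
    f.Far A (Γ.i X) ↔ f.Far A X := by
  refine ⟨fun h => ?_, Far.i X hX h1 h2⟩
  rw [← Γ.i_i X]
  refine Far.i _ hX.i (fun h3 => h2 ?_) (fun h3 => h1 ?_) h
  · rw [← h3, Γ.i_i]
  · rw [← Γ.i_i X, h3, Γ.i_i]

lemma Far.onV_s {A X : Γ.H} (hA : f.Collapsed A) (h : f.Far A X) :
    f.onV (Γ.s X) = f.onV (Γ.s A) := by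
  induction h with
  | base => exact hA.onV_s_i
  | σ X _ ih => rw [Γ.s_σ, ih]
  | i X hX _ _ _ ih => rw [hX.onV_s_i, ih]

/-- Removing an edge disconnects a tree. -/
lemma not_far_self {A : Γ.H} (hA : f.Collapsed A) : ¬ f.Far A A := by
  intro hfar
  set w := f.onV (Γ.s A) with hw
  have hT := f.tree w
  -- The fibre without the edge of `A`. If `A` could be reached around this edge, `S` would be
  -- connected with all vertices of the fibre but two half-edges fewer, against `card_le`.
  let S : Set Γ.Elt := (f.toFun ⁻¹' {Sum.inl w}) \ {Sum.inr A, Sum.inr (Γ.i A)}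
  have hSV : ∀ v : Γ.V, Sum.inl v ∈ S ↔ Sum.inl v ∈ f.toFun ⁻¹' {Sum.inl w} := by
    intro v; simp [S]
  have hSH : ∀ X : Γ.H, Sum.inr X ∈ S ↔
      Sum.inr X ∈ f.toFun ⁻¹' {Sum.inl w} ∧ X ≠ A ∧ X ≠ Γ.i A := by
    intro X; simp [S]
  have hSi : ∀ x ∈ S, Γ.iExt x ∈ S := by
    rintro (v | X) hx
    · exact hx
    · change Sum.inr (Γ.i X) ∈ S
      rw [hSH] at hx ⊢
      refine ⟨hT.i_mem _ hx.1, fun h => hx.2.2 ?_, fun h => hx.2.1 ?_⟩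
      · rw [← h, Γ.i_i]
      · rw [← Γ.i_i X, h, Γ.i_i]
  have hwalk : ∀ X, f.Far A X → Γ.Walk S (Γ.s (Γ.i A)) (Γ.s X) := by
    intro X hX
    induction hX with
    | base => exact .refl
    | σ X _ ih => rwa [Γ.s_σ]
    | i X hX h1 h2 h3 ih =>
      refine ih.tail ⟨X, ?_, rfl, rfl⟩
      rw [hSH]
      refine ⟨?_, h1, h2⟩
      change f.toFun _ = _
      rw [hX.map, h3.onV_s hA]
  have hdet : Γ.Walk S (Γ.s (Γ.i A)) (Γ.s A) := hwalk A hfar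
  have hS : Γ.IsConnectedSubgraph S := by
    refine ⟨?_, hSi, ?_, ?_⟩
    · rintro (v | X) hx
      · exact hx
      · change Sum.inl _ ∈ S
        rw [hSH] at hx
        rw [hSV]
        exact hT.s_mem _ hx.1
    · obtain ⟨v, hv⟩ := hT.nonempty
      exact ⟨v, (hSV v).2 hv⟩
    · intro u v hu hv
      rw [hSV] at hu hv
      have h := hT.walk u v hu hv
      clear hv
      induction h with
      | refl => exact .refl
      | tail _ h ih =>
        obtain ⟨X, hX, rfl, rfl⟩ := h
        refine ih.trans ?_
        by_cases h1 : X = A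
        · rw [h1]
          exact CombGraph.walk_symm hSi hdet
        · by_cases h2 : X = Γ.i A
          · rw [h2, Γ.i_i]
            exact hdet
          · exact .single ⟨X, (hSH X).2 ⟨hX, h1, h2⟩, rfl, rfl⟩
  have h1 := hS.card_le
  have h2 := hT.euler
  have h3 : Nat.card {v : Γ.V // Sum.inl v ∈ S} =
      Nat.card {v : Γ.V // Sum.inl v ∈ f.toFun ⁻¹' {Sum.inl w}} :=
    Nat.card_congr (Equiv.subtypeEquivRight hSV)
  have h4 : Nat.card {X : Γ.H // Sum.inr X ∈ S} + 2 ≤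
      Nat.card {X : Γ.H // Sum.inr X ∈ f.toFun ⁻¹' {Sum.inl w}} := by
    classical
    have hA' : Sum.inr A ∈ f.toFun ⁻¹' {Sum.inl w} := by
      change f.toFun _ = _
      rw [hA.map]
    have hiA' : Sum.inr (Γ.i A) ∈ f.toFun ⁻¹' {Sum.inl w} := hT.i_mem _ hA'
    have : Nat.card {X : Γ.H // Sum.inr X ∈ S} + 2 =
        Nat.card ({X : Γ.H // Sum.inr X ∈ S} ⊕ Bool) := by
      rw [Nat.card_sum]; simp
    rw [this]
    refine Nat.card_le_card_of_injective
      (Sum.elim (fun X => ⟨X.1, ((hSH _).1 X.2).1⟩)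
        (fun b => if b then ⟨A, hA'⟩ else ⟨Γ.i A, hiA'⟩)) ?_
    have hne := Γ.i_ne A
    rintro (⟨X, hX⟩ | _ | _) (⟨Y, hY⟩ | _ | _) h <;> have h := congrArg Subtype.val h
    · obtain rfl : X = Y := h
      rfl
    · exact absurd h ((hSH X).1 hX).2.2
    · exact absurd h ((hSH X).1 hX).2.1
    · exact absurd h.symm ((hSH Y).1 hY).2.2
    · rfl
    · exact absurd h hne
    · exact absurd h.symm ((hSH Y).1 hY).2.1
    · exact absurd h.symm hne
    · rfl
  omega

/-- A set of half-edges that is closed under the cyclic orders and under collapsed edges contains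
every fibre that it meets. -/
lemma forall_of_fibre {P : Γ.H → Prop} (hσ : ∀ X, P X → P (Γ.σ X))
    (hi : ∀ X, f.Collapsed X → P X → P (Γ.i X)) {X Y : Γ.H}
    (h : f.onV (Γ.s X) = f.onV (Γ.s Y)) (hX : P X) : P Y := by
  have hw := (f.tree (f.onV (Γ.s X))).walk (Γ.s X) (Γ.s Y)
    (by change f.toFun _ = _; rw [f.inl_onV]) (by change f.toFun _ = _; rw [f.inl_onV, h])
  have key : ∀ v, Γ.Walk (f.toFun ⁻¹' {Sum.inl (f.onV (Γ.s X))}) (Γ.s X) v →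
      ∀ Z, Γ.s Z = v → P Z := by
    intro v hv
    induction hv with
    | refl => exact fun Z hZ => forall_of_σ hσ hZ.symm hX
    | tail _ h ih =>
      obtain ⟨A, hA', rfl, rfl⟩ := h
      exact fun Z hZ => forall_of_σ hσ hZ.symm (hi A ⟨_, hA'⟩ (ih A rfl))
  exact key _ hw Y rfl

/-- The union of the two sides is stable under the cyclic orders and under collapsed edges, so it
exhausts the connected fibre. -/
lemma far_or_far_i {A X : Γ.H} (h : f.onV (Γ.s X) = f.onV (Γ.s A)) :
    f.Far A X ∨ f.Far (Γ.i A) X := by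
  have hAi : f.Far (Γ.i A) A := by
    have := Far.base (f := f) (A := Γ.i A)
    rwa [Γ.i_i] at this
  refine forall_of_fibre (f := f) (P := fun X => f.Far A X ∨ f.Far (Γ.i A) X)
    ?_ ?_ h.symm (Or.inr hAi)
  · rintro X (h | h)
    · exact Or.inl (.σ _ h)
    · exact Or.inr (.σ _ h)
  · intro X hX hor
    by_cases h1 : X = A
    · rw [h1]
      exact Or.inl .base
    · by_cases h2 : X = Γ.i A
      · rw [h2, Γ.i_i]
        exact Or.inr hAi
      · rcases hor with h | h
        · exact Or.inl (.i _ hX h1 h2 h)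
        · exact Or.inr (.i _ hX h2 (by rwa [Γ.i_i]) h)

/-- The moves that build one side keep to the complement of the other; the start of the induction is
the tree property `not_far_self`. -/
lemma not_far_of_far_i {A X : Γ.H} (hA : f.Collapsed A) (h : f.Far (Γ.i A) X) :
    ¬ f.Far A X := by
  induction h with
  | base => rw [Γ.i_i]; exact not_far_self hA
  | σ X _ ih => exact fun h => ih h.of_σ
  | i X hX h1 h2 _ ih =>
    rw [Γ.i_i] at h2
    exact fun h => ih ((Far.i_iff hX h2 h1).1 h)

lemma far_i_iff {A X : Γ.H} (hA : f.Collapsed A) (h : f.onV (Γ.s X) = f.onV (Γ.s A)) :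
    f.Far (Γ.i A) X ↔ ¬ f.Far A X :=
  ⟨not_far_of_far_i hA, fun h1 => (far_or_far_i h).resolve_left h1⟩

/-- The first surviving half-edge that is met when walking along the boundary. -/
inductive Reach (f : Hom Γ Δ) : Γ.H → Δ.H → Prop
  | base (B : Δ.H) : Reach f (f.lift B) B
  | step (A : Γ.H) (B : Δ.H) : f.Collapsed A → Reach f (Γ.σ (Γ.i A)) B → Reach f A B

/-- Let `O` be the half-edges whose boundary walk never survives. If `X` were in `O` but `i X` not,
the walk from `X` would stay beyond `X`, never crossing back through `i X`; being periodic, it would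
return to `X` from the far side, which a tree forbids. So `O` is stable under `i` and `σ` and
contains whole fibres, but every fibre contains a surviving half-edge. -/
lemma exists_reach (A : Γ.H) : ∃ B, f.Reach A B := by
  by_contra hA
  let O : Γ.H → Prop := fun X => ¬ ∃ B, f.Reach X B
  have hcol : ∀ X, O X → f.Collapsed X := by
    intro X hX
    by_contra h
    obtain ⟨B, rfl⟩ := f.exists_lift_of_not_collapsed h
    exact hX ⟨B, .base B⟩
  have hω : ∀ X, O X → O (Γ.σ (Γ.i X)) := fun X hX ⟨B, hB⟩ => hX ⟨B, .step X B (hcol X hX) hB⟩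
  have hi : ∀ X, O X → O (Γ.i X) := by
    intro X hX hcon
    have key : ∀ n, O ((Γ.ω ^ n) (Γ.ω X)) ∧ f.Far X ((Γ.ω ^ n) (Γ.ω X)) := by
      intro n
      induction n with
      | zero => exact ⟨hω X hX, .σ _ .base⟩
      | succ n ih =>
        rw [pow_succ', Equiv.Perm.mul_apply]
        set Y := (Γ.ω ^ n) (Γ.ω X)
        refine ⟨hω Y ih.1, .σ _ (.i _ (hcol _ ih.1) ?_ ?_ ih.2)⟩
        · intro h
          have := ih.2
          rw [h] at this
          exact not_far_self (hcol _ hX) this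
        · intro h
          have := ih.1
          rw [h] at this
          exact this hcon
    have h1 := (key (orderOf Γ.ω - 1)).2
    rw [← Equiv.Perm.mul_apply, ← pow_succ, Nat.sub_add_cancel (orderOf_pos _),
      pow_orderOf_eq_one] at h1
    exact not_far_self (hcol _ hX) h1
  have hσ : ∀ X, O X → O (Γ.σ X) := by
    intro X hX
    have := hω _ (hi X hX)
    rwa [Γ.i_i] at this
  obtain ⟨B, hB⟩ := Δ.exists_half_edge (f.onV (Γ.s A))
  have h := forall_of_fibre (f := f) (P := O) hσ (fun X _ => hi X) (X := A) (Y := f.lift B)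
    (by rw [f.onV_s_lift, hB]) hA
  exact f.not_collapsed_lift B (hcol _ h)

lemma Reach.unique {A : Γ.H} {B C : Δ.H} (h : f.Reach A B) (h' : f.Reach A C) : B = C := by
  induction h with
  | base B =>
    generalize hX : f.lift B = X at h'
    cases h' with
    | base C => exact f.lift_injective hX
    | step _ _ hc _ => exact absurd (hX ▸ hc) (f.not_collapsed_lift B)
  | step A B hc _ ih =>
    cases h' with
    | base C => exact absurd hc (f.not_collapsed_lift C)
    | step _ _ _ h => exact ih h

variable (f)

/-- The first surviving half-edge that is met when walking along the boundary. -/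
noncomputable def st (A : Γ.H) : Δ.H := (exists_reach (f := f) A).choose

lemma reach_st (A : Γ.H) : f.Reach A (f.st A) := (exists_reach A).choose_spec

lemma st_lift (B : Δ.H) : f.st (f.lift B) = B := (f.reach_st _).unique (.base B)

variable {f}

lemma Collapsed.st_σ_i {A : Γ.H} (h : f.Collapsed A) : f.st (Γ.σ (Γ.i A)) = f.st A :=
  (Reach.step A _ h (f.reach_st _)).unique (f.reach_st A)

lemma Collapsed.st_σ {A : Γ.H} (h : f.Collapsed A) : f.st (Γ.σ A) = f.st (Γ.i A) := by
  rw [← h.i.st_σ_i, Γ.i_i]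

variable (f)

lemma s_st (A : Γ.H) : Δ.s (f.st A) = f.onV (Γ.s A) := by
  have : ∀ B, f.Reach A B → Δ.s B = f.onV (Γ.s A) := by
    intro B hB
    induction hB with
    | base B => exact (f.onV_s_lift B).symm
    | step A B hc _ ih => rw [ih, Γ.s_σ, hc.onV_s_i]
  exact this _ (f.reach_st A)

/-- The compatibility of the boundary permutations, read at `Δ.i B`: the half-edges that are skipped
are collapsed, and `st` is constant along them. -/
lemma st_σ_lift (B : Δ.H) : f.st (Γ.σ (f.lift B)) = Δ.σ B := by
  obtain ⟨k, hk, h1, h2⟩ := f.map_ω _ _ (f.map_lift (Δ.i B))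
  rw [ω_apply, Δ.i_i] at h1
  have key : ∀ j, j < k → f.st ((Γ.ω ^ (k - j)) (f.lift (Δ.i B))) = Δ.σ B := by
    intro j
    induction j with
    | zero =>
      intro _
      rw [Nat.sub_zero, f.eq_lift h1, st_lift]
    | succ j ih =>
      intro hj
      rw [← ih (by omega)]
      have hc : f.Collapsed ((Γ.ω ^ (k - (j + 1))) (f.lift (Δ.i B))) :=
        h2 _ (by omega) (by omega)
      rw [← hc.st_σ_i, ← ω_apply, ← Equiv.Perm.mul_apply, ← pow_succ']
      congr 3
      omega
  have := key (k - 1) (by omega)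
  rw [Nat.sub_sub_self hk, pow_one, ω_apply, f.i_lift, Δ.i_i] at this
  exact this

variable {f}

/-- A boundary walk that starts beyond `A` can leave the far side only through `i A`, and from there
on it is the walk of `i A`. -/
lemma far_st_or {A X : Γ.H} (hA : f.Collapsed A) (h : f.Far A X) :
    f.Far A (f.lift (f.st X)) ∨ f.st X = f.st (Γ.i A) := by
  have : ∀ B, f.Reach X B → f.Far A (f.lift B) ∨ B = f.st (Γ.i A) := by
    intro B hB
    induction hB with
    | base B => exact Or.inl h
    | step X B hc hr ih =>
      by_cases h1 : X = Γ.i A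
      · subst h1
        exact Or.inr ((Reach.step _ _ hc hr).unique (f.reach_st _))
      · refine ih (.σ _ (.i _ hc ?_ h1 h))
        rintro rfl
        exact not_far_self hA h
  exact this _ (f.reach_st X)

lemma not_far_st_or {A X : Γ.H} (hA : f.Collapsed A) (hX : f.onV (Γ.s X) = f.onV (Γ.s A))
    (h : ¬ f.Far A X) : ¬ f.Far A (f.lift (f.st X)) ∨ f.st X = f.st A := by
  rw [← far_i_iff hA hX] at h
  have := far_st_or hA.i h
  rwa [Γ.i_i, far_i_iff hA (by rw [f.onV_s_lift, s_st, hX])] at this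

end Hom

end LeafedFatGraph

/-! ### Cyclic positions and noncrossing of collapsed edges -/

/-- Strict cyclic order of natural numbers. -/
def Cyc (a b c : ℕ) : Prop := (a < b ∧ b < c) ∨ (b < c ∧ c < a) ∨ (c < a ∧ a < b)

namespace LeafedFatGraph

section Position

variable (Γ : LeafedFatGraph)

/-- A chosen half-edge at every vertex. -/
noncomputable def baseAt (v : Γ.V) : Γ.H := (Γ.exists_half_edge v).choose

lemma s_baseAt (v : Γ.V) : Γ.s (Γ.baseAt v) = v := (Γ.exists_half_edge v).choose_spec

lemma s_iterate (n : ℕ) (A : Γ.H) : Γ.s (Γ.σ^[n] A) = Γ.s A := by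
  induction n with
  | zero => rfl
  | succ n ih => rw [Function.iterate_succ_apply', Γ.s_σ, ih]

lemma period_pos (A : Γ.H) : 0 < Function.minimalPeriod Γ.σ A :=
  Function.minimalPeriod_pos_of_mem_periodicPts
    (Γ.σ.injective.mem_periodicPts A)

lemma exists_position (A : Γ.H) : ∃ n < Function.minimalPeriod Γ.σ (Γ.baseAt (Γ.s A)),
    Γ.σ^[n] (Γ.baseAt (Γ.s A)) = A := by
  obtain ⟨n, -, hn⟩ := (Γ.cyclic (Γ.baseAt (Γ.s A)) A (Γ.s_baseAt _)).exists_pow_eq'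
  refine ⟨n % Function.minimalPeriod Γ.σ (Γ.baseAt (Γ.s A)), Nat.mod_lt _ (Γ.period_pos _), ?_⟩
  rw [Function.iterate_mod_minimalPeriod_eq, ← Equiv.Perm.coe_pow, hn]

/-- The position of a half-edge in the cyclic order at its vertex. -/
noncomputable def pos (A : Γ.H) : ℕ := (Γ.exists_position A).choose

lemma pos_lt_period (A : Γ.H) : Γ.pos A < Function.minimalPeriod Γ.σ (Γ.baseAt (Γ.s A)) :=
  (Γ.exists_position A).choose_spec.1

lemma iterate_pos (A : Γ.H) : Γ.σ^[Γ.pos A] (Γ.baseAt (Γ.s A)) = A :=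
  (Γ.exists_position A).choose_spec.2

lemma pos_iterate {v : Γ.V} {n : ℕ} (hn : n < Function.minimalPeriod Γ.σ (Γ.baseAt v)) :
    Γ.pos (Γ.σ^[n] (Γ.baseAt v)) = n := by
  have hs : Γ.s (Γ.σ^[n] (Γ.baseAt v)) = v := by rw [s_iterate, s_baseAt]
  have h1 := Γ.iterate_pos (Γ.σ^[n] (Γ.baseAt v))
  have h2 := Γ.pos_lt_period (Γ.σ^[n] (Γ.baseAt v))
  rw [hs] at h1 h2
  exact Function.iterate_injOn_Iio_minimalPeriod h2 hn h1

lemma period_eq_val (v : Γ.V) : Function.minimalPeriod Γ.σ (Γ.baseAt v) = Γ.val v := by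
  rw [← Nat.card_fin (Function.minimalPeriod Γ.σ (Γ.baseAt v))]
  refine Nat.card_eq_of_bijective
    (fun n => ⟨Γ.σ^[n] (Γ.baseAt v), by rw [s_iterate, s_baseAt]⟩) ⟨?_, ?_⟩
  · intro m n h
    have := congrArg (fun A => Γ.pos A.1) h
    simp only [Γ.pos_iterate m.2, Γ.pos_iterate n.2] at this
    exact Fin.ext this
  · rintro ⟨A, rfl⟩
    exact ⟨⟨Γ.pos A, Γ.pos_lt_period A⟩, Subtype.ext (Γ.iterate_pos A)⟩

lemma pos_lt (A : Γ.H) : Γ.pos A < Γ.val (Γ.s A) := by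
  rw [← period_eq_val]
  exact Γ.pos_lt_period A

lemma eq_of_pos_eq {A B : Γ.H} (h : Γ.s A = Γ.s B) (hp : Γ.pos A = Γ.pos B) : A = B := by
  rw [← Γ.iterate_pos A, ← Γ.iterate_pos B, h, hp]

lemma exists_pos_eq {v : Γ.V} {n : ℕ} (hn : n < Γ.val v) : ∃ A, Γ.s A = v ∧ Γ.pos A = n := by
  rw [← period_eq_val] at hn
  exact ⟨_, by rw [s_iterate, s_baseAt], Γ.pos_iterate hn⟩

lemma pos_σ (A : Γ.H) : Γ.pos (Γ.σ A) = if Γ.pos A + 1 = Γ.val (Γ.s A) then 0 else Γ.pos A + 1 := by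
  have h := Γ.iterate_pos A
  have hlt := Γ.pos_lt A
  have hσ : Γ.σ A = Γ.σ^[Γ.pos A + 1] (Γ.baseAt (Γ.s A)) := by
    rw [Function.iterate_succ_apply', h]
  split_ifs with h1
  · have h2 : Γ.σ A = Γ.σ^[0] (Γ.baseAt (Γ.s A)) := by
      rw [hσ, h1, ← period_eq_val, Function.iterate_minimalPeriod]
      rfl
    rw [h2, Γ.pos_iterate (Γ.period_pos _)]
  · rw [hσ, Γ.pos_iterate]
    rw [period_eq_val]
    omega

/-- The number of steps from one half-edge to another in the cyclic order. -/
noncomputable def offset (A B : Γ.H) : ℕ :=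
  if Γ.pos A ≤ Γ.pos B then Γ.pos B - Γ.pos A else Γ.pos B + Γ.val (Γ.s A) - Γ.pos A

variable {Γ}

/-- Induction on the number of steps from `b`: the property is inherited until the rotation arrives
at `c`, and around the whole vertex if `c = b`. -/
lemma propagate {Q : Γ.H → Prop} {b c : Γ.H} (hb : Q b)
    (h : ∀ B, Γ.s B = Γ.s b → Q B → Q (Γ.σ B) ∨ Γ.σ B = c) {B : Γ.H} (hB : Γ.s B = Γ.s b)
    (hc : Γ.offset b B < Γ.offset b c ∨ c = b) : Q B := by
  generalize hn : Γ.offset b B = n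
  induction n generalizing B with
  | zero =>
    have : B = b := by
      refine Γ.eq_of_pos_eq hB ?_
      have h1 := Γ.pos_lt b
      have h2 := Γ.pos_lt B
      rw [hB] at h2
      unfold offset at hn
      split_ifs at hn <;> omega
    rwa [this]
  | succ n ih =>
    obtain ⟨B, rfl⟩ := Γ.σ.surjective B
    rw [Γ.s_σ] at hB
    have hoff : Γ.offset b B = n := by
      have h1 := Γ.pos_lt b
      have h2 := Γ.pos_lt B
      have h3 := Γ.pos_σ B
      rw [hB] at h2 h3
      unfold offset at hn ⊢
      split_ifs at hn h3 ⊢ <;> omega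
    have hlt : Γ.offset b B < Γ.offset b c ∨ c = b := hc.imp_left (by omega)
    refine (h B hB (ih hB hlt hoff)).resolve_right fun hcon => ?_
    rcases hc with hc | hc
    · rw [hcon] at hc
      exact lt_irrefl _ hc
    · rw [hcon, hc] at hn
      simp [offset] at hn

/-- A set of half-edges at a vertex that is entered only at `b` and left only at `c` is an arc. -/
lemma isArc {P : Γ.H → Prop} {b c : Γ.H} (hbc : Γ.s c = Γ.s b)
    (h1 : ∀ B, Γ.s B = Γ.s b → P B → P (Γ.σ B) ∨ Γ.σ B = c)
    (h2 : ∀ B, Γ.s B = Γ.s b → ¬ P B → ¬ P (Γ.σ B) ∨ Γ.σ B = b)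
    (hb : P b ∨ b = c) (hc : ¬ P c ∨ b = c)
    (hP : ∃ B, Γ.s B = Γ.s b ∧ P B) (hP' : ∃ B, Γ.s B = Γ.s b ∧ ¬ P B) :
    b ≠ c ∧ ∀ B, Γ.s B = Γ.s b → (P B ↔ B = b ∨ Cyc (Γ.pos b) (Γ.pos B) (Γ.pos c)) := by
  -- For `b = c` either the property or its negation would spread over the whole vertex.
  have hne : b ≠ c := by
    rintro rfl
    by_cases hPb : P b
    · obtain ⟨B, hB, hPB⟩ := hP'
      exact hPB (propagate hPb h1 hB (Or.inr rfl))
    · obtain ⟨B, hB, hPB⟩ := hP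
      exact propagate (Q := fun B => ¬ P B) hPb h2 hB (Or.inr rfl) hPB
  refine ⟨hne, fun B hB => ?_⟩
  have hPb := hb.resolve_right hne
  have hPc := hc.resolve_right hne
  have k1 := Γ.pos_lt b
  have k2 := Γ.pos_lt B
  have k3 := Γ.pos_lt c
  have k4 : Γ.pos b ≠ Γ.pos c := fun h => hne (Γ.eq_of_pos_eq hbc.symm h)
  rw [hB] at k2
  rw [hbc] at k3
  have k5 : B ≠ b → Γ.pos B ≠ Γ.pos b := fun h h' => h (Γ.eq_of_pos_eq hB h')
  constructor
  · intro hPB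
    by_contra! hcon
    obtain ⟨hBb, hcyc⟩ := hcon
    have k6 := k5 hBb
    refine propagate (Q := fun B => ¬ P B) (b := c) (c := b) hPc
      (fun B hB => h2 B (hB.trans hbc)) (hB.trans hbc.symm) (Or.inl ?_) hPB
    unfold Cyc at hcyc
    unfold offset
    rw [hbc]
    split_ifs <;> omega
  · rintro hor
    refine propagate hPb h1 hB (Or.inl ?_)
    rcases hor with rfl | hcyc
    · unfold offset
      split_ifs <;> omega
    · unfold Cyc at hcyc
      unfold offset
      split_ifs <;> omega

end Position

/-! ### The surviving half-edges on the two sides of a collapsed edge -/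

namespace Hom

variable {Γ Δ : LeafedFatGraph} (f : Hom Γ Δ)

/-- The surviving half-edges that lie beyond a half-edge. -/
def Sees (A : Γ.H) (B : Δ.H) : Prop := (f.Collapsed A ∧ f.Far A (f.lift B)) ∨ A = f.lift B

variable {f}

lemma sees_iff {A : Γ.H} (hA : f.Collapsed A) {B : Δ.H} : f.Sees A B ↔ f.Far A (f.lift B) := by
  constructor
  · rintro (⟨-, h⟩ | rfl)
    · exact h
    · exact absurd hA (f.not_collapsed_lift B)
  · exact fun h => Or.inl ⟨hA, h⟩

lemma sees_lift_iff {B C : Δ.H} : f.Sees (f.lift C) B ↔ B = C := by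
  constructor
  · rintro (⟨h, -⟩ | h)
    · exact absurd h (f.not_collapsed_lift C)
    · exact (f.lift_injective h).symm
  · rintro rfl
    exact Or.inr rfl

lemma Sees.s_eq {A : Γ.H} {B : Δ.H} (h : f.Sees A B) : Δ.s B = f.onV (Γ.s A) := by
  rcases h with ⟨h1, h2⟩ | rfl
  · rw [← f.onV_s_lift, h2.onV_s h1]
  · rw [f.onV_s_lift]

/-- A walk beyond `Z` never crosses the edge of `Y`, since neither half of it is beyond `Z`;
starting beyond `Y`, it stays there. -/
lemma far_subset {Y Z : Γ.H} (h1 : ¬ f.Far Z Y) (h2 : f.Far Y Z) (hY : f.Collapsed Y)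
    (hZ : f.Collapsed Z) {X : Γ.H} (h : f.Far Z X) : f.Far Y X := by
  have hYZ : Y ≠ Z := by
    rintro rfl
    exact not_far_self hY h2
  have hYi : Y ≠ Γ.i Z := by
    rintro rfl
    exact h1 .base
  have h1' : ¬ f.Far Z (Γ.i Y) := by rwa [Far.i_iff hY hYZ hYi]
  induction h with
  | base =>
    refine .i _ hZ hYZ.symm (fun h => hYi ?_) h2
    rw [h, Γ.i_i]
  | σ X _ ih => exact .σ _ ih
  | i X hX h3 h4 h5 ih =>
    refine .i _ hX ?_ ?_ ih
    · rintro rfl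
      exact h1 h5
    · rintro rfl
      exact h1' h5

/-- Again a walk beyond `Z` does not cross the edge of `Y`; here it starts on the near side of `Y`.
-/
lemma far_disjoint {Y Z : Γ.H} (h1 : ¬ f.Far Z Y) (h2 : ¬ f.Far Y Z) (hYZ : Y ≠ Z)
    (hY : f.Collapsed Y) (hZ : f.Collapsed Z) {X : Γ.H} (h : f.Far Z X) : ¬ f.Far Y X := by
  have hYi : Y ≠ Γ.i Z := by
    rintro rfl
    exact h1 .base
  have h1' : ¬ f.Far Z (Γ.i Y) := by rwa [Far.i_iff hY hYZ hYi]
  induction h with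
  | base =>
    rwa [Far.i_iff hZ hYZ.symm]
    intro h
    refine hYi ?_
    rw [h, Γ.i_i]
  | σ X _ ih => exact fun h => ih h.of_σ
  | i X hX h3 h4 h5 ih =>
    rwa [Far.i_iff hX]
    · rintro rfl
      exact h1 h5
    · rintro rfl
      exact h1' h5

lemma sees_subset {Y Z : Γ.H} (h1 : ¬ f.Far Z Y) (h2 : f.Far Y Z) (hY : f.Collapsed Y)
    (hZ : f.Collapsed Z) {B : Δ.H} (h : f.Sees Z B) : f.Sees Y B := by
  rw [sees_iff hY]
  rw [sees_iff hZ] at h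
  exact far_subset h1 h2 hY hZ h

lemma sees_disjoint {Y Z : Γ.H} (h1 : ¬ f.Far Z Y) (h2 : f.Collapsed Y → ¬ f.Far Y Z)
    (hYZ : Y ≠ Z) (hZ : f.Collapsed Z) {B : Δ.H} (h : f.Sees Z B) : ¬ f.Sees Y B := by
  rw [sees_iff hZ] at h
  by_cases hY : f.Collapsed Y
  · rw [sees_iff hY]
    exact far_disjoint h1 (h2 hY) hYZ hY hZ h
  · rintro (⟨h3, -⟩ | rfl)
    · exact hY h3
    · exact h1 h

lemma not_far_of_s_eq {A B : Γ.H} (h : Γ.s A = Γ.s B) (hA : f.Collapsed A) : ¬ f.Far A B :=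
  fun h1 => not_far_self hA (h1.of_s h.symm)

/-- Different half-edges at one vertex lead into different branches of the fibre. -/
lemma sees_disjoint_of_s_eq {Y Z : Γ.H} (hs : Γ.s Y = Γ.s Z) (hYZ : Y ≠ Z) {B : Δ.H}
    (h : f.Sees Z B) : ¬ f.Sees Y B := by
  by_cases hZ : f.Collapsed Z
  · exact sees_disjoint (not_far_of_s_eq hs.symm hZ) (not_far_of_s_eq hs) hYZ hZ h
  · by_cases hY : f.Collapsed Y
    · exact fun h' => sees_disjoint (not_far_of_s_eq hs hY) (not_far_of_s_eq hs.symm) hYZ.symm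
        hY h' h
    · rcases h with ⟨h, -⟩ | rfl
      · exact absurd h hZ
      · rintro (⟨h, -⟩ | rfl)
        · exact hY h
        · exact hYZ rfl

/-- Induction on the size of the far side. The far end of `X` has at least two further half-edges;
each survives or leads into a smaller branch, and what different branches see is disjoint. -/
lemma exists_two_sees_of_far {X : Γ.H} (hX : f.Collapsed X)
    (hval : ∀ Y, f.Far X Y → 3 ≤ Γ.val (Γ.s Y)) :
    ∃ B C, B ≠ C ∧ f.Sees X B ∧ f.Sees X C := by
  generalize hn : {Y | f.Far X Y}.ncard = n
  induction n using Nat.strong_induction_on generalizing X with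
  | _ n ih =>
    have hv := hval _ .base
    have h1 : Γ.σ (Γ.i X) ≠ Γ.i X := Γ.σ_ne_self hv
    have h2 : Γ.σ (Γ.σ (Γ.i X)) ≠ Γ.i X := Γ.σ_σ_ne_self hv
    have h3 : Γ.σ (Γ.σ (Γ.i X)) ≠ Γ.σ (Γ.i X) := fun h => h1 (Γ.σ.injective h)
    have key : ∀ Y, Γ.s Y = Γ.s (Γ.i X) → Y ≠ Γ.i X → ∃ B, f.Sees Y B ∧ f.Sees X B := by
      intro Y hs hne
      have hfar : f.Far X Y := Far.base.of_s hs.symm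
      by_cases hY : f.Collapsed Y
      · have hYX : X ≠ Y := by
          rintro rfl
          exact not_far_self hX hfar
        have hnot : ¬ f.Far Y X := by
          have := not_far_of_s_eq hs hY
          rwa [Far.i_iff hX hYX] at this
          intro h
          refine hne ?_
          rw [h, Γ.i_i]
        have hsub : ∀ Z, f.Far Y Z → f.Far X Z := fun Z => far_subset hnot hfar hX hY
        obtain ⟨B, C, -, hB, -⟩ := ih _ (by
          rw [← hn]
          exact Set.ncard_lt_ncard ⟨hsub, fun h => not_far_self hY (h hfar)⟩) hY
          (fun Z hZ => hval Z (hsub Z hZ)) rfl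
        exact ⟨B, hB, sees_subset hnot hfar hX hY hB⟩
      · obtain ⟨B, rfl⟩ := f.exists_lift_of_not_collapsed hY
        exact ⟨B, Or.inr rfl, (sees_iff hX).2 hfar⟩
    obtain ⟨B, hB, hB'⟩ := key (Γ.σ (Γ.i X)) (Γ.s_σ _) h1
    obtain ⟨C, hC, hC'⟩ := key (Γ.σ (Γ.σ (Γ.i X))) (by rw [Γ.s_σ, Γ.s_σ]) h2
    refine ⟨B, C, ?_, hB', hC'⟩
    rintro rfl
    exact sees_disjoint_of_s_eq (Γ.s_σ _) h3 hB hC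

lemma onV_leaf (j : Fin Γ.n) : f.onV (Γ.leaf j) = Δ.leaf (Fin.cast f.n_eq j) := by
  have := f.map_leaf j
  rw [f.inl_onV] at this
  exact Sum.inl_injective this

/-- The half-edge at a leaf is not collapsed. -/
lemma Collapsed.s_ne_leaf {A : Γ.H} (hA : f.Collapsed A) (j : Fin Γ.n) : Γ.s A ≠ Γ.leaf j := by
  intro hj
  -- No leaf lies beyond `A`, since different leaves are sent to different leaves. So all valences
  -- there are at least three and `A` would see two half-edges at a univalent vertex.
  obtain ⟨B, C, hne, hB, hC⟩ := exists_two_sees_of_far hA fun Y hY => Γ.three_le_val _ (by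
    rintro ⟨j', hj'⟩
    have h1 := hY.onV_s hA
    rw [← hj', hj, onV_leaf, onV_leaf] at h1
    have h2 : j' = j := Fin.cast_injective _ (Δ.leaf_injective h1)
    exact not_far_self hA (hY.of_s (by rw [← hj', hj, h2])))
  have hs : f.onV (Γ.s A) = Δ.leaf (Fin.cast f.n_eq j) := by rw [hj, onV_leaf]
  exact hne (Δ.eq_of_s_leaf (hB.s_eq.trans hs) (hC.s_eq.trans hs))

lemma Collapsed.three_le_val {A : Γ.H} (hA : f.Collapsed A) : 3 ≤ Γ.val (Γ.s A) :=
  Γ.three_le_val _ fun ⟨j, hj⟩ => hA.s_ne_leaf j hj.symm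

lemma Far.three_le_val {A X : Γ.H} (hA : f.Collapsed A) (h : f.Far A X) : 3 ≤ Γ.val (Γ.s X) := by
  induction h with
  | base => exact hA.i.three_le_val
  | σ X _ ih => rwa [Γ.s_σ]
  | i X hX _ _ _ ih => exact hX.i.three_le_val

lemma exists_two_sees {X : Γ.H} (hX : f.Collapsed X) :
    ∃ B C, B ≠ C ∧ f.Sees X B ∧ f.Sees X C :=
  exists_two_sees_of_far hX fun _ hY => hY.three_le_val hX

lemma sees_i_iff {A : Γ.H} (hA : f.Collapsed A) {B : Δ.H} (hB : Δ.s B = f.onV (Γ.s A)) :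
    f.Sees (Γ.i A) B ↔ ¬ f.Sees A B := by
  rw [sees_iff hA.i, sees_iff hA, far_i_iff hA (by rw [f.onV_s_lift, hB])]

lemma s_st_i {A : Γ.H} (hA : f.Collapsed A) : Δ.s (f.st (Γ.i A)) = Δ.s (f.st A) := by
  rw [s_st, s_st, hA.onV_s_i]

/-- Rotating around the target vertex, one enters the set seen by `A` only at `st A` and leaves it
only at `st (i A)`. Both this set and its complement are non-empty, by `exists_two_sees` for `A` and
for `i A`. -/
lemma sees_isArc {A : Γ.H} (hA : f.Collapsed A) : f.st A ≠ f.st (Γ.i A) ∧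
    ∀ B, Δ.s B = Δ.s (f.st A) → (f.Sees A B ↔
      B = f.st A ∨ Cyc (Δ.pos (f.st A)) (Δ.pos B) (Δ.pos (f.st (Γ.i A)))) := by
  obtain ⟨B, -, -, hB, -⟩ := exists_two_sees hA
  obtain ⟨C, -, -, hC, -⟩ := exists_two_sees hA.i
  have hCs := hC.s_eq
  rw [hA.onV_s_i] at hCs
  rw [sees_i_iff hA hCs] at hC
  refine isArc (s_st_i hA) ?_ ?_ ?_ ?_ ⟨B, by rw [hB.s_eq, s_st], hB⟩
    ⟨C, by rw [hCs, s_st], hC⟩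
  · intro B hB h
    rw [sees_iff hA] at h ⊢
    have := far_st_or hA (.σ _ h)
    rwa [st_σ_lift] at this
  · intro B hB h
    rw [sees_iff hA] at h ⊢
    have := not_far_st_or hA (X := Γ.σ (f.lift B)) (by rw [Γ.s_σ, f.onV_s_lift, hB, s_st])
      (fun h' => h h'.of_σ)
    rwa [st_σ_lift] at this
  · rw [sees_iff hA]
    have := far_st_or hA (.σ _ .base)
    rwa [hA.st_σ_i] at this
  · rw [sees_iff hA]
    have := not_far_st_or hA (X := Γ.σ A) (by rw [Γ.s_σ]) (fun h' => not_far_self hA h'.of_σ)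
    rw [hA.st_σ] at this
    exact this.imp_right Eq.symm

variable (f)

lemma sees_st (A : Γ.H) : f.Sees A (f.st A) := by
  by_cases hA : f.Collapsed A
  · exact ((sees_isArc hA).2 _ rfl).2 (Or.inl rfl)
  · obtain ⟨B, rfl⟩ := f.exists_lift_of_not_collapsed hA
    rw [st_lift]
    exact Or.inr rfl

variable {f}

lemma not_sees_st_i {A : Γ.H} (hA : f.Collapsed A) : ¬ f.Sees A (f.st (Γ.i A)) := by
  rw [← sees_i_iff hA (by rw [s_st, hA.onV_s_i])]
  exact f.sees_st _

lemma Collapsed.st_ne {A : Γ.H} (hA : f.Collapsed A) : f.st A ≠ f.st (Γ.i A) := (sees_isArc hA).1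

/-- The arc seen by `A` has at least two elements, so the diagonal is not a side of the polygon. -/
lemma Collapsed.st_i_ne_σ {A : Γ.H} (hA : f.Collapsed A) : f.st (Γ.i A) ≠ Δ.σ (f.st A) := by
  intro h
  obtain ⟨B, C, hne, hB, hC⟩ := exists_two_sees hA
  have key : ∀ B, f.Sees A B → B = f.st A := by
    intro B hB
    have hs : Δ.s B = Δ.s (f.st A) := by rw [hB.s_eq, s_st]
    refine (((sees_isArc hA).2 B hs).1 hB).resolve_right fun hcyc => ?_
    have h1 := Δ.pos_σ (f.st A)
    have h2 := Δ.pos_lt B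
    rw [hs] at h2
    rw [h] at hcyc
    unfold Cyc at hcyc
    split_ifs at h1 <;> omega
  exact hne ((key B hB).trans (key C hC).symm)

lemma pos_ne {B C : Δ.H} (h : B ≠ C) (hs : Δ.s B = Δ.s C) : Δ.pos B ≠ Δ.pos C :=
  fun h' => h (Δ.eq_of_pos_eq hs h')

/-- If the diagonals crossed, there would be half-edges seen by both, by only one, by only the
other, and by neither. But of the sides of two edges of a tree, two are nested or disjoint, so one
of these four sets is empty. -/
lemma Collapsed.noncrossing {A A' : Γ.H} (hA : f.Collapsed A) (hA' : f.Collapsed A')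
    (hs : Δ.s (f.st A) = Δ.s (f.st A'))
    (h1 : Cyc (Δ.pos (f.st A)) (Δ.pos (f.st A')) (Δ.pos (f.st (Γ.i A))))
    (h2 : Cyc (Δ.pos (f.st (Γ.i A))) (Δ.pos (f.st (Γ.i A'))) (Δ.pos (f.st A))) : False := by
  have hne : A' ≠ A := by
    rintro rfl
    unfold Cyc at h1
    omega
  have hb : ¬ f.Sees A' (f.st A) := by
    rw [(sees_isArc hA').2 _ hs]
    rintro (h | h)
    · rw [h] at h1
      unfold Cyc at h1
      omega
    · unfold Cyc at *
      omega
  have hb' : f.Sees A (f.st A') := ((sees_isArc hA).2 _ hs.symm).2 (Or.inr h1)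
  have hc : f.Sees A' (f.st (Γ.i A)) := by
    refine ((sees_isArc hA').2 _ ((s_st_i hA).trans hs)).2 (Or.inr ?_)
    unfold Cyc at *
    omega
  have hc' : ¬ f.Sees A (f.st (Γ.i A')) := by
    rw [(sees_isArc hA).2 _ ((s_st_i hA').trans hs.symm)]
    rintro (h | h)
    · rw [h] at h2
      unfold Cyc at h2
      omega
    · unfold Cyc at *
      omega
  have hVV : f.onV (Γ.s A') = f.onV (Γ.s A) := by rw [← s_st, ← s_st, hs]
  by_cases hfar : f.Far A A'
  · have hfar' := not_far_of_far_i hA.i (by rwa [Γ.i_i]) (X := A') (f := f)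
    have hsA' : ∀ {B}, f.Sees A' B → (f.Sees (Γ.i A) B ↔ ¬ f.Sees A B) := fun h =>
      sees_i_iff hA (h.s_eq.trans hVV)
    by_cases h3 : f.Far A' (Γ.i A)
    · have := sees_subset (B := f.st (Γ.i A')) hfar' h3 hA' hA.i
        ((sees_i_iff hA (by rw [s_st, hA'.onV_s_i, hVV])).2 hc')
      exact not_sees_st_i hA' this
    · refine sees_disjoint hfar' (fun _ => h3) ?_ hA.i (f.sees_st (Γ.i A)) hc
      rintro rfl
      unfold Cyc at h1
      omega
  · by_cases h3 : f.Far A' A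
    · exact hb (sees_subset hfar h3 hA' hA (f.sees_st A))
    · exact sees_disjoint hfar (fun _ => h3) hne hA hb' (f.sees_st A')

lemma sees_congr {A A' : Γ.H} (hA : f.Collapsed A) (hA' : f.Collapsed A')
    (h1 : f.st A = f.st A') (h2 : f.st (Γ.i A) = f.st (Γ.i A')) {B : Δ.H} :
    f.Sees A B ↔ f.Sees A' B := by
  by_cases hs : Δ.s B = Δ.s (f.st A)
  · rw [(sees_isArc hA).2 B hs, (sees_isArc hA').2 B (h1 ▸ hs), h1, h2]
  · refine iff_of_false (fun h => hs ?_) (fun h => hs ?_)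
    · rw [h.s_eq, s_st]
    · rw [h.s_eq, h1, s_st]

/-- Equal diagonals see the same half-edges. If `A` lies beyond `A'`, valence three gives at the
source of `A` a further branch `Y` that does not lead to `A'`; what it sees is seen by `A'` but not
by `A`. If neither is beyond the other, they see disjoint sets although both see `st A`. -/
lemma Collapsed.eq_of_not_far {A A' : Γ.H} (hA : f.Collapsed A) (hA' : f.Collapsed A')
    (h1 : f.st A = f.st A') (h2 : f.st (Γ.i A) = f.st (Γ.i A')) (hfar : ¬ f.Far A A') :
    A = A' := by
  by_contra hne
  by_cases h3 : f.Far A' A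
  · have hv := hA.three_le_val
    have hY : ∃ Y, Γ.s Y = Γ.s A ∧ Y ≠ A ∧ (f.Collapsed Y → ¬ f.Far Y A') := by
      by_contra! hcon
      have e1 := hcon (Γ.σ A) (Γ.s_σ A) (Γ.σ_ne_self hv)
      have e2 := hcon (Γ.σ (Γ.σ A)) (by rw [Γ.s_σ, Γ.s_σ]) (Γ.σ_σ_ne_self hv)
      have hs : Γ.s (Γ.σ A) = Γ.s (Γ.σ (Γ.σ A)) := (Γ.s_σ _).symm
      exact far_disjoint (not_far_of_s_eq hs.symm e2.1) (not_far_of_s_eq hs e1.1)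
        (fun h => Γ.σ_ne_self hv (Γ.σ.injective h.symm)) e1.1 e2.1 e2.2 e1.2
    obtain ⟨Y, hYs, hYA, hYf⟩ := hY
    have hfarY : f.Far A' Y := h3.of_s hYs.symm
    have hYA' : A' ≠ Y := by
      rintro rfl
      exact not_far_self hA' hfarY
    have hYi : Y ≠ Γ.i A' := by
      rintro rfl
      refine hYf hA'.i ?_
      have := Far.base (f := f) (A := Γ.i A')
      rwa [Γ.i_i] at this
    have key : ¬ f.Sees (Γ.i A') (f.st Y) := fun h =>
      sees_disjoint (not_far_of_far_i hA'.i (by rwa [Γ.i_i])) (fun hY => by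
        rw [Far.i_iff hA' hYA']
        · exact hYf hY
        · intro h'
          refine hYi ?_
          rw [h', Γ.i_i]) hYi hA'.i h (f.sees_st Y)
    rw [sees_i_iff hA' (by rw [s_st, hfarY.onV_s hA']), not_not,
      ← sees_congr hA hA' h1 h2] at key
    exact sees_disjoint_of_s_eq hYs hYA key (f.sees_st Y)
  · refine sees_disjoint hfar (fun _ => h3) (Ne.symm hne) hA (f.sees_st A) ?_
    rw [h1]
    exact f.sees_st A'

/-- A collapsed half-edge is determined by the two surviving half-edges following it. -/
lemma Collapsed.eq_of_st_eq {A A' : Γ.H} (hA : f.Collapsed A) (hA' : f.Collapsed A')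
    (h1 : f.st A = f.st A') (h2 : f.st (Γ.i A) = f.st (Γ.i A')) : A = A' := by
  by_cases hfar : f.Far A A'
  · by_cases hne : A' = A
    · exact hne.symm
    have hne' : A' ≠ Γ.i A := by
      rintro rfl
      exact hA.st_ne h1
    -- If `A'` is beyond `A`, the opposite half-edges are not nested in this way, and the previous
    -- case applies to them.
    have h3 : ¬ f.Far (Γ.i A) (Γ.i A') := by
      rw [Far.i_iff hA' hne' (by rwa [Γ.i_i])]
      exact not_far_of_far_i hA.i (by rwa [Γ.i_i])
    have := hA.i.eq_of_not_far hA'.i h2 (by rwa [Γ.i_i, Γ.i_i]) h3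
    rw [← Γ.i_i A, this, Γ.i_i]
  · exact hA.eq_of_not_far hA' h1 h2 hfar

/-- By valence three `A`, `σ A` and `σ (σ A)` head different branches. So `st A` is outside the arc
seen by `σ A` and also differs from its end, which is `st (σ (σ A))`. -/
lemma cyc_st_σ {A : Γ.H} (hσ : f.Collapsed (Γ.σ A)) :
    Cyc (Δ.pos (f.st (Γ.σ A))) (Δ.pos (f.st (Γ.i (Γ.σ A)))) (Δ.pos (f.st A)) := by
  have hv := hσ.three_le_val
  rw [Γ.s_σ] at hv
  have hYA : Γ.σ A ≠ A := Γ.σ_ne_self hv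
  have hY'A : Γ.σ (Γ.σ A) ≠ A := Γ.σ_σ_ne_self hv
  have e1 : ¬ f.Sees (Γ.σ A) (f.st A) := sees_disjoint_of_s_eq (Γ.s_σ A) hYA (f.sees_st A)
  have e2 : f.st (Γ.i (Γ.σ A)) ≠ f.st A := by
    rw [← hσ.st_σ]
    intro h
    refine sees_disjoint_of_s_eq (by rw [Γ.s_σ, Γ.s_σ]) hY'A (f.sees_st A) ?_
    rw [← h]
    exact f.sees_st _
  have hs : Δ.s (f.st A) = Δ.s (f.st (Γ.σ A)) := by rw [s_st, s_st, Γ.s_σ]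
  rw [(sees_isArc hσ).2 _ hs] at e1
  push Not at e1
  have h1 := pos_ne e1.1 hs
  have h2 := pos_ne e2 ((s_st_i hσ).trans hs.symm)
  have h3 := pos_ne hσ.st_ne (s_st_i hσ).symm
  have h4 := e1.2
  unfold Cyc at *
  omega

/-- Any collapsed edge with the same initial corner as the next half-edge, and not reaching beyond
the current half-edge, is seen by the next half-edge. -/
lemma sees_σ_of_sees {A Z : Γ.H} (hZ : f.Collapsed Z) (hst : f.st Z = f.st (Γ.σ A))
    (hcyc : Cyc (Δ.pos (f.st Z)) (Δ.pos (f.st (Γ.i Z))) (Δ.pos (f.st A)))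
    {B : Δ.H} (hB : f.Sees Z B) : f.Sees (Γ.σ A) B := by
  have hsZ := f.sees_st Z
  by_cases hZY : Z = Γ.σ A
  · rwa [hZY] at hB
  have hVV : f.onV (Γ.s Z) = f.onV (Γ.s A) := by rw [← s_st, hst, s_st, Γ.s_σ]
  have hsA : Δ.s (f.st A) = Δ.s (f.st Z) := by rw [s_st, s_st, hVV]
  by_cases h1 : f.Far Z A
  -- Suppose `A` is beyond `Z`. Either `A` leads back across the edge of `Z`, and its arc, which
  -- ends at `st Z`, contains `st (i Z)`; or `Z` sees `st A`. Both contradict `hcyc`.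
  · exfalso
    have h1' : ¬ f.Far (Γ.i Z) A := not_far_of_far_i hZ.i (by rwa [Γ.i_i])
    have hAi : A ≠ Γ.i Z := by
      rintro rfl
      unfold Cyc at hcyc
      omega
    by_cases h2 : f.Collapsed A ∧ f.Far A (Γ.i Z)
    · have h3 := sees_subset h1' h2.2 h2.1 hZ.i (f.sees_st (Γ.i Z))
      rw [(sees_isArc h2.1).2 _ (by rw [s_st_i hZ, hsA]), ← h2.1.st_σ, ← hst] at h3
      rcases h3 with h3 | h3
      · rw [h3] at hcyc
        unfold Cyc at hcyc
        omega
      · unfold Cyc at *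
        omega
    · have h3 : ¬ f.Sees (Γ.i Z) (f.st A) := fun h =>
        sees_disjoint h1' (fun hA hfar => h2 ⟨hA, hfar⟩) hAi hZ.i h (f.sees_st A)
      rw [sees_i_iff hZ (by rw [s_st, hVV]), not_not, (sees_isArc hZ).2 _ hsA] at h3
      rcases h3 with h3 | h3
      · rw [h3] at hcyc
        unfold Cyc at hcyc
        omega
      · unfold Cyc at *
        omega
  · have h1' : ¬ f.Far Z (Γ.σ A) := fun h => h1 h.of_σ
    by_cases h2 : f.Collapsed (Γ.σ A) ∧ f.Far (Γ.σ A) Z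
    · exact sees_subset h1' h2.2 h2.1 hZ hB
    · exfalso
      refine sees_disjoint h1' (fun hA hfar => h2 ⟨hA, hfar⟩) (Ne.symm hZY) hZ hsZ ?_
      rw [hst]
      exact f.sees_st _

lemma not_cyc_of_not_collapsed_σ {A Z : Γ.H} (hσ : ¬ f.Collapsed (Γ.σ A)) (hZ : f.Collapsed Z)
    (hst : f.st Z = f.st (Γ.σ A)) :
    ¬ Cyc (Δ.pos (f.st Z)) (Δ.pos (f.st (Γ.i Z))) (Δ.pos (f.st A)) := by
  intro hcyc
  obtain ⟨B, C, hne, hB, hC⟩ := exists_two_sees hZ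
  obtain ⟨D, hD⟩ := f.exists_lift_of_not_collapsed hσ
  have h1 := sees_σ_of_sees hZ hst hcyc hB
  have h2 := sees_σ_of_sees hZ hst hcyc hC
  rw [hD, sees_lift_iff] at h1 h2
  exact hne (h1.trans h2.symm)

/-- Together with `cyc_st_σ` this says that `σ A` gives the farthest diagonal from `st (σ A)` that
ends before `st A`, which is the rule `Dissection.IsNext` for the cyclic order of an expansion. -/
lemma farthest_σ {A Z : Γ.H} (hσ : f.Collapsed (Γ.σ A)) (hZ : f.Collapsed Z)
    (hst : f.st Z = f.st (Γ.σ A))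
    (hcyc : Cyc (Δ.pos (f.st Z)) (Δ.pos (f.st (Γ.i Z))) (Δ.pos (f.st A)))
    (hne : f.st (Γ.i Z) ≠ f.st (Γ.i (Γ.σ A))) :
    Cyc (Δ.pos (f.st Z)) (Δ.pos (f.st (Γ.i Z))) (Δ.pos (f.st (Γ.i (Γ.σ A)))) := by
  by_contra hcon
  have hs : Δ.s (f.st (Γ.i (Γ.σ A))) = Δ.s (f.st Z) := by rw [s_st_i hσ, hst]
  have h1 := pos_ne hne ((s_st_i hZ).trans hs.symm)
  have h2 := pos_ne hZ.st_ne (s_st_i hZ).symm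
  have h3 := pos_ne hσ.st_ne (s_st_i hσ).symm
  rw [← hst] at h3
  refine not_sees_st_i hσ (sees_σ_of_sees hZ hst hcyc (((sees_isArc hZ).2 _ hs).2 (Or.inr ?_)))
  unfold Cyc at *
  omega

end Hom

end LeafedFatGraph

/-! ### Dissections -/

namespace LeafedFatGraph

variable {Γ : LeafedFatGraph}

lemma pos_ne_pos {A B : Γ.H} (h : A ≠ B) (hs : Γ.s A = Γ.s B) : Γ.pos A ≠ Γ.pos B :=
  fun h' => h (Γ.eq_of_pos_eq hs h')

lemma not_cyc_σ {A B : Γ.H} (hs : Γ.s B = Γ.s A) :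
    ¬ Cyc (Γ.pos (Γ.σ A)) (Γ.pos A) (Γ.pos B) := by
  have h1 := Γ.pos_σ A
  have h2 := Γ.pos_lt B
  have h3 := Γ.pos_lt A
  rw [hs] at h2
  unfold Cyc
  split_ifs at h1 <;> omega

lemma eq_of_σ_eq_self {A B : Γ.H} (h : Γ.σ A = A) (hs : Γ.s A = Γ.s B) : B = A :=
  forall_of_σ (P := fun B => B = A) (fun C hC => by rw [hC, h]) hs rfl

/-- A dissection of the polygons dual to the vertices of a fat graph: a set of pairwise
non-crossing diagonals, each of which is recorded with both orientations by the half-edges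
following its two ends. -/
@[ext]
structure Dissection (Γ : LeafedFatGraph) where
  rel : Γ.H → Γ.H → Prop
  symm : ∀ {b c}, rel b c → rel c b
  s_eq : ∀ {b c}, rel b c → Γ.s b = Γ.s c
  ne : ∀ {b c}, rel b c → b ≠ c
  ne_σ : ∀ {b c}, rel b c → c ≠ Γ.σ b
  noncrossing : ∀ {b c b' c'}, rel b c → rel b' c' → Γ.s b = Γ.s b' →
    Cyc (Γ.pos b) (Γ.pos b') (Γ.pos c) → Cyc (Γ.pos c) (Γ.pos c') (Γ.pos b) → False

namespace Dissection

variable (D : Dissection Γ)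

/-- The half-edges of the expansion of a fat graph along a dissection. -/
abbrev HalfEdge := Γ.H ⊕ {x : Γ.H × Γ.H // D.rel x.1 x.2}

variable {D}

/-- The first end of a half-edge of the expansion. -/
def start : D.HalfEdge → Γ.H := Sum.elim id (fun x => x.1.1)

/-- The second end of a half-edge of the expansion. -/
def finish : D.HalfEdge → Γ.H := Sum.elim Γ.σ (fun x => x.1.2)

/-- The involution of the expansion. -/
def flip : D.HalfEdge → D.HalfEdge :=
  Sum.map Γ.i (fun x => ⟨(x.1.2, x.1.1), D.symm x.2⟩)

lemma flip_flip (X : D.HalfEdge) : flip (flip X) = X := by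
  rcases X with B | x
  · simp [flip, Γ.i_i]
  · rfl

lemma flip_ne (X : D.HalfEdge) : flip X ≠ X := by
  rcases X with B | x
  · simp [flip, Γ.i_ne]
  · intro h
    have h1 : x.1.2 = x.1.1 := congrArg start h
    exact D.ne x.2 h1.symm

lemma s_finish (X : D.HalfEdge) : Γ.s (finish X) = Γ.s (start X) := by
  rcases X with B | x
  · exact Γ.s_σ B
  · exact (D.s_eq x.2).symm

/-- `Y` is the next half-edge in the cyclic order of the expansion. -/
def IsNext (X Y : D.HalfEdge) : Prop :=
  (Y = Sum.inl (finish X) ∧ ∀ d, D.rel (finish X) d →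
    ¬ Cyc (Γ.pos (finish X)) (Γ.pos d) (Γ.pos (start X))) ∨
  ∃ d, ∃ h : D.rel (finish X) d, Y = Sum.inr ⟨(finish X, d), h⟩ ∧
    Cyc (Γ.pos (finish X)) (Γ.pos d) (Γ.pos (start X)) ∧
    ∀ d', D.rel (finish X) d' → Cyc (Γ.pos (finish X)) (Γ.pos d') (Γ.pos (start X)) →
      d' = d ∨ Cyc (Γ.pos (finish X)) (Γ.pos d') (Γ.pos d)

lemma IsNext.start_eq {X Y : D.HalfEdge} (h : IsNext X Y) : start Y = finish X := by
  rcases h with ⟨rfl, -⟩ | ⟨d, h, rfl, -⟩ <;> rfl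

lemma IsNext.unique {X Y Z : D.HalfEdge} (hY : IsNext X Y) (hZ : IsNext X Z) : Y = Z := by
  rcases hY with ⟨rfl, h1⟩ | ⟨d, hd, rfl, h2, h3⟩
  · rcases hZ with ⟨rfl, -⟩ | ⟨d', hd', rfl, h2', -⟩
    · rfl
    · exact absurd h2' (h1 _ hd')
  · rcases hZ with ⟨rfl, h1⟩ | ⟨d', hd', rfl, h2', h3'⟩
    · exact absurd h2 (h1 _ hd)
    · rcases h3 d' hd' h2' with rfl | h4
      · rfl
      · rcases h3' d hd h2 with rfl | h5
        · rfl
        · exfalso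
          unfold Cyc at *
          omega

lemma exists_isNext (X : D.HalfEdge) : ∃ Y, IsNext X Y := by
  by_cases h : ∃ d, D.rel (finish X) d ∧ Cyc (Γ.pos (finish X)) (Γ.pos d) (Γ.pos (start X))
  · obtain ⟨d, ⟨hd1, hd2⟩, hmax⟩ := Set.exists_max_image
      {d | D.rel (finish X) d ∧ Cyc (Γ.pos (finish X)) (Γ.pos d) (Γ.pos (start X))}
      (Γ.offset (finish X)) (Set.toFinite _) h
    refine ⟨Sum.inr ⟨(finish X, d), hd1⟩, Or.inr ⟨d, hd1, rfl, hd2, fun d' hd' hc => ?_⟩⟩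
    by_cases hdd : d' = d
    · exact Or.inl hdd
    · right
      have h1 := hmax d' ⟨hd', hc⟩
      have h2 := pos_ne_pos hdd ((D.s_eq hd').symm.trans (D.s_eq hd1))
      have h3 := Γ.pos_lt d
      have h4 := Γ.pos_lt d'
      have h5 := Γ.pos_lt (finish X)
      rw [← D.s_eq hd1] at h3
      rw [← D.s_eq hd'] at h4
      unfold offset at h1
      unfold Cyc at *
      split_ifs at h1 <;> omega
  · exact ⟨Sum.inl (finish X), Or.inl ⟨rfl, fun d hd hc => h ⟨d, hd, hc⟩⟩⟩

lemma start_eq_of_finish_eq_start {X X' : D.HalfEdge} (h : start X = finish X)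
    (hs : finish X = finish X') : start X' = start X := by
  rcases X with B | x
  · refine eq_of_σ_eq_self h.symm ?_
    rw [← s_finish X', ← hs]
    exact (Γ.s_σ B).symm
  · exact absurd h (D.ne x.2)

/-- Both half-edges end at the same place. If they start at different places, neither start can
precede the other after the common end: an original half-edge leaves no room there, and a reversed
diagonal would be an admissible successor of the other half-edge, farther than the common one. -/
lemma IsNext.injective {X X' Y : D.HalfEdge} (h : IsNext X Y) (h' : IsNext X' Y) : X = X' := by
  have hfin : finish X = finish X' := h.start_eq.symm.trans h'.start_eq
  have hss : Γ.s (start X) = Γ.s (start X') := by rw [← s_finish, hfin, s_finish]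
  have key : ∀ {X X' : D.HalfEdge}, finish X = finish X' → IsNext X Y → IsNext X' Y →
      Γ.s (start X) = Γ.s (start X') →
      ¬ Cyc (Γ.pos (finish X)) (Γ.pos (start X')) (Γ.pos (start X)) := by
    intro X X' hfin h h' hss hc
    rcases X' with B' | ⟨⟨b', c'⟩, hr⟩
    · rw [hfin] at hc
      exact not_cyc_σ hss hc
    · change finish X = c' at hfin
      change Cyc _ (Γ.pos b') _ at hc
      have hr' : D.rel (finish X) b' := hfin ▸ D.symm hr
      rcases h with ⟨-, h1⟩ | ⟨d, hd, hY, h2, h3⟩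
      · exact h1 _ hr' hc
      · rcases h' with ⟨hY', -⟩ | ⟨d', hd', hY', h2', -⟩
        · rw [hY] at hY'
          cases hY'
        · have hdd : d' = d := by
            have h4 := hY.symm.trans hY'
            have h5 := congrArg (fun x => x.1.2) (Sum.inr_injective h4)
            exact h5.symm
          subst hdd
          change Cyc (Γ.pos c') (Γ.pos d') (Γ.pos b') at h2'
          rw [hfin] at h3 hc
          rcases h3 b' (hfin ▸ hr') hc with rfl | h6
          · unfold Cyc at h2'
            omega
          · unfold Cyc at *
            omega
  have hstart : start X = start X' := by
    by_cases h1 : start X = finish X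
    · exact (start_eq_of_finish_eq_start h1 hfin).symm
    by_cases h2 : start X' = finish X'
    · exact start_eq_of_finish_eq_start h2 hfin.symm
    by_contra hne
    have k1 := key hfin h h' hss
    have k2 := key hfin.symm h' h hss.symm
    rw [← hfin] at k2 h2
    have p1 := pos_ne_pos h1 (s_finish X).symm
    have p2 := pos_ne_pos h2 (hss.symm.trans (s_finish X).symm)
    have p3 := pos_ne_pos hne hss
    unfold Cyc at *
    omega
  rcases X with B | ⟨⟨b, c⟩, hr⟩
  · rcases X' with B' | ⟨⟨b', c'⟩, hr'⟩
    · exact congrArg Sum.inl hstart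
    · change B = b' at hstart
      change Γ.σ B = c' at hfin
      subst hstart hfin
      exact absurd rfl (D.ne_σ hr')
  · rcases X' with B' | ⟨⟨b', c'⟩, hr'⟩
    · change b = B' at hstart
      change c = Γ.σ B' at hfin
      subst hstart hfin
      exact absurd rfl (D.ne_σ hr)
    · change b = b' at hstart
      change c = c' at hfin
      subst hstart hfin
      rfl

/-- The next half-edge in the cyclic order of the expansion. -/
noncomputable def next (X : D.HalfEdge) : D.HalfEdge := (exists_isNext X).choose

lemma isNext_next (X : D.HalfEdge) : IsNext X (next X) := (exists_isNext X).choose_spec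

variable (D)

/-- The cyclic orders of the expansion. -/
noncomputable def perm : Equiv.Perm D.HalfEdge :=
  Equiv.ofBijective next (Finite.injective_iff_bijective.1 fun X X' h =>
    (isNext_next X).injective (h ▸ isNext_next X'))

variable {D}

lemma isNext_perm (X : D.HalfEdge) : IsNext X (D.perm X) := isNext_next X

lemma perm_eq {X Y : D.HalfEdge} (h : IsNext X Y) : D.perm X = Y := (isNext_perm X).unique h

lemma start_perm (X : D.HalfEdge) : start (D.perm X) = finish X := (isNext_perm X).start_eq

lemma s_start_perm (X : D.HalfEdge) : Γ.s (start (D.perm X)) = Γ.s (start X) := by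
  rw [start_perm, s_finish]

lemma perm_ne {X : D.HalfEdge} (h : 3 ≤ Γ.val (Γ.s (start X))) : D.perm X ≠ X := by
  intro h1
  have h2 := start_perm X
  rw [h1] at h2
  rcases X with B | x
  · exact Γ.σ_ne_self h h2.symm
  · exact D.ne x.2 h2

lemma perm_perm_ne {X : D.HalfEdge} (h : 3 ≤ Γ.val (Γ.s (start X))) :
    D.perm (D.perm X) ≠ X := by
  intro h1
  have h2 := start_perm (D.perm X)
  rw [h1] at h2
  rcases isNext_perm X with ⟨h3, -⟩ | ⟨d, hd, h3, h4, -⟩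
  · rw [h3] at h2
    rcases X with B | x
    · exact Γ.σ_σ_ne_self h h2.symm
    · exact D.ne_σ (D.symm x.2) h2
  · rw [h3] at h2
    change start X = d at h2
    rw [h2] at h4
    unfold Cyc at h4
    omega

lemma eq_inl_of_s_start {X : D.HalfEdge} {j : Fin Γ.n} (h : Γ.s (start X) = Γ.leaf j) :
    X = Sum.inl (start X) := by
  rcases X with B | x
  · rfl
  · exact absurd (Γ.eq_of_s_leaf h ((D.s_eq x.2).symm.trans h)) (D.ne x.2)

/-- Starting from a half-edge and turning around its first end, one arrives at the half-edge of
the original graph. -/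
lemma start_of_closed {P : D.HalfEdge → Prop} (h1 : ∀ X, P X → P (D.perm X))
    (h2 : ∀ x, P (Sum.inr x) → P (flip (Sum.inr x))) {X : D.HalfEdge} (hX : P X) :
    P (Sum.inl (start X)) := by
  -- The measure is the number of steps from the first end of the diagonal to the second; turning
  -- around the first end leads to a shorter diagonal or to the original half-edge.
  generalize hn : (match X with | Sum.inl _ => 0 | Sum.inr x => Γ.offset x.1.1 x.1.2) = n
  induction n using Nat.strong_induction_on generalizing X with
  | _ n ih =>
    rcases X with B | ⟨⟨b, c⟩, hr⟩
    · exact hX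
    · have h3 : P (D.perm (flip (Sum.inr ⟨(b, c), hr⟩))) := h1 _ (h2 _ hX)
      rcases isNext_perm (flip (D := D) (Sum.inr ⟨(b, c), hr⟩)) with ⟨h4, -⟩ | ⟨d, hd, h4, h5, -⟩
      · rw [h4] at h3
        exact h3
      · rw [h4] at h3
        change D.rel b d at hd
        change Cyc (Γ.pos b) (Γ.pos d) (Γ.pos c) at h5
        refine ih (Γ.offset b d) ?_ (X := Sum.inr ⟨(b, d), hd⟩) h3 rfl
        change Γ.offset b c = n at hn
        have k1 := Γ.pos_lt b
        have k2 := Γ.pos_lt c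
        have k3 := Γ.pos_lt d
        rw [← D.s_eq hr] at k2
        rw [← D.s_eq hd] at k3
        unfold offset at *
        unfold Cyc at h5
        split_ifs at * <;> omega

/-- The complement of the property is closed under the same moves, because the successor is a
permutation of finite order and the flip an involution. -/
lemma of_start_of_closed {P : D.HalfEdge → Prop} (h1 : ∀ X, P X → P (D.perm X))
    (h2 : ∀ x, P (Sum.inr x) → P (flip (Sum.inr x))) {X : D.HalfEdge}
    (hX : P (Sum.inl (start X))) : P X := by
  by_contra hcon
  refine start_of_closed (P := fun X => ¬ P X) ?_ ?_ hcon hX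
  · exact fun X hX hP => hX (D.perm.mem_of_map_mem h1 hP)
  · intro x hx hP
    have := h2 _ hP
    exact hx this

/-- Connectedness of the expansion, reduced to that of `Γ`: every half-edge is joined to the
original one at its start, and the original ones are joined as in `Γ`. -/
lemma forall_of_closed {P : D.HalfEdge → Prop} (h1 : ∀ X, P X → P (D.perm X))
    (h2 : ∀ X, P X → P (flip X)) {X : D.HalfEdge} (hX : P X) (Y : D.HalfEdge) : P Y := by
  have h3 : ∀ B, P (Sum.inl B) → P (Sum.inl (Γ.σ B)) := fun B hB => by
    have := start_of_closed h1 (fun x => h2 _) (h1 _ hB)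
    rwa [start_perm] at this
  refine of_start_of_closed h1 (fun x => h2 _) ?_
  have key : ∀ v, Γ.Walk Set.univ (Γ.s (start X)) v → ∀ B, Γ.s B = v → P (Sum.inl B) := by
    intro v hv
    induction hv with
    | refl =>
      exact fun B hB => forall_of_σ (P := fun B => P (Sum.inl B)) h3 hB.symm
        (start_of_closed h1 (fun x => h2 _) hX)
    | tail _ h ih =>
      obtain ⟨A, -, rfl, rfl⟩ := h
      exact fun B hB => forall_of_σ (P := fun B => P (Sum.inl B)) h3 hB.symm
        (h2 _ (ih A rfl))
  exact key _ (Γ.connected.walk _ _ trivial trivial) _ rfl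

variable (D)

/-- The vertices of the expansion. -/
abbrev Vertex := Quotient (Equiv.Perm.SameCycle.setoid D.perm)

/-- The vertex of a half-edge of the expansion. -/
noncomputable def vertex (X : D.HalfEdge) : D.Vertex := Quotient.mk _ X

variable {D}

lemma vertex_eq {X Y : D.HalfEdge} : D.vertex X = D.vertex Y ↔ D.perm.SameCycle X Y :=
  Quotient.eq (r := Equiv.Perm.SameCycle.setoid D.perm)

lemma vertex_perm (X : D.HalfEdge) : D.vertex (D.perm X) = D.vertex X :=
  vertex_eq.2 (Equiv.Perm.sameCycle_apply_left.2 (Equiv.Perm.SameCycle.refl _ _))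

lemma s_start_of_vertex_eq {X Y : D.HalfEdge} (h : D.vertex X = D.vertex Y) :
    Γ.s (start X) = Γ.s (start Y) := by
  obtain ⟨n, -, rfl⟩ := (vertex_eq.1 h).exists_pow_eq'
  clear h
  induction n with
  | zero => rfl
  | succ n ih => rw [pow_succ', Equiv.Perm.mul_apply, s_start_perm, ih]

lemma eq_of_vertex_eq_of_leaf {X Y : D.HalfEdge} {j : Fin Γ.n} (h : D.vertex X = D.vertex Y)
    (hX : Γ.s (start X) = Γ.leaf j) : X = Y := by
  have hY := (s_start_of_vertex_eq h).symm.trans hX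
  rw [eq_inl_of_s_start hX, eq_inl_of_s_start hY, Γ.eq_of_s_leaf hX hY]

variable (D)

instance : Finite D.Vertex := Quotient.finite _

/-- The combinatorial graph underlying the expansion. -/
noncomputable def combGraph : CombGraph where
  V := D.Vertex
  H := D.HalfEdge
  finV := inferInstance
  finH := inferInstance
  s := D.vertex
  i := flip
  i_i := flip_flip
  i_ne := flip_ne

/-- The expansion of a fat graph along a dissection: every vertex is replaced by the planar tree
dual to the dissection of its polygon. -/
noncomputable def expand : LeafedFatGraph where
  toCombGraph := D.combGraph
  connected :=
    { s_mem := fun _ _ => trivial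
      i_mem := fun _ _ => trivial
      nonempty := ⟨D.vertex (Sum.inl (Γ.baseAt (Γ.leaf ⟨0, Γ.n_pos⟩))), trivial⟩
      walk := by
        intro u v _ _
        obtain ⟨X, rfl⟩ := Quotient.exists_rep u
        obtain ⟨Y, rfl⟩ := Quotient.exists_rep v
        refine forall_of_closed (D := D)
          (P := fun Y => D.combGraph.Walk Set.univ (D.vertex X) (D.vertex Y)) ?_ ?_
          (X := X) .refl Y
        · intro Y hY
          rwa [vertex_perm]
        · intro Y hY
          exact hY.tail ⟨Y, trivial, rfl, rfl⟩ }
  σ := D.perm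
  s_σ := vertex_perm
  cyclic _ _ h := vertex_eq.1 h
  n := Γ.n
  n_pos := Γ.n_pos
  leaf j := D.vertex (Sum.inl (Γ.baseAt (Γ.leaf j)))
  leaf_injective j j' h := by
    have := s_start_of_vertex_eq h
    change Γ.s (Γ.baseAt _) = Γ.s (Γ.baseAt _) at this
    rw [s_baseAt, s_baseAt] at this
    exact Γ.leaf_injective this
  val_leaf j := by
    refine Nat.card_eq_one_iff_unique.2 ⟨⟨fun X Y => Subtype.ext ?_⟩, ⟨⟨_, rfl⟩⟩⟩
    have h : Γ.s (start (D := D) (Sum.inl (Γ.baseAt (Γ.leaf j)))) = Γ.leaf j := Γ.s_baseAt _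
    exact (eq_of_vertex_eq_of_leaf X.2.symm h).symm.trans (eq_of_vertex_eq_of_leaf Y.2.symm h)
  three_le_val v hv := by
    obtain ⟨X, rfl⟩ := Quotient.exists_rep v
    have hX : 3 ≤ Γ.val (Γ.s (start X)) := by
      refine Γ.three_le_val _ fun ⟨j, hj⟩ => hv ⟨j, ?_⟩
      refine congrArg D.vertex ((congrArg Sum.inl ?_).trans (eq_inl_of_s_start hj.symm).symm)
      exact Γ.eq_of_s_leaf (Γ.s_baseAt (Γ.leaf j)) hj.symm
    have e1 := perm_ne hX
    have e2 := perm_perm_ne hX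
    have hmem : ∀ k : Fin 3, D.vertex (![X, D.perm X, D.perm (D.perm X)] k) = D.vertex X := by
      intro k
      fin_cases k
      · rfl
      · exact vertex_perm X
      · exact (vertex_perm _).trans (vertex_perm X)
    refine (Nat.card_fin 3).symm.le.trans (Nat.card_le_card_of_injective
      (β := {Y : D.HalfEdge // D.vertex Y = D.vertex X})
      (fun k => ⟨_, hmem k⟩) ?_)
    intro k l h
    have h := congrArg Subtype.val h
    fin_cases k <;> fin_cases l <;> simp at h ⊢
    · exact e1 h.symm
    · exact e2 h.symm
    · exact e1 h
    · exact e1 h.symm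
    · exact e2 h
    · exact e1 h

end Dissection

end LeafedFatGraph

/-! ### Constructing trees and morphisms -/

namespace CombGraph

variable {G : CombGraph}

lemma isTree_of_unique {S : Set G.Elt} {v : G.V} (hV : ∀ u, Sum.inl u ∈ S ↔ u = v)
    (hH : ∀ A, Sum.inr A ∉ S) : G.IsTree S where
  s_mem := by
    rintro (u | A) h
    · exact h
    · exact absurd h (hH A)
  i_mem := by
    rintro (u | A) h
    · exact h
    · exact absurd h (hH A)
  nonempty := ⟨v, (hV v).2 rfl⟩
  walk a b ha hb := by
    rw [hV] at ha hb
    rw [ha, hb]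
    exact .refl
  euler := by
    have h1 : Nat.card {A : G.H // Sum.inr A ∈ S} = 0 := by
      rw [Nat.card_eq_zero]
      exact Or.inl ⟨fun A => hH A.1 A.2⟩
    have h2 : Nat.card {u : G.V // Sum.inl u ∈ S} = 1 :=
      Nat.card_eq_one_iff_unique.2 ⟨⟨fun a b => Subtype.ext
        (((hV _).1 a.2).trans ((hV _).1 b.2).symm)⟩, ⟨⟨v, (hV v).2 rfl⟩⟩⟩
    rw [h1, h2]

lemma isTree_of_edge {S : Set G.Elt} {A : G.H} (hA : G.s A ≠ G.s (G.i A))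
    (hV : ∀ u, Sum.inl u ∈ S ↔ u = G.s A ∨ u = G.s (G.i A))
    (hH : ∀ X, Sum.inr X ∈ S ↔ X = A ∨ X = G.i A) : G.IsTree S where
  s_mem := by
    rintro (u | X) h
    · exact h
    · rw [hH] at h
      refine (hV _).2 ?_
      rcases h with rfl | rfl
      · exact Or.inl rfl
      · exact Or.inr rfl
  i_mem := by
    rintro (u | X) h
    · exact h
    · rw [hH] at h
      refine (hH _).2 ?_
      rcases h with rfl | rfl
      · exact Or.inr rfl
      · exact Or.inl (G.i_i _)
  nonempty := ⟨_, (hV _).2 (Or.inl rfl)⟩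
  walk a b ha hb := by
    have h1 : G.Walk S (G.s A) (G.s (G.i A)) := .single ⟨A, (hH _).2 (Or.inl rfl), rfl, rfl⟩
    have h2 : G.Walk S (G.s (G.i A)) (G.s A) :=
      .single ⟨G.i A, (hH _).2 (Or.inr rfl), rfl, by rw [G.i_i]⟩
    rw [hV] at ha hb
    rcases ha with rfl | rfl <;> rcases hb with rfl | rfl
    · exact .refl
    · exact h1
    · exact h2
    · exact .refl
  euler := by
    have h1 : Nat.card {u : G.V // Sum.inl u ∈ S} = 2 := by
      rw [Nat.card_congr (Equiv.subtypeEquivRight hV)]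
      exact Set.ncard_pair hA
    have h2 : Nat.card {X : G.H // Sum.inr X ∈ S} = 2 := by
      rw [Nat.card_congr (Equiv.subtypeEquivRight hH)]
      exact Set.ncard_pair (G.i_ne A).symm
    rw [h1, h2]

end CombGraph

namespace LeafedFatGraph

namespace Hom

variable {Γ Δ Λ : LeafedFatGraph}

lemma not_collapsed_iff {f : Hom Γ Δ} {A : Γ.H} : ¬ f.Collapsed A ↔ ∃ B, A = f.lift B := by
  refine ⟨f.exists_lift_of_not_collapsed, ?_⟩
  rintro ⟨B, rfl⟩
  exact f.not_collapsed_lift B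

/-- The lifts tell which half-edges are collapsed; this determines the boundary walks and, through
`st`, the map on vertices. -/
lemma ext_lift {f g : Hom Γ Δ} (h : ∀ B, f.lift B = g.lift B) : f = g := by
  have hc : ∀ A, f.Collapsed A ↔ g.Collapsed A := fun A => by
    rw [← not_iff_not, not_collapsed_iff, not_collapsed_iff]
    simp only [h]
  have hr : ∀ A B, f.Reach A B → g.Reach A B := by
    intro A B hAB
    induction hAB with
    | base B => rw [h]; exact .base B
    | step A B hA _ ih => exact .step A B ((hc A).1 hA) ih
  have hst : ∀ A, f.st A = g.st A := fun A => (hr _ _ (f.reach_st A)).unique (g.reach_st A)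
  have hV : ∀ A, f.onV (Γ.s A) = g.onV (Γ.s A) := fun A => by rw [← s_st, ← s_st, hst]
  refine Hom.ext (funext fun x => ?_)
  rcases x with v | A
  · obtain ⟨A, rfl⟩ := Γ.exists_half_edge v
    rw [f.inl_onV, g.inl_onV, hV]
  · by_cases hA : f.Collapsed A
    · rw [hA.map, ((hc A).1 hA).map, hV]
    · obtain ⟨B, rfl⟩ := f.exists_lift_of_not_collapsed hA
      rw [f.map_lift, h, g.map_lift]

lemma lift_comp (f : Γ ⟶ Δ) (g : Δ ⟶ Λ) (C : Λ.H) :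
    Hom.lift (f ≫ g) C = Hom.lift f (Hom.lift g C) := by
  refine (Hom.eq_lift (f ≫ g) ?_).symm
  rw [toFun_comp, Hom.map_lift, Hom.map_lift]

lemma lift_id (A : Γ.H) : Hom.lift (𝟙 Γ) A = A := (Hom.eq_lift (𝟙 Γ) rfl).symm

end Hom

/-! ### Isomorphisms from bijections of half-edges -/

section OfEquiv

variable {Γ Δ : LeafedFatGraph}

lemma s_congr {e : Γ.H ≃ Δ.H} (hσ : ∀ A, e (Γ.σ A) = Δ.σ (e A)) {A B : Γ.H}
    (h : Γ.s A = Γ.s B) : Δ.s (e A) = Δ.s (e B) :=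
  (forall_of_σ (P := fun B => Δ.s (e B) = Δ.s (e A)) (fun X hX => by rw [hσ, Δ.s_σ, hX])
    h rfl).symm

lemma symm_comm {α β : Type*} (e : α ≃ β) {φ : α → α} {ψ : β → β} (h : ∀ a, e (φ a) = ψ (e a))
    (b : β) : e.symm (ψ b) = φ (e.symm b) := by
  rw [Equiv.symm_apply_eq, h, e.apply_symm_apply]

/-- The morphism given by a bijection between the half-edges. -/
noncomputable def homOfEquiv (e : Γ.H ≃ Δ.H) (hi : ∀ A, e (Γ.i A) = Δ.i (e A))
    (hσ : ∀ A, e (Γ.σ A) = Δ.σ (e A)) (hn : Γ.n = Δ.n)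
    (hleaf : ∀ j A, Γ.s A = Γ.leaf j → Δ.s (e A) = Δ.leaf (Fin.cast hn j)) : Γ ⟶ Δ where
  toFun := Sum.elim (fun v => Sum.inl (Δ.s (e (Γ.baseAt v)))) (fun A => Sum.inr (e A))
  map_s := by
    rintro (v | A)
    · rfl
    · exact congrArg Sum.inl (s_congr hσ (Γ.s_baseAt _))
  map_i := by
    rintro (v | A)
    · rfl
    · exact congrArg Sum.inr (hi A)
  tree w := by
    obtain ⟨B, rfl⟩ := Δ.exists_half_edge w
    refine CombGraph.isTree_of_unique (v := Γ.s (e.symm B)) (fun u => ?_) (fun A h => ?_)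
    · change Sum.inl _ = Sum.inl _ ↔ _
      rw [Sum.inl.injEq]
      constructor
      · intro h
        have := s_congr (e := e.symm) (symm_comm e hσ) h
        rwa [e.symm_apply_apply, s_baseAt] at this
      · rintro rfl
        rw [s_congr hσ (Γ.s_baseAt _), e.apply_symm_apply]
    · cases (show Sum.inr _ = Sum.inl _ from h)
  single B := ⟨e.symm B, by simp, fun A hA => by
    rw [Equiv.eq_symm_apply]
    exact Sum.inr_injective hA⟩
  map_ω A B h := by
    obtain rfl := Sum.inr_injective h
    refine ⟨1, one_pos, ?_, fun j h1 h2 => by omega⟩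
    change Sum.inr (e (Γ.σ (Γ.i A))) = Sum.inr (Δ.σ (Δ.i (e A)))
    rw [hσ, hi]
  n_eq := hn
  map_leaf j := congrArg Sum.inl (hleaf j _ (Γ.s_baseAt _))

lemma lift_homOfEquiv (e : Γ.H ≃ Δ.H) (hi : ∀ A, e (Γ.i A) = Δ.i (e A))
    (hσ : ∀ A, e (Γ.σ A) = Δ.σ (e A)) (hn : Γ.n = Δ.n)
    (hleaf : ∀ j A, Γ.s A = Γ.leaf j → Δ.s (e A) = Δ.leaf (Fin.cast hn j)) (B : Δ.H) :
    Hom.lift (homOfEquiv e hi hσ hn hleaf) B = e.symm B :=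
  (Hom.eq_lift _ (congrArg Sum.inr (e.apply_symm_apply B))).symm

/-- The isomorphism given by a bijection between the half-edges. -/
noncomputable def isoOfEquiv (e : Γ.H ≃ Δ.H) (hi : ∀ A, e (Γ.i A) = Δ.i (e A))
    (hσ : ∀ A, e (Γ.σ A) = Δ.σ (e A)) (hn : Γ.n = Δ.n)
    (hleaf : ∀ j A, Γ.s A = Γ.leaf j → Δ.s (e A) = Δ.leaf (Fin.cast hn j)) : Γ ≅ Δ where
  hom := homOfEquiv e hi hσ hn hleaf
  inv := homOfEquiv e.symm (symm_comm e hi) (symm_comm e hσ) hn.symm (by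
    intro j B hB
    have h1 : Δ.s (e (Γ.baseAt (Γ.leaf (Fin.cast hn.symm j)))) = Δ.leaf j :=
      hleaf _ _ (Γ.s_baseAt _)
    rw [Δ.eq_of_s_leaf hB h1, e.symm_apply_apply, s_baseAt])
  hom_inv_id := Hom.ext_lift fun A => by
    rw [Hom.lift_comp, lift_homOfEquiv, lift_homOfEquiv, Hom.lift_id]
    simp
  inv_hom_id := Hom.ext_lift fun A => by
    rw [Hom.lift_comp, lift_homOfEquiv, lift_homOfEquiv, Hom.lift_id]
    simp

lemma lift_isoOfEquiv (e : Γ.H ≃ Δ.H) (hi : ∀ A, e (Γ.i A) = Δ.i (e A))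
    (hσ : ∀ A, e (Γ.σ A) = Δ.σ (e A)) (hn : Γ.n = Δ.n)
    (hleaf : ∀ j A, Γ.s A = Γ.leaf j → Δ.s (e A) = Δ.leaf (Fin.cast hn j)) (B : Δ.H) :
    Hom.lift (isoOfEquiv e hi hσ hn hleaf).hom B = e.symm B :=
  lift_homOfEquiv e hi hσ hn hleaf B

end OfEquiv

/-! ### Collapsing a single edge -/

section CollapseEdge

variable {Γ Δ : LeafedFatGraph}

/-- Collapsing one edge is a morphism. -/
lemma exists_hom_of_collapse_edge {A : Γ.H} (hA : Γ.s A ≠ Γ.s (Γ.i A)) (hA1 : Γ.σ A ≠ A)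
    (hA2 : Γ.σ (Γ.i A) ≠ Γ.i A) (e : Δ.H → Γ.H) (he : Function.Injective e)
    (hrange : ∀ X, (∃ B, e B = X) ↔ X ≠ A ∧ X ≠ Γ.i A) (hi : ∀ B, e (Δ.i B) = Γ.i (e B))
    (hσ : ∀ B, Γ.σ (e B) ≠ A → Γ.σ (e B) ≠ Γ.i A → e (Δ.σ B) = Γ.σ (e B))
    (hσ1 : ∀ B, Γ.σ (e B) = A → e (Δ.σ B) = Γ.σ (Γ.i A))
    (hσ2 : ∀ B, Γ.σ (e B) = Γ.i A → e (Δ.σ B) = Γ.σ A) (hn : Γ.n = Δ.n)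
    (hleaf : ∀ j, ∃ B, Γ.s (e B) = Γ.leaf j ∧ Δ.s B = Δ.leaf (Fin.cast hn j)) :
    ∃ f : Hom Γ Δ, ∀ B, f.toFun (Sum.inr (e B)) = Sum.inr B := by
  classical
  have hne := Γ.i_ne A
  have hsA : Γ.σ A ≠ Γ.i A := fun h => hA (by rw [← h, Γ.s_σ])
  have hsiA : Γ.σ (Γ.i A) ≠ A := fun h => hA (by
    have := Γ.s_σ (Γ.i A)
    rwa [h] at this)
  have he1 : ∀ B, e B ≠ A := fun B => ((hrange _).1 ⟨B, rfl⟩).1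
  have he2 : ∀ B, e B ≠ Γ.i A := fun B => ((hrange _).1 ⟨B, rfl⟩).2
  -- The function `q` plays the role of `st`: a collapsed half-edge goes to the first surviving one
  -- on its boundary walk, which is the next one because neither end of the edge is univalent and
  -- the ends differ.
  have hq : ∀ X, ∃ B, e B = if X = A then Γ.σ (Γ.i A) else if X = Γ.i A then Γ.σ A else X := by
    intro X
    rw [hrange]
    split_ifs with h1 h2
    · exact ⟨hsiA, hA2⟩
    · exact ⟨hA1, hsA⟩
    · exact ⟨h1, h2⟩
  choose q hq using hq
  have hqA : e (q A) = Γ.σ (Γ.i A) := by rw [hq, if_pos rfl]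
  have hqiA : e (q (Γ.i A)) = Γ.σ A := by rw [hq, if_neg hne, if_pos rfl]
  have hqe : ∀ B, q (e B) = B := fun B => he (by rw [hq, if_neg (he1 B), if_neg (he2 B)])
  have hqX : ∀ X, X ≠ A → X ≠ Γ.i A → e (q X) = X := fun X h1 h2 => by
    rw [hq, if_neg h1, if_neg h2]
  -- The ends of the edge become one vertex: rotating from `A` around its source up to the
  -- predecessor of `A`, one meets only half-edges at the target vertex of `q (Γ.i A)`, and the next
  -- step downstairs arrives at `q A`.
  have hmerge : Δ.s (q A) = Δ.s (q (Γ.i A)) := by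
    have key : (Γ.s (Γ.σ.symm A) = Γ.s A) ∧ (Γ.σ.symm A = A ∨
        ∃ B, Γ.σ.symm A = e B ∧ Δ.s B = Δ.s (q (Γ.i A))) := by
      refine forall_of_σ (P := fun X => Γ.s X = Γ.s A ∧ (X = A ∨
        ∃ B, X = e B ∧ Δ.s B = Δ.s (q (Γ.i A)))) ?_ (A := A) ?_ ⟨rfl, Or.inl rfl⟩
      · rintro X ⟨hs, hX⟩
        refine ⟨by rw [Γ.s_σ, hs], ?_⟩
        by_cases h1 : Γ.σ X = A
        · exact Or.inl h1
        right
        rcases hX with rfl | ⟨B, rfl, hB⟩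
        · exact ⟨_, hqiA.symm, rfl⟩
        · refine ⟨Δ.σ B, (hσ B h1 fun h2 => hA ?_).symm, by rw [Δ.s_σ, hB]⟩
          rw [← hs, ← h2, Γ.s_σ]
      · rw [← Γ.s_σ (Γ.σ.symm A), Equiv.apply_symm_apply]
    obtain ⟨-, h | ⟨B, h, hB⟩⟩ := key
    · rw [Equiv.symm_apply_eq] at h
      exact absurd h.symm hA1
    · rw [Equiv.symm_apply_eq] at h
      have h1 := hσ1 B h.symm
      rw [← hqA] at h1
      rw [← he h1, Δ.s_σ, hB]
  have hstep : ∀ X, Δ.s (q (Γ.σ X)) = Δ.s (q X) := by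
    intro X
    by_cases h1 : X = A
    · rw [h1, ← hqiA, hqe, hmerge]
    by_cases h2 : X = Γ.i A
    · rw [h2, ← hqA, hqe, hmerge]
    obtain ⟨B, rfl⟩ := (hrange X).2 ⟨h1, h2⟩
    rw [hqe, ← Δ.s_σ B]
    congr 1
    apply he
    by_cases h3 : Γ.σ (e B) = A
    · rw [hσ1 B h3, h3, hqA]
    by_cases h4 : Γ.σ (e B) = Γ.i A
    · rw [hσ2 B h4, h4, hqiA]
    rw [hσ B h3 h4, hqX _ h3 h4]
  have hqs : ∀ {X Y}, Γ.s X = Γ.s Y → Δ.s (q X) = Δ.s (q Y) := fun {X Y} h =>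
    (forall_of_σ (P := fun Y => Δ.s (q Y) = Δ.s (q X)) (fun Z hZ => by rw [hstep, hZ]) h rfl).symm
  -- Conversely, half-edges at one vertex of the target come from one vertex, or both come from ends
  -- of the collapsed edge.
  have hback : ∀ {B C}, Δ.s B = Δ.s C → Γ.s (e C) = Γ.s (e B) ∨
      ((Γ.s (e C) = Γ.s A ∨ Γ.s (e C) = Γ.s (Γ.i A)) ∧
        (Γ.s (e B) = Γ.s A ∨ Γ.s (e B) = Γ.s (Γ.i A))) := by
    intro B C h
    refine forall_of_σ (P := fun C => Γ.s (e C) = Γ.s (e B) ∨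
      ((Γ.s (e C) = Γ.s A ∨ Γ.s (e C) = Γ.s (Γ.i A)) ∧
        (Γ.s (e B) = Γ.s A ∨ Γ.s (e B) = Γ.s (Γ.i A)))) ?_ h (Or.inl rfl)
    intro C hC
    by_cases h3 : Γ.σ (e C) = A
    · have : Γ.s (e C) = Γ.s A := by rw [← h3, Γ.s_σ]
      rw [hσ1 C h3, Γ.s_σ]
      rw [this] at hC
      right
      refine ⟨Or.inr rfl, ?_⟩
      rcases hC with hC | hC
      · exact Or.inl hC.symm
      · exact hC.2
    by_cases h4 : Γ.σ (e C) = Γ.i A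
    · have : Γ.s (e C) = Γ.s (Γ.i A) := by rw [← h4, Γ.s_σ]
      rw [hσ2 C h4, Γ.s_σ]
      rw [this] at hC
      right
      refine ⟨Or.inl rfl, ?_⟩
      rcases hC with hC | hC
      · exact Or.inr hC.symm
      · exact hC.2
    rwa [hσ C h3 h4, Γ.s_σ]
  let F : Γ.Elt → Δ.Elt := Sum.elim (fun v => Sum.inl (Δ.s (q (Γ.baseAt v))))
    (fun X => if X = A ∨ X = Γ.i A then Sum.inl (Δ.s (q X)) else Sum.inr (q X))
  have hFv : ∀ X, F (Sum.inl (Γ.s X)) = Sum.inl (Δ.s (q X)) := fun X =>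
    congrArg Sum.inl (hqs (Γ.s_baseAt _))
  have hFe : ∀ B, F (Sum.inr (e B)) = Sum.inr B := fun B => by
    change (if _ then _ else _) = _
    rw [if_neg (not_or.2 ⟨he1 B, he2 B⟩), hqe]
  have hFc : ∀ X, X = A ∨ X = Γ.i A → F (Sum.inr X) = Sum.inl (Δ.s (q A)) := fun X hX => by
    change (if _ then _ else _) = _
    rw [if_pos hX]
    rcases hX with rfl | rfl
    · rfl
    · rw [hmerge]
  refine ⟨{ toFun := F
            map_s := ?_
            map_i := ?_
            tree := ?_
            single := ?_
            map_ω := ?_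
            n_eq := hn
            map_leaf := ?_ }, hFe⟩
  · rintro (v | X)
    · rfl
    · change F (Sum.inl (Γ.s X)) = _
      by_cases hX : X = A ∨ X = Γ.i A
      · rw [hFv, hFc X hX]
        rcases hX with rfl | rfl
        · rfl
        · rw [← hmerge]; rfl
      · obtain ⟨B, rfl⟩ := (hrange X).2 (not_or.1 hX)
        rw [hFv, hFe, hqe]
        rfl
  · rintro (v | X)
    · rfl
    · change F (Sum.inr (Γ.i X)) = _
      by_cases hX : X = A ∨ X = Γ.i A
      · rw [hFc X hX, hFc]
        · rfl
        · rcases hX with rfl | rfl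
          · exact Or.inr rfl
          · exact Or.inl (Γ.i_i _)
      · obtain ⟨B, rfl⟩ := (hrange X).2 (not_or.1 hX)
        rw [hFe, ← hi, hFe]
        rfl
  · intro w
    by_cases hw : w = Δ.s (q A)
    · subst hw
      refine CombGraph.isTree_of_edge hA (fun u => ?_) (fun X => ?_)
      · change F (Sum.inl u) = Sum.inl _ ↔ _
        obtain ⟨X, rfl⟩ := Γ.exists_half_edge u
        rw [hFv, Sum.inl.injEq]
        constructor
        · intro h
          by_cases h1 : X = A
          · exact Or.inl (by rw [h1])
          by_cases h2 : X = Γ.i A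
          · exact Or.inr (by rw [h2])
          have := hback h.symm
          rw [hqA, hqX X h1 h2, Γ.s_σ] at this
          tauto
        · rintro (h | h)
          · exact hqs h
          · rw [hmerge]
            exact hqs h
      · change F (Sum.inr X) = Sum.inl _ ↔ _
        constructor
        · intro h
          by_contra hX
          obtain ⟨B, rfl⟩ := (hrange X).2 (not_or.1 hX)
          rw [hFe] at h
          cases h
        · exact hFc X
    · obtain ⟨B, rfl⟩ := Δ.exists_half_edge w
      have hB : ¬ (Γ.s (e B) = Γ.s A ∨ Γ.s (e B) = Γ.s (Γ.i A)) := by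
        rintro (h | h)
        · have := hqs h
          rw [hqe] at this
          exact hw this
        · have := hqs h
          rw [hqe, ← hmerge] at this
          exact hw this
      refine CombGraph.isTree_of_unique (v := Γ.s (e B)) (fun u => ?_) (fun X h => ?_)
      · change F (Sum.inl u) = Sum.inl _ ↔ _
        obtain ⟨X, rfl⟩ := Γ.exists_half_edge u
        rw [hFv, Sum.inl.injEq]
        constructor
        · intro h
          by_cases h1 : X = A
          · exact absurd (by rw [← h, h1]) hw
          by_cases h2 : X = Γ.i A
          · exact absurd (by rw [← h, h2, hmerge]) hw
          have := hback h.symm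
          rw [hqX X h1 h2] at this
          tauto
        · intro h
          have := hqs h
          rwa [hqe] at this
      · have h : F (Sum.inr X) = Sum.inl _ := h
        by_cases hX : X = A ∨ X = Γ.i A
        · rw [hFc X hX, Sum.inl.injEq] at h
          exact hw h.symm
        · obtain ⟨C, rfl⟩ := (hrange X).2 (not_or.1 hX)
          rw [hFe] at h
          cases h
  · intro B
    refine ⟨e B, hFe B, fun X hX => ?_⟩
    replace hX : F (Sum.inr X) = Sum.inr B := hX
    by_cases hX' : X = A ∨ X = Γ.i A
    · rw [hFc X hX'] at hX
      cases hX
    · obtain ⟨C, rfl⟩ := (hrange X).2 (not_or.1 hX')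
      rw [hFe] at hX
      rw [Sum.inr_injective hX]
  · intro X B hX
    have hXe : X = e B := by
      by_cases hX' : X = A ∨ X = Γ.i A
      · rw [hFc X hX'] at hX
        cases hX
      · obtain ⟨C, rfl⟩ := (hrange X).2 (not_or.1 hX')
        rw [hFe] at hX
        rw [Sum.inr_injective hX]
    subst hXe
    have hω : Γ.ω (e B) = Γ.σ (e (Δ.i B)) := by rw [ω_apply, hi]
    -- One collapsed half-edge has to be skipped, or none; so the walk upstairs takes two steps or
    -- one.
    by_cases h : Γ.σ (e (Δ.i B)) = A ∨ Γ.σ (e (Δ.i B)) = Γ.i A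
    · refine ⟨2, two_pos, ?_, fun j h1 h2 => ?_⟩
      · rw [pow_two, Equiv.Perm.mul_apply, hω, ω_apply, ω_apply, ← hFe]
        congr 2
        rcases h with h | h
        · rw [hσ1 _ h, h]
        · rw [hσ2 _ h, h, Γ.i_i]
      · obtain rfl : j = 1 := by omega
        rw [pow_one, hω]
        exact ⟨_, hFc _ h⟩
    · refine ⟨1, one_pos, ?_, fun j h1 h2 => by omega⟩
      rw [pow_one, hω, ← hσ _ (not_or.1 h).1 (not_or.1 h).2, hFe, ω_apply]
  · intro j
    obtain ⟨B, h1, h2⟩ := hleaf j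
    rw [← h1, hFv, hqe, h2]

end CollapseEdge

end LeafedFatGraph

/-! ### The correspondence between morphisms and dissections -/

namespace LeafedFatGraph

variable {Γ : LeafedFatGraph}

namespace Dissection

variable {D D' : Dissection Γ}

/-- A half-edge of the expansion lies on the side of the diagonal `(b, c)` between `b` and `c`. -/
def Beyond (b c : Γ.H) (X : D.HalfEdge) : Prop :=
  Γ.s (start X) = Γ.s b ∧
    (start X = b ∨ start X = c ∨ Cyc (Γ.pos b) (Γ.pos (start X)) (Γ.pos c)) ∧
    (finish X = b ∨ finish X = c ∨ Cyc (Γ.pos b) (Γ.pos (finish X)) (Γ.pos c)) ∧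
    ¬ (start X = b ∧ finish X = c)

/-- Rotation around a vertex of the expansion does not cross the diagonal: the next diagonal does
not cross it, and on arriving at `c` the reversed diagonal from `c` to `b` competes for being the
successor, so the rotation turns back there at the latest. -/
lemma Beyond.perm {b c : Γ.H} (hbc : D.rel b c) {X : D.HalfEdge} (h : Beyond b c X) :
    Beyond b c (D.perm X) := by
  obtain ⟨hs, h1, h2, h3⟩ := h
  have hsc := D.s_eq hbc
  have hss := s_finish X
  have hp : ∀ {x y : Γ.H}, Γ.s x = Γ.s b → Γ.s y = Γ.s b → (x = y ↔ Γ.pos x = Γ.pos y) :=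
    fun hx hy => ⟨fun h => by rw [h], fun h => Γ.eq_of_pos_eq (hx.trans hy.symm) h⟩
  have hne : Γ.pos b ≠ Γ.pos c := pos_ne_pos (D.ne hbc) hsc
  have hself : start X ≠ finish X := by
    intro h
    have h4 : ∀ x, Γ.s x = Γ.s b → x = start X := by
      intro x hx
      rcases X with B | y
      · exact eq_of_σ_eq_self h.symm (hs.trans hx.symm)
      · exact absurd h (D.ne y.2)
    exact D.ne hbc ((h4 b rfl).trans (h4 c hsc.symm).symm)
  rw [hp hs rfl, hp hs hsc.symm] at h1
  rw [hp (hss.trans hs) rfl, hp (hss.trans hs) hsc.symm] at h2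
  rw [hp hs rfl, hp (hss.trans hs) hsc.symm] at h3
  rw [Ne, hp hs (hss.trans hs)] at hself
  refine ⟨(s_start_perm X).trans hs, ?_⟩
  rcases isNext_perm X with ⟨hY, hno⟩ | ⟨d, hd, hY, hcyc, hmax⟩
  · rw [hY]
    change (finish X = b ∨ finish X = c ∨ Cyc (Γ.pos b) (Γ.pos (finish X)) (Γ.pos c)) ∧
      (Γ.σ (finish X) = b ∨ Γ.σ (finish X) = c ∨ Cyc (Γ.pos b) (Γ.pos (Γ.σ (finish X))) (Γ.pos c)) ∧
      ¬ (finish X = b ∧ Γ.σ (finish X) = c)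
    have hσs : Γ.s (Γ.σ (finish X)) = Γ.s b := (Γ.s_σ _).trans (hss.trans hs)
    have hnc : Γ.pos (finish X) ≠ Γ.pos c := by
      intro h
      have hc : finish X = c := (hp (hss.trans hs) hsc.symm).2 h
      rw [hc] at hno h2 h3 hself
      have := hno b (D.symm hbc)
      unfold Cyc at *
      omega
    have k1 := Γ.pos_σ (finish X)
    have k2 := Γ.pos_lt (finish X)
    have k3 := Γ.pos_lt b
    have k4 := Γ.pos_lt c
    rw [hss, hs] at k1 k2
    rw [← hsc] at k4
    refine ⟨?_, ?_, ?_⟩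
    · rwa [hp (hss.trans hs) rfl, hp (hss.trans hs) hsc.symm]
    · rw [hp hσs rfl, hp hσs hsc.symm]
      unfold Cyc at *
      split_ifs at k1 <;> omega
    · rintro ⟨h5, h6⟩
      exact D.ne_σ hbc (by rw [← h5, h6])
  · rw [hY]
    change (finish X = b ∨ finish X = c ∨ Cyc (Γ.pos b) (Γ.pos (finish X)) (Γ.pos c)) ∧
      (d = b ∨ d = c ∨ Cyc (Γ.pos b) (Γ.pos d) (Γ.pos c)) ∧ ¬ (finish X = b ∧ d = c)
    have hds : Γ.s d = Γ.s b := (D.s_eq hd).symm.trans (hss.trans hs)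
    have hnc : ¬ (Cyc (Γ.pos b) (Γ.pos (finish X)) (Γ.pos c) ∧
        Cyc (Γ.pos c) (Γ.pos d) (Γ.pos b)) := fun h =>
      D.noncrossing hbc hd (hs.symm.trans hss.symm) h.1 h.2
    have hmb : Γ.pos (finish X) = Γ.pos c → Γ.pos b = Γ.pos d ∨
        Cyc (Γ.pos (finish X)) (Γ.pos b) (Γ.pos d) := by
      intro h
      have hc : finish X = c := (hp (hss.trans hs) hsc.symm).2 h
      have hr : D.rel (finish X) b := hc ▸ D.symm hbc
      refine (hmax b hr ?_).imp_left fun h => by rw [h]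
      unfold Cyc at *
      omega
    rw [hp (hss.trans hs) rfl, hp (hss.trans hs) hsc.symm, hp hds rfl, hp hds hsc.symm]
    unfold Cyc at *
    omega

/-- The reversed diagonal lies on the side between `b` and `c`, hence so does its whole vertex,
while the diagonal itself is excluded from that side. -/
lemma vertex_ne {b c : Γ.H} (hbc : D.rel b c) :
    D.vertex (Sum.inr ⟨(b, c), hbc⟩) ≠ D.vertex (flip (Sum.inr ⟨(b, c), hbc⟩)) := by
  intro h
  obtain ⟨n, -, hn⟩ := (vertex_eq.1 h.symm).exists_pow_eq'
  have key : ∀ m, Beyond b c ((D.perm ^ m) (flip (Sum.inr ⟨(b, c), hbc⟩))) := by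
    intro m
    induction m with
    | zero =>
      refine ⟨(D.s_eq hbc).symm, Or.inr (Or.inl rfl), Or.inl rfl, ?_⟩
      rintro ⟨h1, -⟩
      exact D.ne hbc h1.symm
    | succ m ih =>
      rw [pow_succ', Equiv.Perm.mul_apply]
      exact ih.perm hbc
  have := key n
  rw [hn] at this
  exact this.2.2.2 ⟨rfl, rfl⟩

/-- The half-edges of the expansion along a smaller dissection. -/
def incl (h : ∀ b c, D'.rel b c → D.rel b c) : D'.HalfEdge → D.HalfEdge :=
  Sum.map id (fun x => ⟨x.1, h _ _ x.2⟩)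

lemma start_incl (h : ∀ b c, D'.rel b c → D.rel b c) (X : D'.HalfEdge) :
    start (incl h X) = start X := by
  rcases X with B | x <;> rfl

lemma finish_incl (h : ∀ b c, D'.rel b c → D.rel b c) (X : D'.HalfEdge) :
    finish (incl h X) = finish X := by
  rcases X with B | x <;> rfl

lemma incl_injective (h : ∀ b c, D'.rel b c → D.rel b c) : Function.Injective (incl h) := by
  rintro (B | x) (B' | x') hX
  · exact congrArg Sum.inl (Sum.inl_injective hX)
  · cases hX
  · cases hX
  · have := congrArg Subtype.val (Sum.inr_injective hX)
    exact congrArg Sum.inr (Subtype.ext this)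

/-- A successor that is still present after diagonals have been removed wins against fewer
competitors. -/
lemma incl_perm (h : ∀ b c, D'.rel b c → D.rel b c) {X Y : D'.HalfEdge}
    (hY : D.perm (incl h X) = incl h Y) : incl h (D'.perm X) = D.perm (incl h X) := by
  rw [hY]
  congr 1
  refine perm_eq ?_
  have := isNext_perm (incl h X)
  rw [hY] at this
  unfold IsNext at this ⊢
  rw [finish_incl, start_incl] at this
  rcases this with ⟨h1, h2⟩ | ⟨d, hd, h1, h2, h3⟩
  · exact Or.inl ⟨incl_injective h h1, fun d hd => h2 d (h _ _ hd)⟩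
  · right
    rcases Y with B | ⟨⟨x, y⟩, hxy⟩
    · cases h1
    · have h4 := congrArg Subtype.val (Sum.inr_injective h1)
      change (x, y) = (finish X, d) at h4
      obtain ⟨rfl, rfl⟩ := Prod.mk.inj h4
      exact ⟨y, hxy, rfl, h2, fun d' hd' => h3 d' (h _ _ hd')⟩

/-- When the successor is removed, the runner-up takes its place; it is the farthest diagonal from
`b` ending before `c`, that is, the successor of the reversed diagonal. -/
lemma incl_perm_of_eq (h : ∀ b c, D'.rel b c → D.rel b c) {b c : Γ.H} (hbc : D.rel b c)
    (hnot : ¬ D'.rel b c) (hrel : ∀ d, D.rel b d → D'.rel b d ∨ d = c) {X : D'.HalfEdge}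
    (hX : D.perm (incl h X) = Sum.inr ⟨(b, c), hbc⟩) :
    incl h (D'.perm X) = D.perm (flip (Sum.inr ⟨(b, c), hbc⟩)) := by
  have h0 := isNext_perm (incl h X)
  rw [hX] at h0
  obtain ⟨hfin, hcyc, hmax⟩ : finish X = b ∧ Cyc (Γ.pos b) (Γ.pos c) (Γ.pos (start X)) ∧
      ∀ d', D.rel b d' → Cyc (Γ.pos b) (Γ.pos d') (Γ.pos (start X)) →
        d' = c ∨ Cyc (Γ.pos b) (Γ.pos d') (Γ.pos c) := by
    unfold IsNext at h0
    rw [finish_incl, start_incl] at h0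
    rcases h0 with ⟨h1, -⟩ | ⟨d, hd, h1, h2, h3⟩
    · cases h1
    · have h4 := congrArg Subtype.val (Sum.inr_injective h1)
      obtain ⟨h5, h6⟩ := Prod.mk.inj h4
      subst h5 h6
      exact ⟨rfl, h2, h3⟩
  have hlt : ∀ d', D'.rel b d' → Cyc (Γ.pos b) (Γ.pos d') (Γ.pos (start X)) →
      Cyc (Γ.pos b) (Γ.pos d') (Γ.pos c) := fun d' hd' hc =>
    (hmax d' (h _ _ hd') hc).resolve_left fun h => hnot (h ▸ hd')
  rcases isNext_perm (flip (D := D) (Sum.inr ⟨(b, c), hbc⟩)) with ⟨h1, h2⟩ | ⟨d, hd, h1, h2, h3⟩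
  · rw [h1]
    change _ = incl h (Sum.inl b)
    congr 1
    refine perm_eq (Or.inl ⟨by rw [hfin], fun d hd hc => ?_⟩)
    rw [hfin] at hd hc
    exact h2 d (h _ _ hd) (hlt d hd hc)
  · have hd' : D'.rel b d := (hrel d hd).resolve_right (by
      rintro rfl
      change Cyc (Γ.pos b) (Γ.pos d) (Γ.pos d) at h2
      unfold Cyc at h2
      omega)
    rw [h1]
    change _ = incl h (Sum.inr ⟨(b, d), hd'⟩)
    congr 1
    change Cyc (Γ.pos b) (Γ.pos d) (Γ.pos c) at h2
    subst hfin
    refine perm_eq (Or.inr ⟨d, hd', rfl, ?_, fun d' hd'' hc => ?_⟩)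
    · unfold Cyc at *
      omega
    · exact h3 d' (h _ _ hd'') (hlt d' hd'' hc)

lemma exists_hom_remove (h : ∀ b c, D'.rel b c → D.rel b c) {b c : Γ.H} (hbc : D.rel b c)
    (hnot : ¬ D'.rel b c)
    (hrel : ∀ x y, D.rel x y → D'.rel x y ∨ (x = b ∧ y = c) ∨ (x = c ∧ y = b)) :
    ∃ f : Hom D.expand D'.expand,
      ∀ B : Γ.H, f.toFun (Sum.inr (Sum.inl B)) = Sum.inr (Sum.inl B) := by
  have hne := D.ne hbc
  have hval : 3 ≤ Γ.val (Γ.s b) := by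
    refine Γ.three_le_val _ fun ⟨j, hj⟩ => hne ?_
    exact Γ.eq_of_s_leaf hj.symm ((D.s_eq hbc).symm.trans hj.symm)
  have hrange : ∀ X : D.HalfEdge, (∃ Y, incl h Y = X) ↔
      X ≠ Sum.inr ⟨(b, c), hbc⟩ ∧ X ≠ flip (Sum.inr ⟨(b, c), hbc⟩) := by
    intro X
    constructor
    · rintro ⟨Y, rfl⟩
      rcases Y with B | ⟨⟨x, y⟩, hxy⟩
      · exact ⟨fun h => (by cases h), fun h => (by cases h)⟩
      · refine ⟨fun h1 => ?_, fun h1 => ?_⟩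
        · have h2 := congrArg Subtype.val (Sum.inr_injective h1)
          obtain ⟨rfl, rfl⟩ := Prod.mk.inj h2
          exact hnot hxy
        · have h2 := congrArg Subtype.val (Sum.inr_injective h1)
          obtain ⟨rfl, rfl⟩ := Prod.mk.inj h2
          exact hnot (D'.symm hxy)
    · rintro ⟨h1, h2⟩
      rcases X with B | ⟨⟨x, y⟩, hxy⟩
      · exact ⟨Sum.inl B, rfl⟩
      · rcases hrel x y hxy with h3 | ⟨rfl, rfl⟩ | ⟨rfl, rfl⟩
        · exact ⟨Sum.inr ⟨(x, y), h3⟩, rfl⟩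
        · exact absurd rfl h1
        · exact absurd rfl h2
  have hc1 : ∀ d, D.rel b d → D'.rel b d ∨ d = c := fun d hd => by
    rcases hrel _ _ hd with h1 | h1 | h1
    · exact Or.inl h1
    · exact Or.inr h1.2
    · exact absurd h1.1 hne
  have hc2 : ∀ d, D.rel c d → D'.rel c d ∨ d = b := fun d hd => by
    rcases hrel _ _ hd with h1 | h1 | h1
    · exact Or.inl h1
    · exact absurd h1.1.symm hne
    · exact Or.inr h1.2
  obtain ⟨f, hf⟩ := exists_hom_of_collapse_edge (Γ := D.expand) (Δ := D'.expand)
    (A := (Sum.inr ⟨(b, c), hbc⟩ : D.HalfEdge)) (vertex_ne hbc) (perm_ne hval)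
    (perm_ne (D.s_eq hbc ▸ hval)) (incl h) (incl_injective h) hrange
    (by rintro (B | x) <;> rfl)
    (fun X h1 h2 => by
      obtain ⟨Y, hY⟩ := (hrange (D.perm (incl h X))).2 ⟨h1, h2⟩
      exact incl_perm h hY.symm)
    (fun X hX => incl_perm_of_eq h hbc hnot hc1 hX)
    (fun X hX => incl_perm_of_eq h (D.symm hbc) (fun h => hnot (D'.symm h)) hc2 hX)
    rfl (fun j => ⟨Sum.inl (Γ.baseAt (Γ.leaf j)), rfl, rfl⟩)
  exact ⟨f, fun B => hf (Sum.inl B)⟩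

/-- Removing a diagonal and its reverse from a dissection. -/
def remove (D : Dissection Γ) (b c : Γ.H) : Dissection Γ where
  rel x y := D.rel x y ∧ ¬ (x = b ∧ y = c) ∧ ¬ (x = c ∧ y = b)
  symm h := ⟨D.symm h.1, fun h' => h.2.2 ⟨h'.2, h'.1⟩, fun h' => h.2.1 ⟨h'.2, h'.1⟩⟩
  s_eq h := D.s_eq h.1
  ne h := D.ne h.1
  ne_σ h := D.ne_σ h.1
  noncrossing h h' := D.noncrossing h.1 h'.1

/-- A smaller dissection gives a collapse of the expansion. -/
lemma exists_hom_of_le (h : ∀ b c, D'.rel b c → D.rel b c) :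
    ∃ f : Hom D.expand D'.expand,
      ∀ B : Γ.H, f.toFun (Sum.inr (Sum.inl B)) = Sum.inr (Sum.inl B) := by
  generalize hn : {x : Γ.H × Γ.H | D.rel x.1 x.2 ∧ ¬ D'.rel x.1 x.2}.ncard = n
  induction n using Nat.strong_induction_on generalizing D with
  | _ n ih =>
    by_cases hex : ∃ b c, D.rel b c ∧ ¬ D'.rel b c
    · obtain ⟨b, c, hbc, hnot⟩ := hex
      obtain ⟨f, hf⟩ := exists_hom_remove (D := D) (D' := D.remove b c) (fun _ _ h => h.1) hbc
        (fun h => h.2.1 ⟨rfl, rfl⟩) (fun x y hxy => by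
          by_cases h1 : x = b ∧ y = c
          · exact Or.inr (Or.inl h1)
          by_cases h2 : x = c ∧ y = b
          · exact Or.inr (Or.inr h2)
          exact Or.inl ⟨hxy, h1, h2⟩)
      have hle : ∀ x y, D'.rel x y → (D.remove b c).rel x y := by
        refine fun x y hxy => ⟨h _ _ hxy, ?_, ?_⟩
        · rintro ⟨rfl, rfl⟩
          exact hnot hxy
        · rintro ⟨rfl, rfl⟩
          exact hnot (D'.symm hxy)
      obtain ⟨g, hg⟩ := ih _ (by
        rw [← hn]
        refine Set.ncard_lt_ncard ⟨fun x hx => ⟨hx.1.1, hx.2⟩, fun hsub => ?_⟩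
        have := hsub (a := (b, c)) ⟨hbc, hnot⟩
        exact this.1.2.1 ⟨rfl, rfl⟩) hle rfl
      refine ⟨f.comp g, fun B => ?_⟩
      exact (congrArg g.toFun (hf B)).trans (hg B)
    · push Not at hex
      have : D = D' := Dissection.ext (by
        funext x y
        exact propext ⟨hex x y, h x y⟩)
      subst this
      exact ⟨Hom.id _, fun B => rfl⟩

variable (Γ) in
/-- The empty dissection. -/
def empty : Dissection Γ where
  rel _ _ := False
  symm h := h
  s_eq h := h.elim
  ne h := h.elim
  ne_σ h := h.elim
  noncrossing h := h.elim

/-- Nothing happens when expanding along the empty dissection. -/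
noncomputable def expandEmptyIso : (empty Γ).expand ≅ Γ :=
  isoOfEquiv (Γ := (empty Γ).expand)
    (Equiv.ofBijective (start (D := empty Γ)) ⟨by
      rintro (B | x) (B' | x') h
      · exact congrArg Sum.inl h
      · exact x'.2.elim
      · exact x.2.elim
      · exact x.2.elim, fun B => ⟨Sum.inl B, rfl⟩⟩)
    (by
      rintro (B | x)
      · rfl
      · exact x.2.elim)
    (by
      rintro (B | x)
      · exact start_perm _
      · exact x.2.elim) rfl
    (fun j X hX => by
      have h := s_start_of_vertex_eq hX
      exact h.trans (Γ.s_baseAt _))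

lemma exists_proj (D : Dissection Γ) : ∃ f : D.expand ⟶ Γ,
    ∀ B : Γ.H, Hom.lift f B = (Sum.inl B : D.HalfEdge) := by
  obtain ⟨f, hf⟩ := exists_hom_of_le (D := D) (D' := empty Γ) (fun _ _ h => h.elim)
  let f' : D.expand ⟶ (empty Γ).expand := f
  refine ⟨f' ≫ expandEmptyIso.hom, fun B => ?_⟩
  rw [Hom.lift_comp]
  have h1 : Hom.lift (expandEmptyIso (Γ := Γ)).hom B = (Sum.inl B : (empty Γ).HalfEdge) := by
    exact (lift_isoOfEquiv _ _ _ _ _ B).trans ((Equiv.symm_apply_eq _).2 rfl)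
  rw [h1]
  exact (Hom.eq_lift f (hf B)).symm

/-- The projection of the expansion. -/
noncomputable def proj (D : Dissection Γ) : D.expand ⟶ Γ := D.exists_proj.choose

lemma lift_proj (B : Γ.H) : Hom.lift D.proj B = (Sum.inl B : D.HalfEdge) :=
  D.exists_proj.choose_spec B

lemma collapsed_proj_iff {X : D.expand.H} :
    Hom.Collapsed D.proj X ↔ ∃ x, X = (Sum.inr x : D.HalfEdge) := by
  rw [← not_iff_not, Hom.not_collapsed_iff]
  rcases X with B | x
  · exact iff_of_true ⟨B, (lift_proj B).symm⟩ (by rintro ⟨x, hx⟩; cases hx)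
  · refine iff_of_false ?_ (fun h => h ⟨x, rfl⟩)
    rintro ⟨B, hB⟩
    rw [lift_proj] at hB
    cases hB

lemma st_proj (X : D.expand.H) : Hom.st D.proj X = start X := by
  have : ∀ (X : D.expand.H) B, Hom.Reach D.proj X B → B = start X := by
    intro X B hB
    induction hB with
    | base B => rw [lift_proj]; rfl
    | step X B hX _ ih =>
      rw [ih]
      obtain ⟨x, rfl⟩ := collapsed_proj_iff.1 hX
      exact start_perm _
  exact this _ _ (Hom.reach_st D.proj X)

end Dissection

/-! ### Every morphism is an expansion along its dissection -/

namespace Hom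

variable {Γ Δ Λ : LeafedFatGraph}

/-- The dissection of the target of a morphism by the collapsed edges. -/
def dissection (f : Hom Γ Δ) : Dissection Δ where
  rel b c := ∃ A, f.Collapsed A ∧ f.st A = b ∧ f.st (Γ.i A) = c
  symm := by
    rintro b c ⟨A, hA, rfl, rfl⟩
    exact ⟨Γ.i A, hA.i, rfl, by rw [Γ.i_i]⟩
  s_eq := by
    rintro b c ⟨A, hA, rfl, rfl⟩
    exact (s_st_i hA).symm
  ne := by
    rintro b c ⟨A, hA, rfl, rfl⟩
    exact hA.st_ne
  ne_σ := by
    rintro b c ⟨A, hA, rfl, rfl⟩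
    exact hA.st_i_ne_σ
  noncrossing := by
    rintro b c b' c' ⟨A, hA, rfl, rfl⟩ ⟨A', hA', rfl, rfl⟩ hs h1 h2
    exact hA.noncrossing hA' hs h1 h2

lemma _root_.LeafedFatGraph.Dissection.dissection_proj (D : Dissection Γ) :
    Hom.dissection D.proj = D := by
  refine Dissection.ext (funext fun b => funext fun c => propext ⟨?_, fun h => ?_⟩)
  · rintro ⟨X, hX, rfl, rfl⟩
    obtain ⟨x, rfl⟩ := Dissection.collapsed_proj_iff.1 hX
    have h1 := Dissection.st_proj (D := D) (Sum.inr x : D.HalfEdge)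
    have h2 := Dissection.st_proj (D := D) (Dissection.flip (Sum.inr x) : D.HalfEdge)
    exact (congrArg₂ D.rel h1 h2).mpr x.2
  · exact ⟨(Sum.inr ⟨(b, c), h⟩ : D.HalfEdge), Dissection.collapsed_proj_iff.2 ⟨_, rfl⟩,
      Dissection.st_proj _, Dissection.st_proj _⟩

open Classical in
/-- A half-edge of the source as a half-edge of the expansion along the dissection. -/
noncomputable def toHalfEdge (f : Hom Γ Δ) (A : Γ.H) : f.dissection.HalfEdge :=
  if h : f.Collapsed A then Sum.inr ⟨(f.st A, f.st (Γ.i A)), A, h, rfl, rfl⟩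
  else Sum.inl (f.st A)

variable {f : Hom Γ Δ}

lemma toHalfEdge_of_collapsed {A : Γ.H} (h : f.Collapsed A) :
    f.toHalfEdge A = Sum.inr ⟨(f.st A, f.st (Γ.i A)), A, h, rfl, rfl⟩ := dif_pos h

lemma toHalfEdge_lift (B : Δ.H) : f.toHalfEdge (f.lift B) = Sum.inl B := by
  rw [toHalfEdge, dif_neg (f.not_collapsed_lift B), st_lift]

lemma start_toHalfEdge (A : Γ.H) : Dissection.start (f.toHalfEdge A) = f.st A := by
  rw [toHalfEdge]
  split_ifs <;> rfl

lemma finish_toHalfEdge (A : Γ.H) : Dissection.finish (f.toHalfEdge A) = f.st (Γ.σ A) := by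
  by_cases hA : f.Collapsed A
  · rw [toHalfEdge_of_collapsed hA, hA.st_σ]
    rfl
  · obtain ⟨B, rfl⟩ := f.exists_lift_of_not_collapsed hA
    rw [toHalfEdge_lift, st_σ_lift]
    rfl

variable (f)

lemma toHalfEdge_bijective : Function.Bijective f.toHalfEdge := by
  constructor
  · intro A A' h
    by_cases hA : f.Collapsed A
    · by_cases hA' : f.Collapsed A'
      · rw [toHalfEdge_of_collapsed hA, toHalfEdge_of_collapsed hA'] at h
        have h1 := congrArg Subtype.val (Sum.inr_injective h)
        obtain ⟨h2, h3⟩ := Prod.mk.inj h1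
        exact hA.eq_of_st_eq hA' h2 h3
      · obtain ⟨B, rfl⟩ := f.exists_lift_of_not_collapsed hA'
        rw [toHalfEdge_of_collapsed hA, toHalfEdge_lift] at h
        cases h
    · obtain ⟨B, rfl⟩ := f.exists_lift_of_not_collapsed hA
      by_cases hA' : f.Collapsed A'
      · rw [toHalfEdge_of_collapsed hA', toHalfEdge_lift] at h
        cases h
      · obtain ⟨B', rfl⟩ := f.exists_lift_of_not_collapsed hA'
        rw [toHalfEdge_lift, toHalfEdge_lift] at h
        rw [Sum.inl_injective h]
  · rintro (B | ⟨⟨b, c⟩, A, hA, h1, h2⟩)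
    · exact ⟨_, toHalfEdge_lift B⟩
    · refine ⟨A, ?_⟩
      rw [toHalfEdge_of_collapsed hA]
      change f.st A = b at h1
      change f.st (Γ.i A) = c at h2
      subst h1 h2
      rfl

lemma toHalfEdge_i (A : Γ.H) : f.toHalfEdge (Γ.i A) = Dissection.flip (f.toHalfEdge A) := by
  by_cases hA : f.Collapsed A
  · rw [toHalfEdge_of_collapsed hA, toHalfEdge_of_collapsed hA.i]
    refine congrArg Sum.inr (Subtype.ext ?_)
    change (_, f.st (Γ.i (Γ.i A))) = (_, f.st A)
    rw [Γ.i_i]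
  · obtain ⟨B, rfl⟩ := f.exists_lift_of_not_collapsed hA
    rw [i_lift, toHalfEdge_lift, toHalfEdge_lift]
    rfl

/-- If `σ A` is collapsed, it realizes the farthest admissible diagonal, by `cyc_st_σ` and
`farthest_σ`; if it survives, there is no admissible diagonal, by `not_cyc_of_not_collapsed_σ`. -/
lemma toHalfEdge_σ (A : Γ.H) : f.toHalfEdge (Γ.σ A) = f.dissection.perm (f.toHalfEdge A) := by
  refine (Dissection.perm_eq ?_).symm
  unfold Dissection.IsNext
  rw [finish_toHalfEdge, start_toHalfEdge]
  by_cases hσ : f.Collapsed (Γ.σ A)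
  · right
    refine ⟨f.st (Γ.i (Γ.σ A)), ⟨_, hσ, rfl, rfl⟩, toHalfEdge_of_collapsed hσ, cyc_st_σ hσ, ?_⟩
    rintro d' ⟨Z, hZ, hst, rfl⟩ hcyc
    by_cases hne : f.st (Γ.i Z) = f.st (Γ.i (Γ.σ A))
    · exact Or.inl hne
    · right
      rw [← hst] at hcyc ⊢
      exact farthest_σ hσ hZ hst hcyc hne
  · left
    obtain ⟨B, hB⟩ := f.exists_lift_of_not_collapsed hσ
    refine ⟨by rw [hB, toHalfEdge_lift, st_lift], ?_⟩
    rintro d ⟨Z, hZ, hst, rfl⟩ hcyc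
    rw [← hst] at hcyc
    exact not_cyc_of_not_collapsed_σ hσ hZ hst hcyc

/-- Every morphism is isomorphic to the expansion along a dissection. -/
noncomputable def isoExpand (f : Hom Γ Δ) : Γ ≅ f.dissection.expand :=
  isoOfEquiv (Δ := f.dissection.expand) (Equiv.ofBijective _ f.toHalfEdge_bijective)
    f.toHalfEdge_i f.toHalfEdge_σ f.n_eq (by
      intro j A hA
      have h1 : Δ.s (f.st A) = Δ.leaf (Fin.cast f.n_eq j) := by rw [s_st, hA, onV_leaf]
      change f.dissection.vertex (f.toHalfEdge A) = f.dissection.vertex _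
      have h2 : Δ.s (Dissection.start (f.toHalfEdge A)) = Δ.leaf (Fin.cast f.n_eq j) := by
        rw [start_toHalfEdge, h1]
      rw [Dissection.eq_inl_of_s_start h2, Δ.eq_of_s_leaf h2 (Δ.s_baseAt _)]
      rfl)

lemma isoExpand_proj (f : Γ ⟶ Δ) : (isoExpand f).hom ≫ (Hom.dissection f).proj = f := by
  refine ext_lift fun B => ?_
  rw [lift_comp, Dissection.lift_proj]
  exact (lift_isoOfEquiv _ _ _ _ _ _).trans
    ((Equiv.symm_apply_eq _).2 (toHalfEdge_lift B).symm)

/-- Both morphisms are replaced by expansions of `Λ`, between which the inclusion of dissections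
gives a collapse fixing the half-edges of `Λ`. -/
lemma exists_comp_eq_of_le (f : Γ ⟶ Λ) (g : Δ ⟶ Λ)
    (h : ∀ b c, (Hom.dissection g).rel b c → (Hom.dissection f).rel b c) :
    ∃ k : Γ ⟶ Δ, k ≫ g = f := by
  obtain ⟨k, hk⟩ := Dissection.exists_hom_of_le h
  let k' : (Hom.dissection f).expand ⟶ (Hom.dissection g).expand := k
  refine ⟨(isoExpand f).hom ≫ k' ≫ (isoExpand g).inv, ?_⟩
  have h1 : (isoExpand g).inv ≫ g = (Hom.dissection g).proj := by
    rw [Iso.inv_comp_eq, isoExpand_proj]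
  rw [Category.assoc, Category.assoc, h1]
  conv_rhs => rw [← isoExpand_proj f]
  congr 1
  refine ext_lift fun B => ?_
  rw [lift_comp, Dissection.lift_proj, Dissection.lift_proj]
  exact (Hom.eq_lift k (hk B)).symm

/-- Boundary walks compose: the half-edges that `f` skips are also collapsed by the composite. -/
lemma reach_comp (f : Γ ⟶ Δ) (g : Δ ⟶ Λ) {A : Γ.H} {B : Δ.H} (h : Hom.Reach f A B) :
    Hom.st (f ≫ g) A = Hom.st g B := by
  have hlift : ∀ B, Hom.st (f ≫ g) (Hom.lift f B) = Hom.st g B := by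
    intro B
    have : ∀ C, Hom.Reach g B C → Hom.st (f ≫ g) (Hom.lift f B) = C := by
      intro C hC
      induction hC with
      | base C => rw [← lift_comp, st_lift]
      | step B C hB _ ih =>
        have hc : Hom.Collapsed (f ≫ g) (Hom.lift f B) := by
          obtain ⟨w, hw⟩ := hB
          exact ⟨w, by rw [toFun_comp, Hom.map_lift, hw]⟩
        obtain ⟨k, hk, h1, h2⟩ := Hom.map_ω f _ _ (Hom.map_lift f B)
        have key : ∀ j < k, Hom.st (f ≫ g) (Hom.lift f B) =
            Hom.st (f ≫ g) ((Γ.ω ^ (j + 1)) (Hom.lift f B)) := by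
          intro j hj
          induction j with
          | zero => rw [← hc.st_σ_i]; rfl
          | succ j ihj =>
            rw [ihj (by omega)]
            have hc' : Hom.Collapsed (f ≫ g) ((Γ.ω ^ (j + 1)) (Hom.lift f B)) := by
              obtain ⟨w, hw⟩ := h2 (j + 1) (by omega) (by omega)
              exact ⟨_, by rw [toFun_comp, hw, Hom.inl_onV]⟩
            rw [← hc'.st_σ_i, pow_succ' Γ.ω (j + 1)]
            rfl
        have h3 := key (k - 1) (by omega)
        rw [Nat.sub_add_cancel hk, Hom.eq_lift f h1] at h3
        rw [h3]
        exact ih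
    exact this _ (Hom.reach_st g B)
  induction h with
  | base B => exact hlift B
  | step A B hA _ ih =>
    have hc : Hom.Collapsed (f ≫ g) A := by
      obtain ⟨w, hw⟩ := hA
      exact ⟨_, by rw [toFun_comp, hw, Hom.inl_onV]⟩
    rw [← hc.st_σ_i, ih]

lemma st_comp (f : Γ ⟶ Δ) (g : Δ ⟶ Λ) (A : Γ.H) :
    Hom.st (f ≫ g) A = Hom.st g (Hom.st f A) := reach_comp f g (Hom.reach_st f A)

lemma collapsed_comp_lift {f : Γ ⟶ Δ} {g : Δ ⟶ Λ} {A : Δ.H} (hA : Hom.Collapsed g A) :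
    Hom.Collapsed (f ≫ g) (Hom.lift f A) := by
  obtain ⟨w, hw⟩ := hA
  exact ⟨w, by rw [toFun_comp, Hom.map_lift, hw]⟩

lemma dissection_le_of_comp (f : Γ ⟶ Δ) (g : Δ ⟶ Λ) {b c : Λ.H}
    (h : (Hom.dissection g).rel b c) : (Hom.dissection (f ≫ g)).rel b c := by
  obtain ⟨A, hA, rfl, rfl⟩ := h
  refine ⟨Hom.lift f A, collapsed_comp_lift hA, ?_, ?_⟩
  · rw [st_comp, st_lift]
  · rw [st_comp, i_lift, st_lift]

/-- Morphisms of fat graphs are monomorphisms in the sense that they can be cancelled. -/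
lemma eq_of_comp_eq {f f' : Γ ⟶ Δ} {g : Δ ⟶ Λ} (h : f ≫ g = f' ≫ g) : f = f' := by
  refine ext_lift fun A => ?_
  -- The lift of a half-edge surviving in `Λ` is read off from the composite; the lift of a
  -- collapsed one is determined by its diagonal, which is that of the composite.
  by_cases hA : Hom.Collapsed g A
  · have h1 := collapsed_comp_lift (f := f) hA
    have h2 := collapsed_comp_lift (f := f') hA
    rw [← h] at h2
    refine h1.eq_of_st_eq h2 ?_ ?_
    · conv_rhs => rw [h]
      rw [st_comp, st_comp, st_lift, st_lift]
    · conv_rhs => rw [h]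
      rw [st_comp, st_comp, i_lift, i_lift, st_lift, st_lift]
  · obtain ⟨B, rfl⟩ := Hom.exists_lift_of_not_collapsed g hA
    rw [← lift_comp, h, lift_comp]

end Hom

end LeafedFatGraph

section

/-! ### Morphisms of isomorphism classes and the category over a bordered fat graph -/

namespace IsoClass

variable {C : Type u} [Category.{v} C] [UniqueIsos C]

/-- The morphism of isomorphism classes represented by a morphism. -/
def homMk {X Y : C} (f : X ⟶ Y) : mk X ⟶ mk Y :=
  Quotient.mk (homSetoid (mk X) (mk Y)) ⟨Arrow.mk f, rfl, rfl⟩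

omit [UniqueIsos C] in
lemma exists_mk (x : IsoClass C) : ∃ X : C, mk X = x := Quotient.exists_rep x

lemma exists_homMk {X Y : C} (φ : mk X ⟶ mk Y) : ∃ f : X ⟶ Y, homMk f = φ := by
  obtain ⟨⟨g, h1, h2⟩, rfl⟩ := Quotient.exists_rep φ
  obtain ⟨a⟩ := mk_eq_mk.1 h1
  obtain ⟨b⟩ := mk_eq_mk.1 h2
  refine ⟨a.inv ≫ g.hom ≫ b.hom, Quotient.sound ?_⟩
  exact nonempty_arrow_iso (f := Arrow.mk (a.inv ≫ g.hom ≫ b.hom)) a.symm b.symm (by simp)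

lemma homMk_comp {X Y Z : C} (f : X ⟶ Y) (g : Y ⟶ Z) : homMk f ≫ homMk g = homMk (f ≫ g) := by
  refine Quotient.sound ?_
  exact preComp_iso _ _ (Iso.refl Y) (Arrow.mk (f ≫ g)) (Iso.refl _) (Iso.refl _) (by simp)

lemma homMk_id (X : C) : homMk (𝟙 X) = 𝟙 (mk X) := by
  obtain ⟨f, hf⟩ := exists_homMk (𝟙 (mk X))
  have h : homMk f ≫ homMk (𝟙 X) = homMk f := by rw [homMk_comp, Category.comp_id]
  rwa [hf, Category.id_comp] at h

/-- Automorphisms are trivial, so the vertical sides of the square that identifies two parallel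
morphisms are identities. -/
lemma homMk_injective {X Y : C} {f g : X ⟶ Y} (h : homMk f = homMk g) : f = g := by
  obtain ⟨e⟩ : Nonempty (Arrow.mk f ≅ Arrow.mk g) :=
    Quotient.exact (s := homSetoid (mk X) (mk Y)) h
  have h1 : Arrow.leftFunc.mapIso e = Iso.refl X := UniqueIsos.iso_unique _ _
  have h2 : Arrow.rightFunc.mapIso e = Iso.refl Y := UniqueIsos.iso_unique _ _
  have hw := arrow_iso_w e
  have h1' : e.hom.left = 𝟙 X := congrArg Iso.hom h1
  have h2' : e.hom.right = 𝟙 Y := congrArg Iso.hom h2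
  rw [h1', h2'] at hw
  simpa using hw.symm

lemma overMk_eq {x y z : IsoClass C} (h : x = y) {a b : Arrow C}
    (ha : mk a.left = x ∧ mk a.right = z) (hb : mk b.left = y ∧ mk b.right = z) (e : a ≅ b) :
    Over.mk (show x ⟶ z from Quotient.mk (homSetoid x z) ⟨a, ha⟩) =
      Over.mk (show y ⟶ z from Quotient.mk (homSetoid y z) ⟨b, hb⟩) := by
  subst h
  congr 1
  exact Quotient.sound ⟨e⟩

lemma overMk_homMk_eq {X Y Z : C} {f : X ⟶ Z} {g : Y ⟶ Z} (e : X ≅ Y) (h : e.hom ≫ g = f) :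
    Over.mk (homMk f) = Over.mk (homMk g) :=
  overMk_eq (mk_eq_mk.2 ⟨e⟩) _ _ (nonempty_arrow_iso (f := Arrow.mk f) (g := Arrow.mk g) e
    (Iso.refl Z) (by simpa using h)).some

lemma exists_overMk {Z : C} (Y : Over (mk Z)) : ∃ (X : C) (f : X ⟶ Z), Over.mk (homMk f) = Y := by
  obtain ⟨x, -, φ⟩ := Y
  obtain ⟨X, rfl⟩ := exists_mk x
  obtain ⟨f, rfl⟩ := exists_homMk φ
  exact ⟨X, f, rfl⟩

lemma nonempty_over_hom_iff {X Y Z : C} {f : X ⟶ Z} {g : Y ⟶ Z} :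
    Nonempty (Over.mk (homMk f) ⟶ Over.mk (homMk g)) ↔ ∃ k : X ⟶ Y, k ≫ g = f := by
  constructor
  · rintro ⟨φ⟩
    obtain ⟨k, hk⟩ := exists_homMk (show mk X ⟶ mk Y from φ.left)
    refine ⟨k, homMk_injective ?_⟩
    rw [← homMk_comp, hk]
    exact Over.w φ
  · rintro ⟨k, rfl⟩
    exact ⟨Over.homMk (homMk k) (homMk_comp k g)⟩

lemma over_isThin {Z : C} (hcancel : ∀ {X Y : C} (f f' : X ⟶ Y) (g : Y ⟶ Z),
    f ≫ g = f' ≫ g → f = f') : Quiver.IsThin (Over (mk Z)) := by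
  intro A B
  obtain ⟨X, f, rfl⟩ := exists_overMk A
  obtain ⟨Y, g, rfl⟩ := exists_overMk B
  refine ⟨fun φ ψ => Over.OverMorphism.ext ?_⟩
  obtain ⟨k, hk⟩ := exists_homMk (show mk X ⟶ mk Y from φ.left)
  obtain ⟨l, hl⟩ := exists_homMk (show mk X ⟶ mk Y from ψ.left)
  have h1 : homMk k ≫ homMk g = homMk f := by rw [hk]; exact Over.w φ
  have h2 : homMk l ≫ homMk g = homMk f := by rw [hl]; exact Over.w ψ
  rw [homMk_comp] at h1 h2
  have := hcancel k l g ((homMk_injective h1).trans (homMk_injective h2).symm)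
  subst this
  exact hk.symm.trans hl

/-- This is what makes a strict grading possible on isomorphism classes: the only morphisms that
preserve the degree are identities. -/
lemma exists_eqToHom {X Y : C} (e : X ≅ Y) : ∃ h : mk X = mk Y, homMk e.hom = eqToHom h := by
  have h := overMk_homMk_eq (f := e.hom) (g := 𝟙 Y) e (by simp)
  have key : ∀ {A B : Over (mk Y)}, A = B → ∃ h : A.left = B.left, A.hom = eqToHom h ≫ B.hom := by
    rintro A _ rfl
    exact ⟨rfl, by simp⟩
  obtain ⟨h1, h2⟩ := key h
  refine ⟨h1, ?_⟩
  change homMk e.hom = eqToHom h1 ≫ homMk (𝟙 Y) at h2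
  exact h2.trans ((congrArg (fun z => eqToHom h1 ≫ z) (homMk_id Y)).trans (Category.comp_id _))

end IsoClass

/-! ### Diagonals at vertices, boundary cycles and dimension under morphisms -/

namespace LeafedFatGraph

variable {Γ Δ : LeafedFatGraph}

namespace Dissection

/-- The diagonals of a dissection at a vertex, with the half-edges numbered by their positions. -/
def diagAt (D : Dissection Γ) (v : Γ.V) (k : ℕ) : Set (Diagonal k) :=
  {d | ∃ b c, D.rel b c ∧ Γ.s b = v ∧ Γ.pos b = d.1.1 ∧ Γ.pos c = d.1.2}

lemma diagAt_noncrossing (D : Dissection Γ) {v : Γ.V} {k : ℕ} {d d' : Diagonal k}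
    (hd : d ∈ D.diagAt v k) (hd' : d' ∈ D.diagAt v k) : d.Noncrossing d' := by
  obtain ⟨b, c, h, rfl, h1, h2⟩ := hd
  obtain ⟨b', c', h', hs, h1', h2'⟩ := hd'
  have k1 := D.noncrossing h h' hs.symm
  have k2 := D.noncrossing h' h hs
  have := d.2
  have := d'.2
  rw [h1, h2, h1', h2'] at k1 k2
  constructor
  · intro h3
    refine k1 ?_ ?_ <;> unfold Cyc <;> omega
  · intro h3
    refine k2 ?_ ?_ <;> unfold Cyc <;> omega

lemma not_leaf (D : Dissection Γ) {b c : Γ.H} (h : D.rel b c) : Γ.s b ∉ Set.range Γ.leaf := by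
  rintro ⟨j, hj⟩
  exact D.ne h (Γ.eq_of_s_leaf hj.symm ((D.s_eq h).symm.trans hj.symm))

/-- That the ends are neither equal nor adjacent is required cyclically of a dissection; adjacency
across position zero is the exclusion of the base edge. -/
lemma mem_diagAt (D : Dissection Γ) {b c : Γ.H} (h : D.rel b c) (hlt : Γ.pos b < Γ.pos c) {k : ℕ}
    (hk : Γ.val (Γ.s b) = k) : ∃ d ∈ D.diagAt (Γ.s b) k, d.1 = (Γ.pos b, Γ.pos c) := by
  have h1 := Γ.pos_σ b
  have h2 := Γ.pos_σ c
  have h3 := Γ.pos_lt b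
  have h4 := Γ.pos_lt c
  have h5 := pos_ne_pos (D.ne_σ h) ((D.s_eq h).symm.trans (Γ.s_σ b).symm)
  have h6 := pos_ne_pos (D.ne_σ (D.symm h)) ((D.s_eq h).trans (Γ.s_σ c).symm)
  rw [← D.s_eq h] at h2 h4
  rw [hk] at h1 h2 h3 h4
  refine ⟨⟨(Γ.pos b, Γ.pos c), ?_, h4, ?_⟩, ⟨b, c, h, rfl, rfl, rfl⟩, rfl⟩
  · change Γ.pos b + 2 ≤ Γ.pos c
    split_ifs at h1 <;> omega
  · rintro ⟨h7, h8⟩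
    change Γ.pos b = 0 at h7
    change Γ.pos c + 1 = k at h8
    rw [if_pos h8] at h2
    omega

lemma le_of_diagAt_subset {D D' : Dissection Γ}
    (h : ∀ v, v ∉ Set.range Γ.leaf → D.diagAt v (Γ.val v) ⊆ D'.diagAt v (Γ.val v)) {b c : Γ.H}
    (hbc : D.rel b c) : D'.rel b c := by
  have key : ∀ {b c}, D.rel b c → Γ.pos b < Γ.pos c → D'.rel b c := by
    intro b c hbc hlt
    obtain ⟨d, hd, hdp⟩ := D.mem_diagAt hbc hlt rfl
    obtain ⟨b', c', h', hs, h1, h2⟩ := h _ (D.not_leaf hbc) hd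
    rw [hdp] at h1 h2
    have hb := Γ.eq_of_pos_eq hs h1
    have hc := Γ.eq_of_pos_eq ((D'.s_eq h').symm.trans (hs.trans (D.s_eq hbc))) h2
    rwa [← hb, ← hc]
  rcases lt_or_gt_of_ne (pos_ne_pos (D.ne hbc) (D.s_eq hbc)) with h1 | h1
  · exact key hbc h1
  · exact D'.symm (key (D.symm hbc) h1)

lemma diagAt_mono {D D' : Dissection Γ} (h : ∀ b c, D.rel b c → D'.rel b c) (v : Γ.V) (k : ℕ) :
    D.diagAt v k ⊆ D'.diagAt v k := by
  rintro d ⟨b, c, hbc, h1⟩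
  exact ⟨b, c, h b c hbc, h1⟩

/-- The dissection given by sets of diagonals. -/
def ofDiagonals (S : ∀ v : Γ.Interior, Set (Diagonal (Γ.val v.1)))
    (hS : ∀ v, ∀ d ∈ S v, ∀ d' ∈ S v, Diagonal.Noncrossing d d') : Dissection Γ where
  rel b c := Γ.s b = Γ.s c ∧ ∃ v, ∃ d ∈ S v, Γ.s b = v.1 ∧
    ((Γ.pos b = d.1.1 ∧ Γ.pos c = d.1.2) ∨ (Γ.pos c = d.1.1 ∧ Γ.pos b = d.1.2))
  symm := by
    rintro b c ⟨h, v, d, hd, hs, hor⟩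
    exact ⟨h.symm, v, d, hd, h.symm.trans hs, hor.symm⟩
  s_eq h := h.1
  ne := by
    rintro b _ ⟨-, v, d, hd, hs, hor⟩ rfl
    have := d.2
    omega
  ne_σ := by
    rintro b _ ⟨-, v, d, hd, hs, hor⟩ rfl
    have := d.2
    have h1 := Γ.pos_σ b
    rw [hs] at h1
    split_ifs at h1 <;> omega
  noncrossing := by
    rintro b c b' c' ⟨-, v, d, hd, hs, hor⟩ ⟨-, v', d', hd', hs', hor'⟩ hss h1 h2
    obtain rfl : v = v' := Subtype.ext (by rw [← hs, ← hs', hss])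
    have h3 := hS v d hd d' hd'
    have := d.2
    have := d'.2
    unfold Diagonal.Noncrossing at h3
    unfold Cyc at h1 h2
    omega

lemma diagAt_ofDiagonals (S : ∀ v : Γ.Interior, Set (Diagonal (Γ.val v.1)))
    (hS : ∀ v, ∀ d ∈ S v, ∀ d' ∈ S v, Diagonal.Noncrossing d d') (v : Γ.Interior) :
    (ofDiagonals S hS).diagAt v.1 (Γ.val v.1) = S v := by
  ext d
  constructor
  · rintro ⟨b, c, ⟨-, v', d', hd', hs', hor⟩, hs, h1, h2⟩
    obtain rfl : v' = v := Subtype.ext (by rw [← hs', hs])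
    have h3 := d.2
    have h4 := d'.2
    have : d' = d := Subtype.ext (Prod.ext (by omega) (by omega))
    rwa [← this]
  · intro hd
    have h1 := d.2
    obtain ⟨b, hb, hpb⟩ := Γ.exists_pos_eq (v := v.1) (n := d.1.1) (by omega)
    obtain ⟨c, hc, hpc⟩ := Γ.exists_pos_eq (v := v.1) (n := d.1.2) (by omega)
    exact ⟨b, c, ⟨hb.trans hc.symm, v, d, hd, hb, Or.inl ⟨hpb, hpc⟩⟩, hb, hpb, hpc⟩

end Dissection

namespace Hom

variable (f : Hom Γ Δ)

/-- The half-edge at a leaf survives. -/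
lemma exists_lift_of_leaf {A : Γ.H} {j : Fin Γ.n} (hA : Γ.s A = Γ.leaf j) :
    ∃ B, A = f.lift B ∧ Δ.s B = Δ.leaf (Fin.cast f.n_eq j) := by
  have hc : ¬ f.Collapsed A := fun h => h.s_ne_leaf j hA
  obtain ⟨B, rfl⟩ := f.exists_lift_of_not_collapsed hc
  exact ⟨B, rfl, by rw [← f.onV_s_lift, hA, f.onV_leaf]⟩

lemma s_lift_leaf {B : Δ.H} {j : Fin Δ.n} (hB : Δ.s B = Δ.leaf j) :
    Γ.s (f.lift B) = Γ.leaf (Fin.cast f.n_eq.symm j) := by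
  obtain ⟨C, h1, h2⟩ := f.exists_lift_of_leaf (Γ.s_baseAt (Γ.leaf (Fin.cast f.n_eq.symm j)))
  have : B = C := Δ.eq_of_s_leaf hB h2
  rw [this, ← h1, s_baseAt]

lemma sameCycle_lift_ω (B : Δ.H) : Γ.ω.SameCycle (f.lift B) (f.lift (Δ.ω B)) := by
  obtain ⟨k, -, h1, -⟩ := f.map_ω _ _ (f.map_lift B)
  rw [← f.eq_lift h1]
  exact ⟨k, by simp⟩

lemma sameCycle_lift {B C : Δ.H} (h : Δ.ω.SameCycle B C) :
    Γ.ω.SameCycle (f.lift B) (f.lift C) := by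
  obtain ⟨n, -, rfl⟩ := h.exists_pow_eq'
  clear h
  induction n with
  | zero => exact .refl _ _
  | succ n ih =>
    rw [pow_succ', Equiv.Perm.mul_apply]
    exact ih.trans (f.sameCycle_lift_ω _)

lemma sameCycle_lift_st (A : Γ.H) : Γ.ω.SameCycle A (f.lift (f.st A)) := by
  have : ∀ B, f.Reach A B → Γ.ω.SameCycle A (f.lift B) := by
    intro B hB
    induction hB with
    | base B => exact .refl _ _
    | step A B _ _ ih => exact Equiv.Perm.sameCycle_apply_left.1 ih
  exact this _ (f.reach_st A)

lemma sameCycle_st_ω (A : Γ.H) : Δ.ω.SameCycle (f.st A) (f.st (Γ.ω A)) := by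
  by_cases hA : f.Collapsed A
  · rw [ω_apply, hA.st_σ_i]
  · obtain ⟨B, rfl⟩ := f.exists_lift_of_not_collapsed hA
    rw [ω_apply, i_lift, st_σ_lift, st_lift]
    exact Equiv.Perm.sameCycle_apply_right.2 (.refl _ _)

lemma sameCycle_st {A A' : Γ.H} (h : Γ.ω.SameCycle A A') : Δ.ω.SameCycle (f.st A) (f.st A') := by
  obtain ⟨n, -, rfl⟩ := h.exists_pow_eq'
  clear h
  induction n with
  | zero => exact .refl _ _
  | succ n ih =>
    rw [pow_succ', Equiv.Perm.mul_apply]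
    exact ih.trans (f.sameCycle_st_ω _)

-- The maps `st` and `lift` match the boundary cycles of source and target, and leaves correspond.
-- Expansions of bordered fat graphs are thus bordered.
include f in
lemma isBordered_of_hom (h : LeafedFatGraph.isBordered Δ) : LeafedFatGraph.isBordered Γ := by
  intro A
  obtain ⟨j, ⟨B, hB, hAB⟩, huniq⟩ := h (f.st A)
  refine ⟨Fin.cast f.n_eq.symm j, ⟨f.lift B, f.s_lift_leaf hB,
    (f.sameCycle_lift_st A).trans (f.sameCycle_lift hAB)⟩, ?_⟩
  rintro j' ⟨A', hA', hc⟩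
  obtain ⟨B', rfl, hB'⟩ := f.exists_lift_of_leaf hA'
  have h1 := f.sameCycle_st hc
  rw [st_lift] at h1
  have h2 := huniq (Fin.cast f.n_eq j') ⟨B', hB', h1⟩
  rw [← h2]
  rfl

-- The Euler characteristic is preserved: the identities for the trees over the vertices are added
-- up.
include f in
lemma card_relation : 2 * Nat.card Γ.V + Nat.card Δ.H = Nat.card Γ.H + 2 * Nat.card Δ.V := by
  classical
  have h1 := f.card_V_preimage Set.univ
  have h2 := f.card_H_preimage Set.univ
  have := Fintype.ofFinite {w : Δ.V // Sum.inl w ∈ (Set.univ : Set Δ.Elt)}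
  rw [Nat.card_sum, Nat.card_sigma] at h2
  rw [Nat.card_sigma] at h1
  have e1 : Nat.card {v : Γ.V // Sum.inl v ∈ f.toFun ⁻¹' Set.univ} = Nat.card Γ.V :=
    Nat.card_congr (Equiv.subtypeUnivEquiv fun _ => trivial)
  have e2 : Nat.card {A : Γ.H // Sum.inr A ∈ f.toFun ⁻¹' Set.univ} = Nat.card Γ.H :=
    Nat.card_congr (Equiv.subtypeUnivEquiv fun _ => trivial)
  have e3 : Nat.card {B : Δ.H // Sum.inr B ∈ (Set.univ : Set Δ.Elt)} = Nat.card Δ.H :=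
    Nat.card_congr (Equiv.subtypeUnivEquiv fun _ => trivial)
  have e4 : Fintype.card {w : Δ.V // Sum.inl w ∈ (Set.univ : Set Δ.Elt)} = Nat.card Δ.V := by
    rw [← Nat.card_eq_fintype_card]
    exact Nat.card_congr (Equiv.subtypeUnivEquiv fun _ => trivial)
  rw [e1] at h1
  rw [e2, e3] at h2
  rw [h1, h2, Finset.mul_sum, Finset.sum_congr rfl (fun w _ => (f.tree w.1).euler),
    Finset.sum_add_distrib, Finset.sum_const, Finset.card_univ, e4, smul_eq_mul]
  ring

end Hom

/-- The valences add up to the number of half-edges, each leaf contributing one. With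
`card_relation` the dimension goes up by one for every collapsed edge. -/
lemma dim_add (Γ : LeafedFatGraph) : Γ.dim + 3 * Nat.card Γ.V = Nat.card Γ.H + 2 * Γ.n := by
  classical
  have := Fintype.ofFinite Γ.V
  have hH : Nat.card Γ.H = ∑ v, Γ.val v := by
    rw [← Nat.card_congr (Equiv.sigmaFiberEquiv Γ.s), Nat.card_sigma]
    rfl
  have hrange : Nat.card {v // v ∈ Set.range Γ.leaf} = Γ.n :=
    (Nat.card_congr (Equiv.ofInjective _ Γ.leaf_injective).symm).trans (Nat.card_fin _)
  have hone : ∀ p : Γ.V → Prop, (∀ v, p v → Γ.val v = 1) →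
      ∑ v, Γ.val v = Nat.card {v // p v} + ∑ v : {v // ¬ p v}, Γ.val v.1 := fun p hp => by
    rw [← Fintype.sum_subtype_add_sum_subtype p Γ.val,
      Finset.sum_congr rfl (g := fun _ => 1) (fun v _ => hp v.1 v.2), Finset.sum_const,
      Finset.card_univ, smul_eq_mul, mul_one, Nat.card_eq_fintype_card]
  have hsplit : ∑ v, Γ.val v = Γ.n + ∑ v : Γ.Interior, Γ.val v.1 := by
    rw [hone (fun v => v ∈ Set.range Γ.leaf) (by rintro _ ⟨j, rfl⟩; exact Γ.val_leaf j), hrange]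
    congr!
  have hV : Nat.card Γ.V = Γ.n + Fintype.card Γ.Interior := by
    have h1 := Nat.card_congr (Equiv.sumCompl (fun v => v ∈ Set.range Γ.leaf))
    rw [Nat.card_sum, hrange] at h1
    rw [← h1, ← Nat.card_eq_fintype_card]
  have hdim : Γ.dim + 3 * Fintype.card Γ.Interior = ∑ v : Γ.Interior, Γ.val v.1 := by
    rw [dim, finsum_eq_sum_of_fintype, mul_comm, ← smul_eq_mul, ← Finset.card_univ,
      ← Finset.sum_const, ← Finset.sum_add_distrib]
    refine Finset.sum_congr rfl fun v _ => ?_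
    have := Γ.three_le_val v.1 v.2
    omega
  omega

/-- A morphism lowers the dimension of its source, unless it is an isomorphism. -/
lemma dim_lt_or (f : Γ ⟶ Δ) : Γ.dim < Δ.dim ∨ ∃ e : Γ ≅ Δ, e.hom = f := by
  by_cases hf : ∃ A, Hom.Collapsed f A
  · left
    obtain ⟨A, hA⟩ := hf
    have hlt : Nat.card Δ.H < Nat.card Γ.H := by
      have h1 : Set.range (Hom.lift f) ≠ Set.univ := by
        intro h
        have : A ∈ Set.range (Hom.lift f) := h ▸ trivial
        obtain ⟨B, rfl⟩ := this
        exact Hom.not_collapsed_lift f B hA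
      have h2 : (Set.range (Hom.lift f)).ncard = Nat.card Δ.H := by
        rw [← Set.image_univ, Set.ncard_image_of_injective _ (Hom.lift_injective f),
          Set.ncard_univ]
      rw [← h2, ← Set.ncard_univ]
      exact Set.ncard_lt_ncard (Set.ssubset_univ_iff.2 h1)
    have h1 := Γ.dim_add
    have h2 := Δ.dim_add
    have h3 := Hom.card_relation f
    have h4 := Hom.n_eq f
    omega
  · right
    -- When nothing is collapsed the dissection is empty, so the identity of `Δ` factors through
    -- `f`.
    obtain ⟨k, hk⟩ := Hom.exists_comp_eq_of_le (𝟙 Δ) f (by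
      rintro b c ⟨A, hA, -⟩
      exact absurd ⟨A, hA⟩ hf)
    refine ⟨⟨f, k, Hom.eq_of_comp_eq (g := f) ?_, hk⟩, rfl⟩
    rw [Category.assoc, hk, Category.comp_id, Category.id_comp]

end LeafedFatGraph

/-! ### The grading and the cube model of the categories over bordered fat graphs -/

open LeafedFatGraph

/-- The grading of the category of bordered fat graphs by dimension. -/
noncomputable def Fatb.grading : Grading Fatb where
  d := Fatb.dim
  lt_or {x y} φ := by
    obtain ⟨X, rfl⟩ := IsoClass.exists_mk x
    obtain ⟨Y, rfl⟩ := IsoClass.exists_mk y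
    obtain ⟨f, rfl⟩ := IsoClass.exists_homMk φ
    rcases dim_lt_or f.hom with h | ⟨e, he⟩
    · exact Or.inl h
    · right
      have h1 := IsoClass.exists_eqToHom (LeafedFatGraph.isBordered.isoMk e)
      rwa [show (LeafedFatGraph.isBordered.isoMk e).hom = f from
        ObjectProperty.hom_ext _ he] at h1

namespace BorderedFatGraph

variable (Γ : BorderedFatGraph)

lemma exists_comp_eq_iff {X Y : BorderedFatGraph} (f : X ⟶ Γ) (g : Y ⟶ Γ) :
    (∃ k : X ⟶ Y, k ≫ g = f) ↔
      ∀ b c, (Hom.dissection g.hom).rel b c → (Hom.dissection f.hom).rel b c := by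
  constructor
  · rintro ⟨k, rfl⟩ b c h
    exact Hom.dissection_le_of_comp k.hom g.hom h
  · intro h
    obtain ⟨k, hk⟩ := Hom.exists_comp_eq_of_le f.hom g.hom h
    exact ⟨ObjectProperty.homMk k, ObjectProperty.hom_ext _ hk⟩

/-- A representative of an object over the isomorphism class of a bordered fat graph. -/
noncomputable def overRep (Y : Over (IsoClass.mk Γ)) : Σ X : BorderedFatGraph, X ⟶ Γ :=
  ⟨_, (IsoClass.exists_overMk Y).choose_spec.choose⟩

lemma overMk_overRep (Y : Over (IsoClass.mk Γ)) :
    Over.mk (IsoClass.homMk (overRep Γ Y).2) = Y :=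
  (IsoClass.exists_overMk Y).choose_spec.choose_spec

/-- The dissection corresponding to an object over the isomorphism class of a bordered fat
graph. -/
noncomputable def overDissection (Y : Over (IsoClass.mk Γ)) : Dissection Γ.obj :=
  Hom.dissection (overRep Γ Y).2.hom

lemma nonempty_over_hom_iff (X Y : Over (IsoClass.mk Γ)) : Nonempty (X ⟶ Y) ↔
    ∀ b c, (overDissection Γ Y).rel b c → (overDissection Γ X).rel b c := by
  conv_lhs => rw [← overMk_overRep Γ X, ← overMk_overRep Γ Y]
  rw [IsoClass.nonempty_over_hom_iff, exists_comp_eq_iff]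
  rfl

lemma over_isThin : Quiver.IsThin (Over (IsoClass.mk Γ)) :=
  IsoClass.over_isThin fun _ _ _ h => ObjectProperty.hom_ext _
    (Hom.eq_of_comp_eq (congrArg InducedCategory.Hom.hom h))

/-- Morphisms in both directions over `Γ` are mutually inverse by cancellation, and isomorphic
objects over a class are equal. -/
lemma eq_of_over_homs {X Y : Over (IsoClass.mk Γ)} (f : X ⟶ Y) (g : Y ⟶ X) : X = Y := by
  have := over_isThin Γ
  rw [← overMk_overRep Γ X, ← overMk_overRep Γ Y] at f g ⊢
  obtain ⟨k, hk⟩ := IsoClass.nonempty_over_hom_iff.1 ⟨f⟩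
  obtain ⟨l, hl⟩ := IsoClass.nonempty_over_hom_iff.1 ⟨g⟩
  have hcancel : ∀ {A B : BorderedFatGraph} (p q : A ⟶ B) (r : B ⟶ Γ), p ≫ r = q ≫ r → p = q :=
    fun _ _ _ h => ObjectProperty.hom_ext _
      (Hom.eq_of_comp_eq (congrArg InducedCategory.Hom.hom h))
  refine IsoClass.overMk_homMk_eq ⟨k, l, ?_, ?_⟩ hk
  · exact hcancel _ _ _ (by rw [Category.assoc, hl, hk, Category.id_comp])
  · exact hcancel _ _ _ (by rw [Category.assoc, hk, hl, Category.id_comp])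

/-- The expansion with its projection. The chosen representative of its class factors through it and
conversely, so it has the same dissection. -/
lemma exists_overDissection_eq (D : Dissection Γ.obj) : ∃ Y, overDissection Γ Y = D := by
  let X : BorderedFatGraph := ⟨D.expand, Hom.isBordered_of_hom D.proj Γ.property⟩
  let f : X ⟶ Γ := ObjectProperty.homMk D.proj
  refine ⟨Over.mk (IsoClass.homMk f), ?_⟩
  have h := overMk_overRep Γ (Over.mk (IsoClass.homMk f))
  have h1 := (exists_comp_eq_iff Γ _ _).1 (IsoClass.nonempty_over_hom_iff.1 ⟨eqToHom h⟩)
  have h2 := (exists_comp_eq_iff Γ _ _).1 (IsoClass.nonempty_over_hom_iff.1 ⟨eqToHom h.symm⟩)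
  have h3 : Hom.dissection f.hom = D := D.dissection_proj
  rw [h3] at h1 h2
  exact Dissection.ext (funext fun b => funext fun c => propext ⟨h2 b c, h1 b c⟩)

/-- The category over a bordered fat graph is modelled by the dissections of the polygons dual to
its interior vertices. -/
noncomputable def overModel : CubeModel (Over (IsoClass.mk Γ))
    (Σ v : Γ.obj.Interior, Diagonal (Γ.obj.val v.1))
    (CubeModel.SigmaRel fun _ => Diagonal.Noncrossing) where
  D Y := {e | e.2 ∈ (overDissection Γ Y).diagAt e.1.1 (Γ.obj.val e.1.1)}
  thin := over_isThin Γ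
  nonempty_hom_iff X Y := by
    rw [nonempty_over_hom_iff]
    constructor
    · exact fun h e he => Dissection.diagAt_mono h _ _ he
    · exact fun h b c hbc => Dissection.le_of_diagAt_subset
        (fun v hv d hd => h (a := ⟨⟨v, hv⟩, d⟩) hd) hbc
  injective X Y h := by
    have key : ∀ {X Y : Over (IsoClass.mk Γ)},
        {e : Σ v : Γ.obj.Interior, Diagonal (Γ.obj.val v.1) |
          e.2 ∈ (overDissection Γ X).diagAt e.1.1 (Γ.obj.val e.1.1)} =
        {e | e.2 ∈ (overDissection Γ Y).diagAt e.1.1 (Γ.obj.val e.1.1)} → Nonempty (X ⟶ Y) := by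
      intro X Y h
      rw [nonempty_over_hom_iff]
      exact fun b c hbc => Dissection.le_of_diagAt_subset
        (fun v hv d hd => (Set.ext_iff.1 h ⟨⟨v, hv⟩, d⟩).2 hd) hbc
    exact eq_of_over_homs Γ (key h).some (key h.symm).some
  compat X := by
    rintro _ he _ he' v a b rfl rfl
    exact Dissection.diagAt_noncrossing _ he he'
  exists_eq S hS := by
    obtain ⟨Y, hY⟩ := exists_overDissection_eq Γ (Dissection.ofDiagonals
      (fun v => {d | ⟨v, d⟩ ∈ S}) (fun v d hd d' hd' => hS _ hd _ hd' v d d' rfl rfl))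
    refine ⟨Y, ?_⟩
    ext ⟨v, d⟩
    change d ∈ (overDissection Γ Y).diagAt v.1 (Γ.obj.val v.1) ↔ _
    rw [hY, Dissection.diagAt_ofDiagonals]
    rfl

end BorderedFatGraph

end

/-! ### Planar trees and corollas -/

namespace LeafedFatGraph

variable {Γ Δ : LeafedFatGraph}

namespace Dissection

lemma le_of_diagAt_subset_of_unique {D D' : Dissection Γ} {v : Γ.V}
    (hv : ∀ u, u ∉ Set.range Γ.leaf → u = v) {k : ℕ} (hk : Γ.val v = k)
    (h : D.diagAt v k ⊆ D'.diagAt v k) {b c : Γ.H} (hbc : D.rel b c) : D'.rel b c := by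
  subst hk
  refine le_of_diagAt_subset (fun u hu => ?_) hbc
  obtain rfl := hv u hu
  exact h

lemma exists_diagAt_eq {v : Γ.V} (hv : v ∉ Set.range Γ.leaf) {k : ℕ} (hk : Γ.val v = k)
    (S : Set (Diagonal k)) (hS : ∀ d ∈ S, ∀ d' ∈ S, Diagonal.Noncrossing d d') :
    ∃ D : Dissection Γ, D.diagAt v k = S := by
  subst hk
  -- The diagonals are compared through their pairs of corners, because the size of the polygon
  -- varies with `u`.
  refine ⟨ofDiagonals (fun u => {d | u.1 = v ∧ ∃ d' ∈ S, d'.1 = d.1}) ?_, ?_⟩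
  · rintro u d ⟨-, d', hd', h⟩ e ⟨-, e', he', h'⟩
    have := hS d' hd' e' he'
    unfold Diagonal.Noncrossing at this ⊢
    rwa [h, h'] at this
  · rw [diagAt_ofDiagonals (v := ⟨v, hv⟩)]
    ext d
    constructor
    · rintro ⟨-, d', hd', h⟩
      rwa [← Subtype.ext h]
    · exact fun hd => ⟨rfl, d, hd, rfl⟩

end Dissection

/-- The source of a morphism to a planar tree is a planar tree. -/
lemma Hom.isPlanarTree_of_hom (f : Hom Γ Δ) {k : ℕ} (h : LeafedFatGraph.isPlanarTree k Δ) :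
    LeafedFatGraph.isPlanarTree k Γ := by
  obtain ⟨hn, htree, hleaf⟩ := h
  refine ⟨f.n_eq.trans hn, f.isTree_preimage htree, fun j => ?_⟩
  obtain ⟨A, hA, m, hm, h1, h2⟩ := hleaf (Fin.cast f.n_eq j)
  obtain ⟨K, hK, h3, h4⟩ := f.map_ω_pow (f.map_lift A) m hm
  refine ⟨f.lift A, f.s_lift_leaf hA, K, hK, ?_, ?_⟩
  · rw [f.eq_lift h3, f.s_lift_leaf h1]
    congr 1
    apply Fin.ext
    simp [f.n_eq]
  · rintro l hl hlK ⟨j', hj'⟩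
    obtain ⟨B, hB, hsB⟩ := f.exists_lift_of_leaf hj'.symm
    rcases h4 l hl hlK with ⟨w, hw⟩ | ⟨l', hl', hlm, h5⟩
    · rw [hB, f.map_lift] at hw
      cases hw
    · rw [hB, f.map_lift, Sum.inr.injEq] at h5
      exact h2 l' hl' hlm ⟨_, by rw [← h5, hsB]⟩

/-! ### Corollas -/

lemma val_finRotate {k : ℕ} (j : Fin k) : (finRotate k j).1 = (j.1 + 1) % k := by
  cases k with
  | zero => exact j.elim0
  | succ k => rw [finRotate_apply, Fin.val_add, Fin.val_one']; simp

/-- The graph with one interior vertex and `k` leaves.  The half-edges are numbered by the leaves;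
those in the left summand issue from the leaves, those in the right one from the centre. -/
abbrev corollaGraph (k : ℕ) : CombGraph where
  V := Option (Fin k)
  H := Fin k ⊕ Fin k
  finV := inferInstance
  finH := inferInstance
  s := Sum.elim some fun _ => none
  i := Sum.swap
  i_i := Sum.swap_swap
  i_ne := by rintro (j | j) <;> simp

lemma corollaGraph_connected (k : ℕ) :
    (corollaGraph k).IsConnectedSubgraph Set.univ where
  s_mem _ _ := trivial
  i_mem _ _ := trivial
  nonempty := ⟨(none : Option (Fin k)), trivial⟩
  walk := by
    have h : ∀ j : Fin k, (corollaGraph k).Walk Set.univ (none : Option (Fin k)) (some j) :=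
      fun j => .single ⟨Sum.inr j, trivial, rfl, rfl⟩
    have h' : ∀ j : Fin k, (corollaGraph k).Walk Set.univ (some j : Option (Fin k)) none :=
      fun j => .single ⟨Sum.inl j, trivial, rfl, rfl⟩
    rintro (_ | a) (_ | b) - -
    · exact .refl
    · exact h b
    · exact h' a
    · exact (h' a).trans (h b)

lemma corollaGraph_val_some {k : ℕ} (j : Fin k) : (corollaGraph k).val (some j) = 1 := by
  refine Nat.card_eq_one_iff_exists.2 ⟨⟨Sum.inl j, rfl⟩, ?_⟩
  rintro ⟨l | l, hl⟩
  · exact Subtype.ext (congrArg Sum.inl (Option.some_injective _ hl))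
  · cases hl

lemma corollaGraph_val_none (k : ℕ) : (corollaGraph k).val (none : Option (Fin k)) = k := by
  conv_rhs => rw [← Nat.card_fin k]
  symm
  refine Nat.card_eq_of_bijective (fun j => ⟨Sum.inr j, rfl⟩) ⟨fun a b h => ?_, ?_⟩
  · exact Sum.inr_injective (congrArg Subtype.val h)
  · rintro ⟨l | l, hl⟩
    · cases hl
    · exact ⟨l, rfl⟩

/-- The corolla with `k` leaves. -/
def corolla (k : ℕ) (hk : 3 ≤ k) : LeafedFatGraph where
  toCombGraph := corollaGraph k
  connected := corollaGraph_connected k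
  σ := Equiv.sumCongr (Equiv.refl _) (finRotate k)
  s_σ := by rintro (j | j) <;> rfl
  cyclic := by
    rintro (a | a) (b | b) h
    · rw [Option.some_injective _ h]
    · cases h
    · cases h
    · have hs : ∀ c, c ∈ (finRotate k).support := fun c => by
        rw [support_finRotate_of_le (by omega)]
        exact Finset.mem_univ c
      obtain ⟨m, -, hm⟩ := ((isCycle_finRotate_of_le (by omega : 2 ≤ k)).sameCycle
        (Equiv.Perm.mem_support.1 (hs a)) (Equiv.Perm.mem_support.1 (hs b))).exists_pow_eq'
      have key : ∀ m : ℕ, ((Equiv.sumCongr (Equiv.refl (Fin k)) (finRotate k) :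
          Equiv.Perm (Fin k ⊕ Fin k)) ^ m) (Sum.inr a) = Sum.inr ((finRotate k ^ m) a) := by
        intro m
        induction m with
        | zero => rfl
        | succ m ih => rw [pow_succ', pow_succ', Equiv.Perm.mul_apply, ih]; rfl
      exact ⟨m, by rw [← hm]; exact_mod_cast key m⟩
  n := k
  n_pos := by omega
  leaf := some
  leaf_injective := Option.some_injective _
  val_leaf := corollaGraph_val_some
  three_le_val := by
    rintro (_ | j) h
    · exact hk.trans_eq (corollaGraph_val_none k).symm
    · exact absurd ⟨j, rfl⟩ h

lemma isPlanarTree_corolla (k : ℕ) (hk : 3 ≤ k) : isPlanarTree k (corolla k hk) := by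
  refine ⟨rfl, ⟨corollaGraph_connected k, ?_⟩, fun j => ⟨Sum.inl j, rfl, 2, two_pos, ?_, ?_⟩⟩
  · have h1 : Nat.card {v : (corolla k hk).V // Sum.inl v ∈ (univ : Set (corolla k hk).Elt)} =
        k + 1 := by
      refine (Nat.card_congr (Equiv.subtypeUnivEquiv fun _ => trivial)).trans ?_
      exact (Finite.card_option (α := Fin k)).trans (by rw [Nat.card_fin])
    have h2 : Nat.card {v : (corolla k hk).H // Sum.inr v ∈ (univ : Set (corolla k hk).Elt)} =
        k + k := by
      refine (Nat.card_congr (Equiv.subtypeUnivEquiv fun _ => trivial)).trans ?_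
      exact (Nat.card_sum (α := Fin k) (β := Fin k)).trans (by rw [Nat.card_fin])
    rw [h1, h2]
    omega
  · change some (finRotate k j) = some _
    exact congrArg some (Fin.ext (val_finRotate j))
  · intro l hl hl2
    obtain rfl : l = 1 := by omega
    rintro ⟨j', hj'⟩
    cases hj'

lemma eq_none_of_not_mem_leaf_corolla {k : ℕ} {hk : 3 ≤ k} (u : (corolla k hk).V)
    (hu : u ∉ Set.range (corolla k hk).leaf) : u = (none : Option (Fin k)) := by
  rcases u with _ | j
  · rfl
  · exact absurd ⟨j, rfl⟩ hu

/-- Every edge of the corolla ends in a leaf, and the half-edge over one at a leaf is forced.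
Together with `exists_hom_corolla` this makes the corolla terminal among planar trees. -/
lemma hom_corolla_ext {k : ℕ} {hk : 3 ≤ k} (f g : Γ ⟶ corolla k hk) : f = g := by
  have key : ∀ j : Fin k, Hom.lift f (Sum.inl j : Fin k ⊕ Fin k) =
      Hom.lift g (Sum.inl j : Fin k ⊕ Fin k) := fun j =>
    Γ.eq_of_s_leaf (Hom.s_lift_leaf f (j := j) rfl) (Hom.s_lift_leaf g (j := j) rfl)
  refine Hom.ext_lift ?_
  rintro (j | j)
  · exact key j
  · have h1 := Hom.i_lift f (Sum.inl j : Fin k ⊕ Fin k)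
    have h2 := Hom.i_lift g (Sum.inl j : Fin k ⊕ Fin k)
    rw [key] at h1
    exact h1.symm.trans h2

/-! ### The collapse of a planar tree onto the corolla -/

namespace ToCorolla

variable (T : LeafedFatGraph)

open Classical in
/-- The number of a leaf. -/
noncomputable def label (v : T.V) : Option (Fin T.n) :=
  if h : ∃ j, T.leaf j = v then some h.choose else none

variable {T}

lemma label_eq_some {v : T.V} {j : Fin T.n} : label T v = some j ↔ T.leaf j = v := by
  unfold label
  split_ifs with h
  · rw [Option.some_inj]
    constructor
    · rintro rfl
      exact h.choose_spec
    · exact fun h' => T.leaf_injective (h.choose_spec.trans h'.symm)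
  · exact ⟨fun h' => (by cases h'), fun h' => absurd ⟨j, h'⟩ h⟩

lemma label_eq_none {v : T.V} : label T v = none ↔ v ∉ Set.range T.leaf := by
  rw [Option.eq_none_iff_forall_ne_some]
  exact ⟨fun h ⟨j, hj⟩ => h j (label_eq_some.2 hj), fun h j hj => h ⟨j, label_eq_some.1 hj⟩⟩

lemma label_leaf (j : Fin T.n) : label T (T.leaf j) = some j := label_eq_some.2 rfl

lemma eq_baseAt {A : T.H} {j : Fin T.n} (h : label T (T.s A) = some j) :
    A = T.baseAt (T.leaf j) :=
  T.eq_of_s_leaf (label_eq_some.1 h).symm (T.s_baseAt _)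

/-- An edge joining two leaves would be a whole component, leaving at most two leaves. -/
lemma label_s_i (h3 : 3 ≤ T.n) {A : T.H} {j : Fin T.n} (h : label T (T.s A) = some j) :
    label T (T.s (T.i A)) = none := by
  by_contra hne
  obtain ⟨j', hj'⟩ := Option.ne_none_iff_exists'.1 hne
  have key : ∀ v, v = T.leaf j ∨ v = T.leaf j' := by
    intro v
    have hw := T.connected.walk (T.leaf j) v trivial trivial
    induction hw with
    | refl => exact Or.inl rfl
    | tail _ hs ih =>
      obtain ⟨B, -, rfl, rfl⟩ := hs
      rcases ih with ih | ih
      · rw [T.eq_of_s_leaf ih (label_eq_some.1 h).symm]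
        exact Or.inr (label_eq_some.1 hj').symm
      · rw [T.eq_of_s_leaf ih (label_eq_some.1 hj').symm, T.i_i]
        exact Or.inl (label_eq_some.1 h).symm
  have hle : Nat.card (Fin T.n) ≤ Nat.card ({j, j'} : Set (Fin T.n)) :=
    Nat.card_le_card_of_injective (fun l => ⟨l, by
      rcases key (T.leaf l) with h | h
      · exact Or.inl (T.leaf_injective h)
      · exact Or.inr (T.leaf_injective h)⟩) fun a b hab => congrArg Subtype.val hab
  rw [Nat.card_fin, Nat.card_coe_set_eq] at hle
  have := Set.ncard_insert_le j {j'}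
  rw [Set.ncard_singleton] at this
  omega

/-- The map on half-edges, in terms of the labels of the two ends. -/
def ofLabels {k : ℕ} : Option (Fin k) → Option (Fin k) → (corollaGraph k).Elt
  | some j, _ => Sum.inr (Sum.inl j)
  | none, some j => Sum.inr (Sum.inr j)
  | none, none => Sum.inl (none : Option (Fin k))

variable (T) in
/-- The map from a planar tree to the corolla that collapses all interior edges. -/
noncomputable def map : T.Elt → (corollaGraph T.n).Elt :=
  Sum.elim (fun v => Sum.inl (label T v)) fun A => ofLabels (label T (T.s A)) (label T (T.s (T.i A)))

lemma map_inr_eq_inl_iff {A : T.H} {w : Option (Fin T.n)} : map T (Sum.inr A) = Sum.inl w ↔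
    w = none ∧ label T (T.s A) = none ∧ label T (T.s (T.i A)) = none := by
  change ofLabels (label T (T.s A)) (label T (T.s (T.i A))) = Sum.inl w ↔ _
  rcases label T (T.s A) with _ | j <;> rcases label T (T.s (T.i A)) with _ | j' <;>
    simp [ofLabels, eq_comm]

lemma map_inr_eq_inl {A : T.H} {j : Fin T.n} :
    map T (Sum.inr A) = Sum.inr (Sum.inl j) ↔ A = T.baseAt (T.leaf j) := by
  have : A = T.baseAt (T.leaf j) ↔ label T (T.s A) = some j := by
    refine ⟨?_, eq_baseAt⟩
    rintro rfl
    rw [s_baseAt, label_leaf]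
  rw [this]
  change ofLabels (label T (T.s A)) (label T (T.s (T.i A))) = _ ↔ _
  rcases label T (T.s A) with _ | j <;> rcases label T (T.s (T.i A)) with _ | j' <;>
    simp [ofLabels]

lemma map_inr_eq_inr (h3 : 3 ≤ T.n) {A : T.H} {j : Fin T.n} :
    map T (Sum.inr A) = Sum.inr (Sum.inr j) ↔ A = T.i (T.baseAt (T.leaf j)) := by
  have : A = T.i (T.baseAt (T.leaf j)) ↔ label T (T.s (T.i A)) = some j := by
    refine ⟨?_, fun h => by rw [← eq_baseAt h, T.i_i]⟩
    rintro rfl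
    rw [T.i_i, s_baseAt, label_leaf]
  rw [this]
  change ofLabels (label T (T.s A)) (label T (T.s (T.i A))) = _ ↔ _
  rcases hA : label T (T.s A) with _ | j
  · rcases label T (T.s (T.i A)) with _ | j' <;> simp [ofLabels]
  · rw [label_s_i h3 hA]
    simp [ofLabels]

lemma map_sExt (x : T.Elt) : map T (T.sExt x) = (corollaGraph T.n).sExt (map T x) := by
  rcases x with v | A
  · rfl
  · change Sum.inl (label T (T.s A)) =
      (corollaGraph T.n).sExt (ofLabels (label T (T.s A)) (label T (T.s (T.i A))))
    rcases label T (T.s A) with _ | j <;> rcases label T (T.s (T.i A)) with _ | j' <;> rfl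

lemma map_iExt (h3 : 3 ≤ T.n) (x : T.Elt) :
    map T (T.iExt x) = (corollaGraph T.n).iExt (map T x) := by
  rcases x with v | A
  · rfl
  · change ofLabels (label T (T.s (T.i A))) (label T (T.s (T.i (T.i A)))) =
      (corollaGraph T.n).iExt (ofLabels (label T (T.s A)) (label T (T.s (T.i A))))
    rw [T.i_i]
    rcases hA : label T (T.s A) with _ | j
    · rcases label T (T.s (T.i A)) with _ | j' <;> rfl
    · rw [label_s_i h3 hA]
      rfl

lemma single (h3 : 3 ≤ T.n) (B : (corollaGraph T.n).H) :
    ∃! A : T.H, map T (Sum.inr A) = Sum.inr B := by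
  rcases B with j | j
  · exact ⟨_, map_inr_eq_inl.2 rfl, fun A => map_inr_eq_inl.1⟩
  · exact ⟨_, (map_inr_eq_inr h3).2 rfl, fun A => (map_inr_eq_inr h3).1⟩

/-- The interior vertex next to a leaf, or the given interior vertex. -/
noncomputable def core (v : T.V) : T.V :=
  (label T v).elim v fun j => T.s (T.i (T.baseAt (T.leaf j)))

lemma core_leaf (j : Fin T.n) : core (T.leaf j) = T.s (T.i (T.baseAt (T.leaf j))) := by
  rw [core, label_leaf]
  rfl

lemma core_of_label {v : T.V} (h : label T v = none) : core v = v := by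
  rw [core, h]
  rfl

/-- Removing the leaves with their edges from a tree leaves a tree: walks are retracted by `core`,
and the count loses `n` vertices and `2 * n` half-edges. -/
lemma isTree_center (hT : T.IsTree Set.univ) (h3 : 3 ≤ T.n) :
    T.IsTree (map T ⁻¹' {Sum.inl (none : Option (Fin T.n))}) where
  s_mem x hx := by
    change map T _ = _
    rw [map_sExt, show map T x = _ from hx]
    rfl
  i_mem x hx := by
    change map T _ = _
    rw [map_iExt h3, show map T x = _ from hx]
    rfl
  nonempty := by
    refine ⟨T.s (T.i (T.baseAt (T.leaf ⟨0, T.n_pos⟩))), ?_⟩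
    exact congrArg Sum.inl (label_s_i h3 (j := ⟨0, T.n_pos⟩) (by rw [s_baseAt, label_leaf]))
  walk u v hu hv := by
    have hu' : label T u = none := Sum.inl_injective hu
    have hv' : label T v = none := Sum.inl_injective hv
    have key : T.Walk (map T ⁻¹' {Sum.inl (none : Option (Fin T.n))}) u (core v) := by
      have hw := T.connected.walk u v trivial trivial
      clear hv hv'
      induction hw with
      | refl =>
        rw [core_of_label hu']
        exact .refl
      | tail _ hs ih =>
        obtain ⟨A, -, rfl, rfl⟩ := hs
        rcases hA : label T (T.s A) with _ | j
        · rw [core_of_label hA] at ih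
          rcases hiA : label T (T.s (T.i A)) with _ | j'
          · rw [core_of_label hiA]
            exact ih.tail ⟨A, map_inr_eq_inl_iff.2 ⟨rfl, hA, hiA⟩, rfl, rfl⟩
          · have h1 := eq_baseAt hiA
            rw [← label_eq_some.1 hiA, core_leaf, ← h1, T.i_i]
            exact ih
        · have h1 := eq_baseAt hA
          rw [← label_eq_some.1 hA, core_leaf, ← h1] at ih
          rwa [core_of_label (label_s_i h3 hA)]
    rwa [core_of_label hv'] at key
  euler := by
    have hV : Nat.card {v : T.V // Sum.inl v ∈ map T ⁻¹' {Sum.inl (none : Option (Fin T.n))}} +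
        T.n = Nat.card T.V := by
      refine (congrArg (_ + ·) (Nat.card_fin T.n).symm).trans (Nat.card_sum.symm.trans ?_)
      refine Nat.card_eq_of_bijective (Sum.elim Subtype.val T.leaf) ⟨?_, fun v => ?_⟩
      · have hdisj : ∀ v : {v : T.V // Sum.inl v ∈ map T ⁻¹' {Sum.inl (none : Option (Fin T.n))}},
            ∀ j, v.1 ≠ T.leaf j := fun v j hj =>
          label_eq_none.1 (Sum.inl_injective v.2) ⟨j, hj.symm⟩
        exact Function.Injective.sumElim Subtype.val_injective T.leaf_injective hdisj
      · rcases hv : label T v with _ | j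
        · exact ⟨Sum.inl ⟨v, congrArg Sum.inl hv⟩, rfl⟩
        · exact ⟨Sum.inr j, label_eq_some.1 hv⟩
    have hH : Nat.card {A : T.H // Sum.inr A ∈ map T ⁻¹' {Sum.inl (none : Option (Fin T.n))}} +
        (T.n + T.n) = Nat.card T.H := by
      choose g hg hg' using single h3
      have hcard : Nat.card (corollaGraph T.n).H = T.n + T.n :=
        (Nat.card_sum (α := Fin T.n) (β := Fin T.n)).trans (by rw [Nat.card_fin])
      rw [← hcard, ← Nat.card_sum]
      refine Nat.card_eq_of_bijective (Sum.elim Subtype.val g) ⟨?_, fun A => ?_⟩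
      · refine Function.Injective.sumElim Subtype.val_injective (fun B C h => ?_) ?_
        · have := hg B
          rw [h, hg] at this
          exact (Sum.inr_injective this).symm
        · rintro ⟨A, hA⟩ B rfl
          have hA' : map T (Sum.inr (g B)) = _ := hA
          rw [hg] at hA'
          cases hA'
      · rcases hA : map T (Sum.inr A) with w | B
        · obtain ⟨rfl, -⟩ := map_inr_eq_inl_iff.1 hA
          exact ⟨Sum.inl ⟨A, hA⟩, rfl⟩
        · exact ⟨Sum.inr B, (hg' B A hA).symm⟩
    have h := hT.euler
    have e1 : Nat.card {v : T.V // Sum.inl v ∈ (univ : Set T.Elt)} = Nat.card T.V :=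
      Nat.card_congr (Equiv.subtypeUnivEquiv fun _ => trivial)
    have e2 : Nat.card {A : T.H // Sum.inr A ∈ (univ : Set T.Elt)} = Nat.card T.H :=
      Nat.card_congr (Equiv.subtypeUnivEquiv fun _ => trivial)
    rw [e1, e2] at h
    omega

lemma isTree_fibre (hT : T.IsTree Set.univ) (h3 : 3 ≤ T.n) (w : (corollaGraph T.n).V) :
    T.IsTree (map T ⁻¹' {Sum.inl w}) := by
  rcases w with _ | j
  · exact isTree_center hT h3
  · refine CombGraph.isTree_of_unique (v := T.leaf j) (fun u => ?_) (fun A h => ?_)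
    · change Sum.inl (label T u) = Sum.inl (some j) ↔ _
      rw [Sum.inl.injEq, label_eq_some, eq_comm]
    · cases (map_inr_eq_inl_iff.1 h).1

lemma σ_baseAt_leaf (j : Fin T.n) : T.σ (T.baseAt (T.leaf j)) = T.baseAt (T.leaf j) :=
  T.eq_of_s_leaf (by rw [T.s_σ, s_baseAt]) (T.s_baseAt _)

lemma map_ω (h3 : 3 ≤ T.n)
    (hleaf : ∀ j : Fin T.n, ∃ A, T.s A = T.leaf j ∧ ∃ m, 0 < m ∧
      T.s ((T.ω ^ m) A) = T.leaf ⟨(j + 1) % T.n, Nat.mod_lt _ T.n_pos⟩ ∧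
      ∀ l, 0 < l → l < m → T.s ((T.ω ^ l) A) ∉ Set.range T.leaf)
    (A : T.H) (B : (corolla T.n h3).H) (h : map T (Sum.inr A) = Sum.inr B) : ∃ k, 0 < k ∧
      map T (Sum.inr ((T.ω ^ k) A)) = Sum.inr ((corolla T.n h3).ω B) ∧
      ∀ j, 0 < j → j < k → ∃ w, map T (Sum.inr ((T.ω ^ j) A)) = Sum.inl w := by
  rcases B with j | j
  · obtain rfl := map_inr_eq_inl.1 h
    obtain ⟨A, hA, m, hm, h1, h2⟩ := hleaf j
    obtain rfl : A = T.baseAt (T.leaf j) := T.eq_of_s_leaf hA (T.s_baseAt _)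
    have hrot : (⟨(j + 1) % T.n, Nat.mod_lt _ T.n_pos⟩ : Fin T.n) = finRotate T.n j :=
      Fin.ext (val_finRotate j).symm
    rw [hrot] at h1
    -- After the original number of steps the walk is at the half-edge issuing from the next leaf;
    -- one step earlier it is at the half-edge leading to that leaf, which lies over the required
    -- half-edge of the corolla.
    obtain ⟨m, rfl⟩ : ∃ m', m = m' + 1 := ⟨m - 1, by omega⟩
    rw [pow_succ', Equiv.Perm.mul_apply, ω_apply, T.s_σ] at h1
    have h4 : (T.ω ^ m) (T.baseAt (T.leaf j)) = T.i (T.baseAt (T.leaf (finRotate T.n j))) := by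
      rw [← T.eq_of_s_leaf h1 (T.s_baseAt _), T.i_i]
    refine ⟨m, Nat.pos_of_ne_zero ?_, (map_inr_eq_inr h3).2 h4, fun l hl hlm => ⟨none, ?_⟩⟩
    · rintro rfl
      have h5 := label_s_i h3 (A := T.baseAt (T.leaf (finRotate T.n j))) (j := finRotate T.n j)
        (by rw [s_baseAt, label_leaf])
      rw [← h4] at h5
      change label T (T.s (T.baseAt (T.leaf j))) = none at h5
      rw [s_baseAt, label_leaf] at h5
      cases h5
    · refine map_inr_eq_inl_iff.2 ⟨rfl, label_eq_none.2 (h2 l hl (by omega)), label_eq_none.2 ?_⟩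
      have h5 := h2 (l + 1) (by omega) (by omega)
      rwa [pow_succ', Equiv.Perm.mul_apply, ω_apply, T.s_σ] at h5
  · obtain rfl := (map_inr_eq_inr h3).1 h
    refine ⟨1, one_pos, ?_, fun j h1 h2 => by omega⟩
    rw [pow_one, ω_apply, T.i_i, σ_baseAt_leaf]
    exact map_inr_eq_inl.2 rfl

end ToCorolla

lemma exists_hom_corolla {k : ℕ} (hk : 3 ≤ k) (h : isPlanarTree k Γ) :
    Nonempty (Γ ⟶ corolla k hk) := by
  obtain ⟨rfl, htree, hleaf⟩ := h
  exact ⟨{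
    toFun := ToCorolla.map Γ
    map_s := ToCorolla.map_sExt
    map_i := ToCorolla.map_iExt hk
    tree := ToCorolla.isTree_fibre htree hk
    single := ToCorolla.single hk
    map_ω := ToCorolla.map_ω hk hleaf
    n_eq := rfl
    map_leaf := fun j => congrArg Sum.inl (ToCorolla.label_leaf j) }⟩

end LeafedFatGraph

/-! ### The category of planar trees and the cell structure -/

namespace PlanarTreeCat

open LeafedFatGraph

variable {k : ℕ} (hk : 3 ≤ k)

/-- A representative of an isomorphism class of planar trees. -/
noncomputable def rep (Y : PlanarTreeCat k) : (isPlanarTree k).FullSubcategory :=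
  (IsoClass.exists_mk Y).choose

lemma mk_rep (Y : PlanarTreeCat k) : IsoClass.mk (rep Y) = Y := (IsoClass.exists_mk Y).choose_spec

/-- The map from a representative to the corolla. -/
noncomputable def toCorolla (Y : PlanarTreeCat k) : (rep Y).obj ⟶ corolla k hk :=
  (exists_hom_corolla hk (rep Y).property).some

/-- The dissection of the polygon dual to the centre of the corolla given by a planar tree. -/
noncomputable def dissection (Y : PlanarTreeCat k) : Dissection (corolla k hk) :=
  Hom.dissection (toCorolla hk Y)

lemma rel_of_hom {X Y : PlanarTreeCat k} (f : (rep X).obj ⟶ (rep Y).obj) (b c : (corolla k hk).H)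
    (h : (dissection hk Y).rel b c) : (dissection hk X).rel b c := by
  have := Hom.dissection_le_of_comp f (toCorolla hk Y) h
  rwa [hom_corolla_ext (f ≫ toCorolla hk Y) (toCorolla hk X)] at this

lemma nonempty_hom_iff (X Y : PlanarTreeCat k) : Nonempty (X ⟶ Y) ↔
    ∀ b c, (dissection hk Y).rel b c → (dissection hk X).rel b c := by
  conv_lhs => rw [← mk_rep X, ← mk_rep Y]
  constructor
  · rintro ⟨φ⟩ b c
    obtain ⟨f, -⟩ := IsoClass.exists_homMk φ
    exact rel_of_hom hk f.hom b c
  · intro h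
    obtain ⟨f, -⟩ := Hom.exists_comp_eq_of_le (toCorolla hk X) (toCorolla hk Y) h
    exact ⟨IsoClass.homMk (ObjectProperty.homMk f)⟩

include hk in
lemma rep_hom_ext {X Y : PlanarTreeCat k} (f g : rep X ⟶ rep Y) : f = g :=
  ObjectProperty.hom_ext _ (Hom.eq_of_comp_eq
    (hom_corolla_ext (f.hom ≫ toCorolla hk Y) (g.hom ≫ toCorolla hk Y)))

include hk in
lemma isThin : Quiver.IsThin (PlanarTreeCat k) := by
  intro X Y
  have h : Subsingleton (IsoClass.mk (rep X) ⟶ IsoClass.mk (rep Y)) := ⟨fun φ ψ => by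
    obtain ⟨f, rfl⟩ := IsoClass.exists_homMk φ
    obtain ⟨g, rfl⟩ := IsoClass.exists_homMk ψ
    rw [rep_hom_ext hk f g]⟩
  rwa [mk_rep, mk_rep] at h

include hk in
lemma eq_of_homs {X Y : PlanarTreeCat k} (φ : X ⟶ Y) (ψ : Y ⟶ X) : X = Y := by
  rw [← mk_rep X, ← mk_rep Y] at φ ψ ⊢
  obtain ⟨f, -⟩ := IsoClass.exists_homMk φ
  obtain ⟨g, -⟩ := IsoClass.exists_homMk ψ
  exact IsoClass.mk_eq_mk.2 ⟨⟨f, g, rep_hom_ext hk _ _, rep_hom_ext hk _ _⟩⟩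

/-- The expansion of the corolla is a planar tree, and uniqueness of maps to the corolla makes the
choice of representative irrelevant. -/
lemma exists_dissection_eq (D : Dissection (corolla k hk)) :
    ∃ Y, dissection hk Y = D := by
  let T : (isPlanarTree k).FullSubcategory :=
    ⟨D.expand, Hom.isPlanarTree_of_hom D.proj (isPlanarTree_corolla k hk)⟩
  refine ⟨IsoClass.mk T, ?_⟩
  obtain ⟨e⟩ := IsoClass.mk_eq_mk.1 (mk_rep (IsoClass.mk T))
  rw [← D.dissection_proj]
  refine Dissection.ext (funext fun b => funext fun c => propext ⟨fun h => ?_, fun h => ?_⟩)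
  · have := Hom.dissection_le_of_comp e.inv.hom (toCorolla hk (IsoClass.mk T)) h
    rwa [hom_corolla_ext (e.inv.hom ≫ toCorolla hk (IsoClass.mk T)) D.proj] at this
  · have := Hom.dissection_le_of_comp e.hom.hom D.proj h
    rwa [hom_corolla_ext (e.hom.hom ≫ D.proj) (toCorolla hk (IsoClass.mk T))] at this

lemma nonempty_hom_iff_diagAt (X Y : PlanarTreeCat k) : Nonempty (X ⟶ Y) ↔
    (dissection hk Y).diagAt (none : Option (Fin k)) k ⊆
      (dissection hk X).diagAt (none : Option (Fin k)) k := by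
  rw [nonempty_hom_iff hk]
  exact ⟨fun h => Dissection.diagAt_mono h _ _, fun h b c =>
    Dissection.le_of_diagAt_subset_of_unique eq_none_of_not_mem_leaf_corolla
      (corollaGraph_val_none k) h⟩

/-- The category of planar trees is modelled by the dissections of a polygon. -/
noncomputable def model : CubeModel (PlanarTreeCat k) (Diagonal k) Diagonal.Noncrossing where
  D Y := (dissection hk Y).diagAt (none : Option (Fin k)) k
  thin := isThin hk
  nonempty_hom_iff := nonempty_hom_iff_diagAt hk
  injective X Y h := eq_of_homs hk ((nonempty_hom_iff_diagAt hk X Y).2 h.symm.subset).some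
    ((nonempty_hom_iff_diagAt hk Y X).2 h.subset).some
  compat _ _ hd _ hd' := Dissection.diagAt_noncrossing _ hd hd'
  exists_eq S hS := by
    obtain ⟨D, hD⟩ := Dissection.exists_diagAt_eq (Γ := corolla k hk)
      (v := (none : Option (Fin k))) (by rintro ⟨j, hj⟩; cases hj) (corollaGraph_val_none k) S hS
    obtain ⟨Y, rfl⟩ := exists_dissection_eq hk D
    exact ⟨Y, hD⟩

end PlanarTreeCat

namespace BorderedFatGraph

variable (Γ : BorderedFatGraph)

lemma three_le_val (v : Γ.obj.Interior) : 3 ≤ Γ.obj.val v.1 := Γ.obj.three_le_val v.1 v.2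

/-- Each interior vertex contributes the `val - 3` height coordinates of its polygon, and the
dimension is their total number. -/
lemma card_coordinates {p : ℕ} (hp : Fatb.dim (IsoClass.mk Γ) = p) :
    Nonempty ((Σ v : Γ.obj.Interior, Fin (Γ.obj.val v.1 - 3)) ≃ Fin p) := by
  have := Fintype.ofFinite Γ.obj.Interior
  refine ⟨Fintype.equivFinOfCardEq ?_⟩
  rw [Fintype.card_sigma, ← hp]
  simp only [Fintype.card_fin]
  exact (finsum_eq_sum_of_fintype _).symm

/-- The chart of the cone of weights of the category over a bordered fat graph. -/
noncomputable def overChart {p : ℕ} (hp : Fatb.dim (IsoClass.mk Γ) = p) :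
    ConeChart (Σ v : Γ.obj.Interior, Diagonal (Γ.obj.val v.1)) (Fin p)
      (CubeModel.SigmaRel fun _ => Diagonal.Noncrossing) :=
  (ConeChart.sigma fun v => Diagonal.chart (three_le_val Γ v)).reindex (card_coordinates Γ hp).some

lemma exists_ballHomeo {p : ℕ} (hp : Fatb.dim (IsoClass.mk Γ) = p) :
    ∃ h : Metric.closedBall (0 : Fin p → ℝ) 1 ≃ₜ Realization (Over (IsoClass.mk Γ)),
      ∀ x, x.1 ∈ Metric.sphere (0 : Fin p → ℝ) 1 ↔
        h x ∈ Set.range (realizationMap (overBoundary (IsoClass.mk Γ)).ι) := by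
  have := Fintype.ofFinite (Σ v : Γ.obj.Interior, Diagonal (Γ.obj.val v.1))
  exact ⟨(overModel Γ).ballHomeo (overChart Γ hp),
    (overModel Γ).mem_sphere_iff (overChart Γ hp) (overModel Γ).overBoundary_iff⟩

end BorderedFatGraph

theorem theorem3 :
    ∃ (_ : T2Space (Realization Fatb))
      (_ : Topology.CWComplex (Set.univ : Set (Realization Fatb)))
      (c : ∀ p : ℕ, Topology.CWComplex.cell (Set.univ : Set (Realization Fatb)) p ≃
        {X : Fatb // X.dim = p}),
      (∀ p : ℕ,
        Topology.IsClosedEmbedding (realizationMap (Fatb.dimLE p).ι) ∧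
        Set.range (realizationMap (Fatb.dimLE p).ι) =
          (Topology.CWComplex.skeleton (Set.univ : Set (Realization Fatb)) (p : ℕ∞) :
            Set (Realization Fatb))) ∧
      ∀ (p : ℕ) (Γ : BorderedFatGraph) (hΓ : Fatb.dim (IsoClass.mk Γ) = p),
        (∃ h : Metric.closedBall (0 : Fin p → ℝ) 1 ≃ₜ Realization (Over (IsoClass.mk Γ)),
          (∀ x, Topology.CWComplex.map (C := (Set.univ : Set (Realization Fatb))) p
              ((c p).symm ⟨IsoClass.mk Γ, hΓ⟩) x.1 =
            realizationMap (Over.forget (IsoClass.mk Γ)) (h x)) ∧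
          ∀ x, x.1 ∈ Metric.sphere (0 : Fin p → ℝ) 1 ↔
            h x ∈ Set.range (realizationMap (overBoundary (IsoClass.mk Γ)).ι)) ∧
        ∃ F : Over (IsoClass.mk Γ) ⥤
            (∀ v : Γ.obj.Interior, PlanarTreeCat (Γ.obj.val v.1)),
          F.IsEquivalence ∧ Function.Bijective F.obj ∧
          IsHomeomorph (fun (x : Realization (Over (IsoClass.mk Γ))) (v : Γ.obj.Interior) =>
            realizationMap (F ⋙ Pi.eval _ v) x) := by
  have hball : ∀ p (X : {X : Fatb // Fatb.grading.d X = p}),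
      ∃ h : Metric.closedBall (0 : Fin p → ℝ) 1 ≃ₜ Realization (Over X.1),
        ∀ x, x.1 ∈ Metric.sphere (0 : Fin p → ℝ) 1 ↔
          h x ∈ Set.range (realizationMap (overBoundary X.1).ι) := by
    rintro p ⟨X, hX⟩
    obtain ⟨Γ, rfl⟩ := IsoClass.exists_mk X
    exact BorderedFatGraph.exists_ballHomeo Γ hX
  choose h hb using hball
  have hfin : ∀ X : Fatb, Finite (Over X) := fun X => by
    obtain ⟨Γ, rfl⟩ := IsoClass.exists_mk X
    exact (BorderedFatGraph.overModel Γ).finite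
  have ht2 := Realization.t2Space Fatb.grading
  -- The cells of `cwComplex` are by construction the objects of a given degree, and the degree is
  -- the dimension.
  refine ⟨ht2, Realization.cwComplex h hb, fun p => Equiv.refl _, fun p => ⟨?_, ?_⟩, fun p Γ hΓ => ⟨?_, ?_⟩⟩
  · exact Realization.isClosedEmbedding_realizationMap_ι (Fatb.dimLE p) Fatb.grading
  · exact Realization.range_realizationMap_eq_skeleton h hb p
  · refine ⟨h p ⟨IsoClass.mk Γ, hΓ⟩, fun x => ?_, hb p ⟨IsoClass.mk Γ, hΓ⟩⟩
    exact Realization.charMap_of_mem h _ x.2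
  · let N := fun v : Γ.obj.Interior => PlanarTreeCat.model (BorderedFatGraph.three_le_val Γ v)
    exact ⟨CubeModel.toProduct (BorderedFatGraph.overModel Γ) N,
      CubeModel.toProduct_isEquivalence _ N, CubeModel.toProduct_bijective _ N,
      CubeModel.isHomeomorph_toProduct _ N⟩
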